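/- Let $G$ be a (Hausdorff) Fréchet–Lie group with Lie algebra $\mathfrak g=T_eG$, smooth in the sense of Michal–Bastiani, which admits a smooth exponential map $\exp:\mathfrak g\to G$ (for each $X$, $t\mapsto\exp(tX)$ is a one-parameter subgroup with velocity $X$ at $t=0$). Let $\phi:U_0\to V_0\subset\mathfrak g$ be a smooth chart around $e$ with $\phi(e)=0$, $d\phi_e=\mathrm{id}$ and $V_0$ open and convex. For $x^{-1}y\in U_0$ and $s\in[0,1]$ put $\mathrm{Join}_\phi(x,y;s)=x\,\phi^{-1}(s\,\phi(x^{-1}y))$. For a neighbourhood $U$ of $e$ let $S_{n,G,U}=\{(g_0,\dots,g_n)\in G^{n+1}: g_k^{-1}g_l\in U\text{ for all }k,l\}$. The affine simplices $\sigma_n(g_0,\dots,g_n):\Delta^n\to G$ are defined by $\sigma_0(g_0)=g_0$ and $$\sigma_n(g_0,\dots,g_n)\bigl((1-s)u,s\bigr)=\mathrm{Join}_\phi\bigl(\sigma_{n-1}(g_0,\dots,g_{n-1})(u),g_n;s\bigr)\qquad(u\in\Delta^{n-1},\ s\in[0,1]).$$ Let $q\ge 0$, and fix a neighbourhood $U\subset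 U_0$ of $e$ with $U\cdot U\subset U_0$ such that for all $n\le q$ the simplex $\sigma_n$ is defined on $S_{n,G,U}$ (i.e. all joins in its definition have $x^{-1}y\in U_0$). For $0\le i\le q$ let $\lambda$ be a closed left-invariant smooth $i$-form on $G$, with value $\lambda_e$, a continuous alternating $i$-linear form on $\mathfrak g$, at $e$, and let $\mathcal F_\sigma(\lambda):S_{i,G,U}\to\mathbb R$ be the function $(g_0,\dots,g_i)\mapsto\int_{\sigma_i(g_0,\dots,g_i)}\lambda$. For an $n$-cochain $f:G^{n+1}\to\mathbb R$ that is smooth near $(e,\dots,e)$ put $$(T^nf)(X_1,\dots,X_n)=\frac{\partial^n}{\partial t_1\cdots\partial t_n}\Big|_{t=0} f\bigl(e,\exp(t_1X_1),\dots,\exp(t_1X_1)\cdots\exp(t_nX_n)\bigr),$$ $$D(f)(X_1,\dots,X_n)=\frac1{n!}\sum_{\pi\in\mathfrak S_n}\mathrm{sgn}(\pi)\,(T^nf)(X_{\pi(1)},\dots,X_{\pi(n)});$$ this depends only on $f$ near $(e,\dots,e)$. If $\Lambda\subset\mathbb R$ is a discrete subgroup, $n\ge1$, and $f$ is an $\mathbb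 R/\Lambda$-valued cochain that is smooth near $(e,\dots,e)$, then $D(f)$ is defined as $D(F)$ for any smooth real-valued lift $F$ of $f$ near $(e,\dots,e)$. Then every extension of $\mathcal F_\sigma(\lambda)$ to a function $G^{i+1}\to\mathbb R$ is smooth near $(e,\dots,e)$, and in the space $C^i_{\rm GF}(\mathfrak g)$ of Gel'fand–Fuks cochains (smooth alternating $i$-linear forms on $\mathfrak g$), which is identified with the space of left-invariant $i$-forms by $\lambda\mapsto\lambda_e$, $$\lambda_e=i!\,D(\mathcal F_\sigma(\lambda)).$$ If $i\ge1$, the same holds for $\mathcal F_\sigma(\lambda)$ modulo $\Lambda$ as an $\mathbb R/\Lambda$-valued cochain, for every discrete subgroup $\Lambda\subset\mathbb R$, for example $\Lambda=\mathbb Z$. -/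

import Mathlib

open Filter Topology Set MeasureTheory
open scoped Pointwise

noncomputable section

universe u v w

/-! ### Calculus in locally convex spaces -/

/-- A real Fréchet space: a complete, metrizable, locally convex, Hausdorff topological vector
space over `ℝ`. -/
class FrechetSpace (E : Type u) [AddCommGroup E] [Module ℝ E] [UniformSpace E] : Prop extends
    IsUniformAddGroup E, ContinuousSMul ℝ E, LocallyConvexSpace ℝ E, CompleteSpace E,
    T2Space E, IsCountablyGenerated (uniformity E)

/-- The function `f` has directional derivative `f'` at `x` in the direction `v`. -/
def HasDirDeriv {E : Type u} [AddCommGroup E] [Module ℝ E]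
    {F : Type v} [AddCommGroup F] [Module ℝ F] [TopologicalSpace F]
    (f : E → F) (x v : E) (f' : F) : Prop :=
  Tendsto (fun t : ℝ => t⁻¹ • (f (x + t • v) - f x)) (𝓝[≠] 0) (𝓝 f')

/-- `f` is of class `C^n` in the sense of Michal and Bastiani on the open set `s`: it is continuous
and, if `n = m + 1`, all directional derivatives exist on `s` and `(x, v) ↦ df(x)v` is of class
`C^m` on `s × E`. (It is only meant for open sets `s`.) -/
def BastianiContDiffOn {F : Type v} [AddCommGroup F] [Module ℝ F] [TopologicalSpace F] :
    ℕ → ∀ {E : Type u} [AddCommGroup E] [Module ℝ E] [TopologicalSpace E],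
      (E → F) → Set E → Prop
  | 0, _, _, _, _, f, s => ContinuousOn f s
  | n + 1, E, _, _, _, f, s =>
    ContinuousOn f s ∧ ∃ df : E × E → F,
      (∀ x ∈ s, ∀ v : E, HasDirDeriv f x v (df (x, v))) ∧
        BastianiContDiffOn n df (s ×ˢ (univ : Set E))

/-- Smoothness (class `C^∞`, in the sense of Michal and Bastiani) on an open set. -/
def BastianiSmoothOn {E : Type u} [AddCommGroup E] [Module ℝ E] [TopologicalSpace E]
    {F : Type v} [AddCommGroup F] [Module ℝ F] [TopologicalSpace F]
    (f : E → F) (s : Set E) : Prop :=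
  ∀ n : ℕ, BastianiContDiffOn n f s

/-- The derivative at `t = 0` of a curve in a topological vector space. -/
def curveDeriv {F : Type v} [AddCommGroup F] [Module ℝ F] [TopologicalSpace F]
    (γ : ℝ → F) : F :=
  @limUnder _ _ _ ⟨0⟩ (𝓝[≠] (0 : ℝ)) (fun t : ℝ => t⁻¹ • (γ t - γ 0))

/-! ### Manifolds and Lie groups modelled on Fréchet spaces -/

/-- Smoothness of `f : M → N` on the open set `s`, tested in a set `A` of charts covering `M` and a
set `B` of charts covering `N`. -/
def SmoothOnCharts {E : Type u} [AddCommGroup E] [Module ℝ E] [TopologicalSpace E]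
    {F : Type v} [AddCommGroup F] [Module ℝ F] [TopologicalSpace F]
    {M : Type*} [TopologicalSpace M] {N : Type*} [TopologicalSpace N]
    (A : Set (OpenPartialHomeomorph M E)) (B : Set (OpenPartialHomeomorph N F))
    (f : M → N) (s : Set M) : Prop :=
  ContinuousOn f s ∧ ∀ c ∈ A, ∀ d ∈ B,
    BastianiSmoothOn (fun x => d (f (c.symm x))) (c.target ∩ c.symm ⁻¹' (s ∩ f ⁻¹' d.source))

/-- The one-chart atlas of a topological vector space. -/
def idCharts (E : Type u) [TopologicalSpace E] : Set (OpenPartialHomeomorph E E) :=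
  {OpenPartialHomeomorph.refl E}

/-- The product charts on `G × G`. -/
def prodCharts (E : Type u) [TopologicalSpace E] (G : Type v) [TopologicalSpace G]
    [ChartedSpace E G] : Set (OpenPartialHomeomorph (G × G) (E × E)) :=
  {p | ∃ c ∈ atlas E G, ∃ d ∈ atlas E G, p = c.prod d}

/-- The product charts on `G^m`. -/
def powCharts (E : Type u) [TopologicalSpace E] (G : Type v) [TopologicalSpace G]
    [ChartedSpace E G] (m : ℕ) : Set (OpenPartialHomeomorph (Fin m → G) (Fin m → E)) :=
  {p | ∃ c : Fin m → OpenPartialHomeomorph G E,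
    (∀ k, c k ∈ atlas E G) ∧ p = OpenPartialHomeomorph.pi c}

/-- `φ` is a smooth chart: its transition maps to and from the charts of the atlas are smooth. -/
def IsSmoothChart {E : Type u} [AddCommGroup E] [Module ℝ E] [TopologicalSpace E]
    {G : Type v} [TopologicalSpace G] [ChartedSpace E G]
    (φ : OpenPartialHomeomorph G E) : Prop :=
  ∀ c ∈ atlas E G,
    BastianiSmoothOn (fun x => c (φ.symm x)) (φ.symm.trans c).source ∧
      BastianiSmoothOn (fun x => φ (c.symm x)) (c.symm.trans φ).source

/-- `G` is a Lie group modelled on `E` (a Fréchet–Lie group if `E` is a Fréchet space): the chart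
transitions, the multiplication and the inversion are smooth. -/
class FrechetLieGroup (E : Type u) [AddCommGroup E] [Module ℝ E] [TopologicalSpace E]
    (G : Type v) [Group G] [TopologicalSpace G] [ChartedSpace E G] : Prop where
  smooth_charts : ∀ c ∈ atlas E G, IsSmoothChart c
  smooth_mul : SmoothOnCharts (prodCharts E G) (atlas E G) (fun p : G × G => p.1 * p.2) univ
  smooth_inv : SmoothOnCharts (atlas E G) (atlas E G) (fun g : G => g⁻¹) univ

/-- The velocity at `t = 0` of a curve `γ` in `G`. The tangent space at each point `g` is identified
with the model space `E` by means of the preferred chart `chartAt E g` at `g`. -/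
def velocity (E : Type u) [AddCommGroup E] [Module ℝ E] [TopologicalSpace E]
    {G : Type v} [TopologicalSpace G] [ChartedSpace E G] (γ : ℝ → G) : E :=
  curveDeriv (fun t => chartAt E (γ 0) (γ t))

/-- `exp : 𝔤 → G`, with `𝔤 = T_e G = E`, is an exponential map: it is smooth, and for each `X`
the curve `t ↦ exp (t X)` is the one-parameter subgroup with velocity `X` at `t = 0`. -/
structure IsExpMap {E : Type u} [AddCommGroup E] [Module ℝ E] [TopologicalSpace E]
    {G : Type v} [Group G] [TopologicalSpace G] [ChartedSpace E G] (exp : E → G) : Prop where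
  smooth : SmoothOnCharts (idCharts E) (atlas E G) exp univ
  map_add_smul : ∀ (X : E) (s t : ℝ), exp ((s + t) • X) = exp (s • X) * exp (t • X)
  velocity_eq : ∀ X : E, velocity E (fun t => exp (t • X)) = X

/-! ### Differential forms -/

/-- A field of alternating continuous `i`-linear forms on the tangent spaces `T_g G = E`. -/
abbrev FormField (E : Type u) [AddCommGroup E] [Module ℝ E] [TopologicalSpace E]
    (G : Type v) (i : ℕ) :=
  G → E [⋀^Fin i]→L[ℝ] ℝ

section forms

variable {E : Type u} [AddCommGroup E] [Module ℝ E] [TopologicalSpace E]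
  {G : Type v} [TopologicalSpace G] [ChartedSpace E G] {i : ℕ}

/-- The expression `((c⁻¹)^* ω)_x (v₁, …, v_i)` of a form in the chart `c`. -/
def FormField.inChart (ω : FormField E G i) (c : OpenPartialHomeomorph G E)
    (x : E) (v : Fin i → E) : ℝ :=
  ω (c.symm x) (fun j => velocity E (fun t : ℝ => c.symm (x + t • v j)))

/-- Smooth differential forms. -/
def FormField.IsSmooth (ω : FormField E G i) : Prop :=
  ∀ c ∈ atlas E G, BastianiSmoothOn (fun p : E × (Fin i → E) => ω.inChart c p.1 p.2)
    (c.target ×ˢ (univ : Set (Fin i → E)))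

/-- Closed differential forms: in every chart the exterior derivative
`dω(v₀, …, v_i) = ∑ (-1)^j ∂_{v_j} (ω(v₀, …, v̂_j, …, v_i))` vanishes. -/
def FormField.IsClosed (ω : FormField E G i) : Prop :=
  ∀ c ∈ atlas E G, ∀ x ∈ c.target, ∀ v : Fin (i + 1) → E,
    ∑ j : Fin (i + 1), (-1 : ℝ) ^ (j : ℕ) *
      curveDeriv (fun t : ℝ => ω.inChart c (x + t • v j) (fun k => v (j.succAbove k))) = 0

/-- Invariance under all left translations `L_h`: `L_h^* ω = ω`. -/
def FormField.IsLeftInvariant [Group G] (ω : FormField E G i) : Prop :=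
  ∀ (h g : G) (v : Fin i → E),
    ω (h * g) (fun j => velocity E
      (fun t : ℝ => h * (chartAt E g).symm (chartAt E g g + t • v j))) = ω g v

/-- The point of `Δ^i` with barycentric coordinates `(1 - ∑ x_j, x₁, …, x_i)`. -/
def simplexPoint {i : ℕ} (x : Fin i → ℝ) : Fin (i + 1) → ℝ :=
  Fin.cons (1 - ∑ j, x j) x

/-- The integral of the form `ω` over a simplex `τ : Δ^i → G`, given in barycentric coordinates.
The simplex is parametrized by its last `i` barycentric coordinates `x₁, …, x_i`, with the
orientation `dx₁ ∧ … ∧ dx_i`; the boundary is left out, being a null set. -/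
def FormField.integral (ω : FormField E G i) (τ : (Fin (i + 1) → ℝ) → G) : ℝ :=
  ∫ x in {x : Fin i → ℝ | (∀ j, 0 < x j) ∧ ∑ j, x j < 1},
    ω (τ (simplexPoint x)) (fun j =>
      velocity E (fun t : ℝ => τ (simplexPoint (x + t • (Pi.single j 1 : Fin i → ℝ)))))

end forms

/-! ### The affine filling -/

section filling

variable {E : Type u} [AddCommGroup E] [Module ℝ E] [TopologicalSpace E]
  {G : Type v} [Group G] [TopologicalSpace G]

/-- A smooth chart `φ : U₀ → V₀` at the identity `e`, with `φ(e) = 0`, `dφ_e = id` and `V₀`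
convex. Here `U₀ = φ.source` and `V₀ = φ.target`. -/
structure IsConvexChart [ChartedSpace E G] (φ : OpenPartialHomeomorph G E) : Prop where
  smooth : IsSmoothChart φ
  one_mem : (1 : G) ∈ φ.source
  map_one : φ 1 = 0
  deriv_one : ∀ v : E, curveDeriv
    (fun t : ℝ => φ ((chartAt E (1 : G)).symm (chartAt E (1 : G) 1 + t • v))) = v
  convex : Convex ℝ φ.target

/-- The set `S_{n,G,U}` of `U`-small `(n+1)`-tuples. -/
def smallTuples (U : Set G) (n : ℕ) : Set (Fin (n + 1) → G) :=
  {g | ∀ k l, (g k)⁻¹ * g l ∈ U}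

/-- `Join_φ(x, y; s) = x φ⁻¹(s φ(x⁻¹ y))`, for `x⁻¹ y ∈ U₀` and `0 ≤ s ≤ 1`. -/
def affineJoin (φ : OpenPartialHomeomorph G E) (x y : G) (s : ℝ) : G :=
  x * φ.symm (s • φ (x⁻¹ * y))

/-- The affine simplices: `σ_0(g_0) = g_0` and
`σ_n(g_0, …, g_n)((1 - s) u, s) = Join_φ(σ_{n-1}(g_0, …, g_{n-1})(u), g_n; s)`,
in barycentric coordinates. -/
def affineSimplex (φ : OpenPartialHomeomorph G E) :
    (n : ℕ) → (Fin (n + 1) → G) → (Fin (n + 1) → ℝ) → G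
  | 0, g, _ => g 0
  | n + 1, g, b =>
    if b (Fin.last (n + 1)) = 1 then g (Fin.last (n + 1))
    else affineJoin φ
      (affineSimplex φ n (fun k => g k.castSucc)
        (fun k => b k.castSucc / (1 - b (Fin.last (n + 1)))))
      (g (Fin.last (n + 1))) (b (Fin.last (n + 1)))

/-- `U` is a neighbourhood of `e` with `U · U ⊆ U₀` such that for `n ≤ q` the affine simplices `σ_n`
are defined on the `U`-small tuples: all the joins that occur satisfy `x⁻¹ y ∈ U₀`. -/
structure IsFillingNhd (φ : OpenPartialHomeomorph G E) (q : ℕ) (U : Set G) : Prop where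
  mem_nhds : U ∈ 𝓝 (1 : G)
  subset : U ⊆ φ.source
  mul_subset : U * U ⊆ φ.source
  join_defined : ∀ n, n + 1 ≤ q → ∀ g ∈ smallTuples U (n + 1), ∀ u ∈ stdSimplex ℝ (Fin (n + 1)),
    (affineSimplex φ n (fun k => g k.castSucc) u)⁻¹ * g (Fin.last (n + 1)) ∈ φ.source

/-- The cochain `𝓕_σ(ω) : S_{i,G,U} → ℝ`, `(g_0, …, g_i) ↦ ∫_{σ_i(g_0, …, g_i)} ω`. -/
def fillingCochain [ChartedSpace E G] (φ : OpenPartialHomeomorph G E) (U : Set G) {i : ℕ}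
    (ω : FormField E G i) (g : smallTuples U i) : ℝ :=
  ω.integral (affineSimplex φ i g)

end filling

/-! ### Locally smooth cochains and the differentiation map -/

section cochains

/-- Locally smooth real-valued cochains on `G`: those that are smooth on an open set around
`(e, …, e)`. -/
def IsLocallySmooth (E : Type u) [AddCommGroup E] [Module ℝ E] [TopologicalSpace E]
    {G : Type v} [Group G] [TopologicalSpace G] [ChartedSpace E G] {n : ℕ}
    (f : (Fin (n + 1) → G) → ℝ) : Prop :=
  ∃ W : Set (Fin (n + 1) → G), IsOpen W ∧ (fun _ => 1) ∈ W ∧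
    SmoothOnCharts (powCharts E G (n + 1)) (idCharts ℝ) f W

/-- `F` is a smooth real-valued lift, near `(e, …, e)`, of the `ℝ/Λ`-valued cochain `f`. For
discrete `Λ` the cochain `f` is locally smooth if and only if it has such a lift. -/
def IsSmoothLift (E : Type u) [AddCommGroup E] [Module ℝ E] [TopologicalSpace E]
    {G : Type v} [Group G] [TopologicalSpace G] [ChartedSpace E G] {Λ : AddSubgroup ℝ} {n : ℕ}
    (f : (Fin (n + 1) → G) → ℝ ⧸ Λ) (F : (Fin (n + 1) → G) → ℝ) : Prop :=
  IsLocallySmooth E F ∧ ∀ᶠ g in 𝓝 (fun _ => (1 : G)), f g = (F g : ℝ ⧸ Λ)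

variable {E : Type u} [AddCommGroup E] [Module ℝ E] {G : Type v} [Group G] {n : ℕ}

/-- `Φ_f(X₁, …, X_n) = f(e, exp X₁, exp X₁ exp X₂, …, exp X₁ ⋯ exp X_n)`. -/
def cochainInExp (exp : E → G) (f : (Fin (n + 1) → G) → ℝ) (X : Fin n → E) : ℝ :=
  f (Fin.partialProd (fun k => exp (X k)))

/-- `(T^n f)(X₁, …, X_n)`, the value at `t = 0` of
`∂^n/∂t₁⋯∂t_n Φ_f(t₁ X₁, …, t_n X_n)`. -/
def iteratedDirDeriv (exp : E → G) (f : (Fin (n + 1) → G) → ℝ) (X : Fin n → E) : ℝ :=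
  iteratedFDeriv ℝ n (fun t : Fin n → ℝ => cochainInExp exp f (fun k => t k • X k)) 0
    (fun k => Pi.single k 1)

/-- The differentiation map `D`: the alternation of `T^n f`. -/
def differentiation (exp : E → G) (f : (Fin (n + 1) → G) → ℝ) (X : Fin n → E) : ℝ :=
  (n.factorial : ℝ)⁻¹ * ∑ π : Equiv.Perm (Fin n),
    ((Equiv.Perm.sign π : ℤ) : ℝ) * iteratedDirDeriv exp f (fun k => X (π k))

end cochains

end

/-!
In the join parameters `s₁, …, s_i` of the iterated joins, the affine simplex is a smooth map
`cubeSimplex` on the closed cube `[0, 1]^i`, which depends smoothly on its vertices. In barycentric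
coordinates it is singular on a part of the boundary. The change of variables `joinCoord` between
the open simplex and the open cube has a triangular derivative with positive determinant, so the
filling cochain is, near the identity, the integral over the closed cube of a density that depends
smoothly on the vertices (`integral_affineSimplex_eq`), and differentiation under the integral sign
shows that it is smooth (`smoothAt_integralInChart`).

For the value of the mixed derivative, let the vertices move along curves `ε ↦ g_k(ε)` through the
identity with velocities `Y_k`. Each of the `i` tangent vectors of the simplex vanishes at `ε = 0`.
Divided by `ε` it converges, jointly with the point of the cube and by the symmetry of second
derivatives, to the tangent vector of the linear cone over the `Y_k`. This cone is the affine
simplex of the vector space, because the derivative of the group multiplication at the identity is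
the addition. Hence the integral is `ε^i (ω_e(Y_1 - Y_0, …, Y_i - Y_0) / i! + o(1))`
(`tendsto_integralInChart_div`), where `1 / i!` is the volume of the simplex. For the vertices
`e, exp(εt₁X₁), exp(εt₁X₁) exp(εt₂X₂), …` the vectors `Y_j - Y_0` are the partial sums of the
`t_k X_k`, and the leading coefficient is `t₁ ⋯ t_i ω_e(X_1, …, X_i) / i!`. By Taylor's formula and
the polarization of the `i`-th derivative (`ContDiffAt.iteratedFDeriv_single_eq`) the mixed
derivative is `ω_e(X_1, …, X_i) / i!`. This is already alternating, so antisymmetrization does not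
change it.

Two continuous real lifts of an `ℝ/Λ`-valued cochain differ by a constant near the identity, since
`Λ` is discrete (`exists_eventually_eq_add`), and a constant has no mixed derivative of order
`i ≥ 1`.

As the modelling spaces are not normed, the differential calculus of Michal and Bastiani is
developed from its definition. All of it rests on the joint continuity of the difference quotients
of `C¹` maps (`tendsto_diffQuotient`), which follows from a mean value theorem.
-/

noncomputable section

universe u v w

set_option linter.unusedSectionVars false

/-! ### Directional derivatives and the mean value theorem -/

section calculus

variable {E : Type u} [AddCommGroup E] [Module ℝ E] [TopologicalSpace E]
  {F : Type v} [AddCommGroup F] [Module ℝ F] [TopologicalSpace F]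
  {H : Type w} [AddCommGroup H] [Module ℝ H] [TopologicalSpace H]

/-- The curve `γ` in a topological vector space has derivative `v` at `t = 0`. -/
def HasCurveDeriv (γ : ℝ → F) (v : F) : Prop :=
  Tendsto (fun t : ℝ => t⁻¹ • (γ t - γ 0)) (𝓝[≠] 0) (𝓝 v)

/-- The directional derivative `df(x)v` as a function of the pair `(x, v)`. It is a junk value
where the limit of the difference quotients does not exist. -/
def dirDeriv (f : E → F) (p : E × E) : F :=
  curveDeriv (fun t : ℝ => f (p.1 + t • p.2))

theorem hasDirDeriv_iff_hasCurveDeriv {f : E → F} {x v : E} {d : F} :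
    HasDirDeriv f x v d ↔ HasCurveDeriv (fun t : ℝ => f (x + t • v)) d := by
  simp [HasDirDeriv, HasCurveDeriv]

theorem HasCurveDeriv.curveDeriv_eq [T2Space F] {γ : ℝ → F} {v : F} (h : HasCurveDeriv γ v) :
    curveDeriv γ = v :=
  Tendsto.limUnder_eq h

theorem HasCurveDeriv.unique [T2Space F] {γ : ℝ → F} {v w : F} (h : HasCurveDeriv γ v)
    (h' : HasCurveDeriv γ w) : v = w :=
  tendsto_nhds_unique h h'

theorem HasDirDeriv.dirDeriv_eq [T2Space F] {f : E → F} {x v : E} {d : F}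
    (h : HasDirDeriv f x v d) : dirDeriv f (x, v) = d :=
  (hasDirDeriv_iff_hasCurveDeriv.1 h).curveDeriv_eq

theorem HasCurveDeriv.congr {γ δ : ℝ → F} {v : F} (h : HasCurveDeriv γ v)
    (hγ : γ =ᶠ[𝓝 0] δ) : HasCurveDeriv δ v := by
  have h0 : γ 0 = δ 0 := hγ.self_of_nhds
  refine Tendsto.congr' ?_ h
  filter_upwards [hγ.filter_mono nhdsWithin_le_nhds] with t ht
  rw [ht, h0]

theorem curveDeriv_congr {γ δ : ℝ → F} (hγ : γ =ᶠ[𝓝 0] δ) : curveDeriv γ = curveDeriv δ := by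
  have h0 : γ 0 = δ 0 := hγ.self_of_nhds
  unfold curveDeriv limUnder
  congr 1
  refine Filter.map_congr ?_
  filter_upwards [hγ.filter_mono nhdsWithin_le_nhds] with t ht
  rw [ht, h0]

theorem tendsto_add_smul_nhds_zero [ContinuousAdd E] [ContinuousSMul ℝ E] (x v : E) :
    Tendsto (fun t : ℝ => x + t • v) (𝓝 0) (𝓝 x) := by
  have : Continuous (fun t : ℝ => x + t • v) := by fun_prop
  simpa using this.tendsto 0

theorem HasDirDeriv.congr [ContinuousAdd E] [ContinuousSMul ℝ E] {f g : E → F} {x v : E} {d : F}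
    (h : HasDirDeriv f x v d) (hfg : f =ᶠ[𝓝 x] g) : HasDirDeriv g x v d := by
  rw [hasDirDeriv_iff_hasCurveDeriv] at h ⊢
  exact h.congr ((tendsto_add_smul_nhds_zero x v).eventually hfg)

/-- **Mean value theorem**, for difference quotients in a locally convex space. By Hahn–Banach it
reduces to the scalar case. -/
theorem inv_smul_sub_mem_of_hasDirDeriv [IsTopologicalAddGroup F] [ContinuousSMul ℝ F]
    [LocallyConvexSpace ℝ F] {f : E → F} {x v : E} {t : ℝ} (ht : t ≠ 0) {C : Set F}
    (hC : Convex ℝ C) (hC' : IsClosed C)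
    (h : ∀ r ∈ Icc (0 : ℝ) 1, ∃ d ∈ C, HasDirDeriv f (x + (r * t) • v) v d) :
    t⁻¹ • (f (x + t • v) - f x) ∈ C := by
  by_contra hn
  obtain ⟨l, u, hl, hu⟩ := geometric_hahn_banach_closed_point hC hC' hn
  choose! d hdC hd using h
  have hder : ∀ r ∈ Icc (0 : ℝ) 1,
      HasDerivAt (fun r : ℝ => t⁻¹ * l (f (x + (r * t) • v))) (l (d r)) r := by
    intro r hr
    have h1 : HasDerivAt (fun a : ℝ => l (f (x + a • v))) (l (d r)) (r * t) := by
      rw [hasDerivAt_iff_tendsto_slope_zero]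
      have := (l.continuous.tendsto _).comp (hd r hr)
      refine this.congr fun a => ?_
      simp [add_smul, add_assoc]
    have h2 := (h1.comp r ((hasDerivAt_id r).mul_const t)).const_mul t⁻¹
    rw [show t⁻¹ * (l (d r) * (1 * t)) = l (d r) by field_simp] at h2
    exact h2
  obtain ⟨r, hr, hr'⟩ := exists_hasDerivAt_eq_slope
    (fun r : ℝ => t⁻¹ * l (f (x + (r * t) • v))) (fun r => l (d r)) zero_lt_one
    (fun r hr => (hder r hr).continuousAt.continuousWithinAt)
    (fun r hr => hder r ⟨hr.1.le, hr.2.le⟩)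
  have h3 := hl _ (hdC r ⟨hr.1.le, hr.2.le⟩)
  simp only [one_mul, zero_mul, zero_smul, add_zero, sub_zero, div_one] at hr'
  rw [map_smul, map_sub, smul_eq_mul, mul_sub, ← hr'] at hu
  exact lt_asymm h3 hu

theorem exists_isClosed_convex_mem_nhds [IsTopologicalAddGroup F] [ContinuousSMul ℝ F]
    [LocallyConvexSpace ℝ F] {y : F} {N : Set F} (hN : N ∈ 𝓝 y) :
    ∃ C ∈ 𝓝 y, IsClosed C ∧ Convex ℝ C ∧ C ⊆ N := by
  obtain ⟨N', ⟨hN', hcl⟩, hsub⟩ := (closed_nhds_basis y).mem_iff.1 hN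
  obtain ⟨C, ⟨hC, hconv⟩, hsub'⟩ := (LocallyConvexSpace.convex_basis (𝕜 := ℝ) y).mem_iff.1 hN'
  exact ⟨closure C, mem_of_superset hC subset_closure, isClosed_closure, hconv.closure,
    (closure_minimal hsub' hcl).trans hsub⟩

/-- The difference quotients of a `C¹` function converge to the derivative jointly in the base
point, the direction and the increment. -/
theorem tendsto_diffQuotient [IsTopologicalAddGroup E] [ContinuousSMul ℝ E]
    [IsTopologicalAddGroup F] [ContinuousSMul ℝ F]
    [LocallyConvexSpace ℝ F] {f : E → F} {x v : E} {df : E × E → F}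
    (hd : ∀ᶠ y in 𝓝 x, ∀ w, HasDirDeriv f y w (df (y, w))) (hc : ContinuousAt df (x, v)) :
    Tendsto (fun p : (E × E) × ℝ => p.2⁻¹ • (f (p.1.1 + p.2 • p.1.2) - f p.1.1))
      (𝓝 (x, v) ×ˢ 𝓝[≠] 0) (𝓝 (df (x, v))) := by
  intro N hN
  obtain ⟨C, hC, hcl, hconv, hsub⟩ := exists_isClosed_convex_mem_nhds hN
  have key : ∀ᶠ p : (E × E) × ℝ in 𝓝 ((x, v), 0), ∀ r ∈ Icc (0 : ℝ) 1,
      (∀ w, HasDirDeriv f (p.1.1 + (r * p.2) • p.1.2) w (df (p.1.1 + (r * p.2) • p.1.2, w))) ∧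
      df (p.1.1 + (r * p.2) • p.1.2, p.1.2) ∈ C := by
    refine isCompact_Icc.eventually_forall_of_forall_eventually fun r _ => ?_
    have hcont : Continuous (fun z : ((E × E) × ℝ) × ℝ =>
        (z.1.1.1 + (z.2 * z.1.2) • z.1.1.2, z.1.1.2)) := by fun_prop
    have ht := hcont.tendsto (((x, v), 0), r)
    simp only [mul_zero, zero_smul, add_zero] at ht
    exact ((((continuous_fst.tendsto (x, v)).comp ht).eventually hd).and
      (ht.eventually (hc.eventually hC)))
  have hle : 𝓝 (x, v) ×ˢ 𝓝[≠] (0 : ℝ) ≤ 𝓝 ((x, v), 0) := by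
    rw [nhds_prod_eq (x := (x, v))]
    exact Filter.prod_mono le_rfl nhdsWithin_le_nhds
  have hne : ∀ᶠ p : (E × E) × ℝ in 𝓝 (x, v) ×ˢ 𝓝[≠] (0 : ℝ), p.2 ≠ 0 :=
    tendsto_snd.eventually eventually_mem_nhdsWithin
  rw [mem_map]
  filter_upwards [hle key, hne] with p hp hp0
  exact hsub (inv_smul_sub_mem_of_hasDirDeriv hp0 hconv hcl
    fun r hr => ⟨_, (hp r hr).2, (hp r hr).1 _⟩)

/-! ### Maps of class `C^n` in the sense of Michal and Bastiani -/

theorem BastianiContDiffOn.continuousOn {n : ℕ} {f : E → F} {s : Set E}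
    (h : BastianiContDiffOn n f s) : ContinuousOn f s := by
  cases n with
  | zero => exact h
  | succ n => exact h.1

theorem BastianiContDiffOn.congr [ContinuousAdd E] [ContinuousSMul ℝ E]
    {n : ℕ} {f g : E → F} {s : Set E} (h : BastianiContDiffOn n f s)
    (hs : IsOpen s) (hfg : EqOn f g s) : BastianiContDiffOn n g s := by
  cases n with
  | zero => exact ContinuousOn.congr h hfg.symm
  | succ n =>
    obtain ⟨hc, df, hd, hdf⟩ := h
    exact ⟨hc.congr hfg.symm, df, fun x hx v =>
      (hd x hx v).congr (hfg.eventuallyEq_of_mem (hs.mem_nhds hx)), hdf⟩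

theorem BastianiContDiffOn.mono : ∀ {n : ℕ} {E : Type u} [AddCommGroup E] [Module ℝ E]
    [TopologicalSpace E] {f : E → F} {s t : Set E},
    BastianiContDiffOn n f s → t ⊆ s → BastianiContDiffOn n f t
  | 0, _, _, _, _, _, _, _, h, hts => ContinuousOn.mono h hts
  | _ + 1, _, _, _, _, _, _, _, ⟨hc, df, hd, hdf⟩, hts =>
    ⟨hc.mono hts, df, fun x hx => hd x (hts hx), hdf.mono (prod_mono hts Subset.rfl)⟩

theorem bastianiContDiffOn_succ_iff [IsTopologicalAddGroup E] [ContinuousSMul ℝ E] [T2Space F]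
    {n : ℕ} {f : E → F} {s : Set E} (hs : IsOpen s) :
    BastianiContDiffOn (n + 1) f s ↔ ContinuousOn f s ∧
      (∀ x ∈ s, ∀ v : E, HasDirDeriv f x v (dirDeriv f (x, v))) ∧
      BastianiContDiffOn n (dirDeriv f) (s ×ˢ (univ : Set E)) := by
  constructor
  · rintro ⟨hc, df, hd, hdf⟩
    refine ⟨hc, fun x hx v => by rw [(hd x hx v).dirDeriv_eq]; exact hd x hx v, ?_⟩
    exact hdf.congr (hs.prod isOpen_univ) fun p hp => ((hd p.1 hp.1 p.2).dirDeriv_eq).symm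
  · rintro ⟨hc, hd, hdf⟩
    exact ⟨hc, _, hd, hdf⟩

/-- Being of class `C^n` is a local property. -/
theorem bastianiContDiffOn_of_locally [T2Space F] : ∀ {n : ℕ} {E : Type u} [AddCommGroup E]
    [Module ℝ E] [TopologicalSpace E] [IsTopologicalAddGroup E] [ContinuousSMul ℝ E]
    {f : E → F} {s : Set E},
    (∀ x ∈ s, ∃ t, IsOpen t ∧ x ∈ t ∧ BastianiContDiffOn n f t) → BastianiContDiffOn n f s := by
  intro n
  induction n with
  | zero =>
    intro E _ _ _ _ _ f s h x hx
    obtain ⟨t, ht, hxt, hf⟩ := h x hx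
    exact (ContinuousOn.continuousAt hf (ht.mem_nhds hxt)).continuousWithinAt
  | succ n ih =>
    intro E _ _ _ _ _ f s h
    refine ⟨fun x hx => ?_, dirDeriv f, fun x hx v => ?_, ih fun p hp => ?_⟩
    · obtain ⟨t, ht, hxt, hf⟩ := h x hx
      exact (hf.continuousOn.continuousAt (ht.mem_nhds hxt)).continuousWithinAt
    · obtain ⟨t, ht, hxt, hf⟩ := h x hx
      exact ((bastianiContDiffOn_succ_iff ht).1 hf).2.1 x hxt v
    · obtain ⟨t, ht, hxt, hf⟩ := h p.1 hp.1
      exact ⟨t ×ˢ univ, ht.prod isOpen_univ, ⟨hxt, mem_univ _⟩,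
        ((bastianiContDiffOn_succ_iff ht).1 hf).2.2⟩

theorem BastianiContDiffOn.of_succ [IsTopologicalAddGroup E] [ContinuousSMul ℝ E]
    {n : ℕ} {f : E → F} {s : Set E} (h : BastianiContDiffOn (n + 1) f s) :
    BastianiContDiffOn n f s := by
  induction n generalizing E with
  | zero => exact h.1
  | succ n ih =>
    obtain ⟨hc, df, hd, hdf⟩ := h
    exact ⟨hc, df, hd, ih hdf⟩

theorem BastianiContDiffOn.tendsto_diffQuotient [IsTopologicalAddGroup E] [ContinuousSMul ℝ E]
    [IsTopologicalAddGroup F] [ContinuousSMul ℝ F] [LocallyConvexSpace ℝ F] [T2Space F]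
    {n : ℕ} {f : E → F} {s : Set E} (h : BastianiContDiffOn (n + 1) f s) (hs : IsOpen s)
    {x : E} (hx : x ∈ s) (v : E) :
    Tendsto (fun p : (E × E) × ℝ => p.2⁻¹ • (f (p.1.1 + p.2 • p.1.2) - f p.1.1))
      (𝓝 (x, v) ×ˢ 𝓝[≠] 0) (𝓝 (dirDeriv f (x, v))) := by
  rw [bastianiContDiffOn_succ_iff hs] at h
  exact _root_.tendsto_diffQuotient (eventually_of_mem (hs.mem_nhds hx) h.2.1)
    (h.2.2.continuousOn.continuousAt ((hs.prod isOpen_univ).mem_nhds ⟨hx, mem_univ _⟩))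

/-- **Chain rule** along a curve which is merely differentiable at `t = 0`. -/
theorem BastianiContDiffOn.comp_hasCurveDeriv [IsTopologicalAddGroup E] [ContinuousSMul ℝ E]
    [IsTopologicalAddGroup F] [ContinuousSMul ℝ F] [LocallyConvexSpace ℝ F] [T2Space F]
    {n : ℕ} {f : E → F} {s : Set E} (h : BastianiContDiffOn (n + 1) f s) (hs : IsOpen s)
    {γ : ℝ → E} {v : E} (hx : γ 0 ∈ s) (hγ : HasCurveDeriv γ v) :
    HasCurveDeriv (fun t => f (γ t)) (dirDeriv f (γ 0, v)) := by
  have h1 : Tendsto (fun t : ℝ => ((γ 0, t⁻¹ • (γ t - γ 0)), t)) (𝓝[≠] 0)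
      (𝓝 (γ 0, v) ×ˢ 𝓝[≠] 0) := by
    rw [nhds_prod_eq]
    exact (tendsto_const_nhds.prodMk hγ).prodMk tendsto_id
  refine ((h.tendsto_diffQuotient hs hx v).comp h1).congr' ?_
  filter_upwards [eventually_mem_nhdsWithin] with t (ht : t ≠ 0)
  simp [smul_inv_smul₀ ht]

theorem BastianiContDiffOn.dirDeriv_add [IsTopologicalAddGroup E] [ContinuousSMul ℝ E]
    [IsTopologicalAddGroup F] [ContinuousSMul ℝ F] [LocallyConvexSpace ℝ F] [T2Space F]
    {n : ℕ} {f : E → F} {s : Set E} (h : BastianiContDiffOn (n + 1) f s) (hs : IsOpen s)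
    {x : E} (hx : x ∈ s) (v w : E) :
    dirDeriv f (x, v + w) = dirDeriv f (x, v) + dirDeriv f (x, w) := by
  have hd := ((bastianiContDiffOn_succ_iff hs).1 h).2.1 x hx
  have h1 : Tendsto (fun t : ℝ => ((x + t • v, w), t)) (𝓝[≠] 0) (𝓝 (x, w) ×ˢ 𝓝[≠] 0) := by
    rw [nhds_prod_eq]
    exact (((tendsto_add_smul_nhds_zero x v).mono_left nhdsWithin_le_nhds).prodMk
      tendsto_const_nhds).prodMk tendsto_id
  refine tendsto_nhds_unique (hd (v + w))
    (((hd v).add ((h.tendsto_diffQuotient hs hx w).comp h1)).congr fun t => ?_)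
  simp only [Function.comp_apply, ← smul_add, add_assoc]
  congr 1
  abel

theorem BastianiContDiffOn.dirDeriv_smul [IsTopologicalAddGroup E] [ContinuousSMul ℝ E]
    [IsTopologicalAddGroup F] [ContinuousSMul ℝ F] [LocallyConvexSpace ℝ F] [T2Space F]
    {n : ℕ} {f : E → F} {s : Set E} (h : BastianiContDiffOn (n + 1) f s) (hs : IsOpen s)
    {x : E} (hx : x ∈ s) (a : ℝ) (v : E) :
    dirDeriv f (x, a • v) = a • dirDeriv f (x, v) := by
  have hd := ((bastianiContDiffOn_succ_iff hs).1 h).2.1 x hx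
  rcases eq_or_ne a 0 with rfl | ha
  · refine tendsto_nhds_unique (hd ((0 : ℝ) • v)) ?_
    simp
  · have h1 : Tendsto (fun t : ℝ => t * a) (𝓝[≠] 0) (𝓝[≠] 0) := by
      refine tendsto_nhdsWithin_iff.2 ⟨?_, ?_⟩
      · have : Continuous fun t : ℝ => t * a := by fun_prop
        simpa using (this.tendsto 0).mono_left nhdsWithin_le_nhds
      · filter_upwards [eventually_mem_nhdsWithin] with t (ht : t ≠ 0)
        exact mul_ne_zero ht ha
    refine tendsto_nhds_unique (hd (a • v)) ((((hd v).comp h1).const_smul a).congr fun t => ?_)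
    simp only [Function.comp_apply, smul_smul, mul_inv]
    congr 1
    rcases eq_or_ne t 0 with rfl | ht
    · simp
    · field_simp

/-- The derivative of a map into a product. -/
theorem HasDirDeriv.prodMk {f : E → F} {g : E → H} {x v : E} {d : F} {e : H}
    (hf : HasDirDeriv f x v d) (hg : HasDirDeriv g x v e) :
    HasDirDeriv (fun y => (f y, g y)) x v (d, e) := by
  simpa [HasDirDeriv] using Tendsto.prodMk_nhds hf hg

theorem HasDirDeriv.pi {ι : Type*} {f : ι → E → F} {x v : E} {d : ι → F}
    (hf : ∀ k, HasDirDeriv (f k) x v (d k)) :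
    HasDirDeriv (fun y k => f k y) x v d :=
  tendsto_pi_nhds.2 hf

theorem HasDirDeriv.comp [IsTopologicalAddGroup F] [ContinuousSMul ℝ F]
    [IsTopologicalAddGroup H] [ContinuousSMul ℝ H] [LocallyConvexSpace ℝ H] [T2Space H]
    {n : ℕ} {g : F → H} {t : Set F} (hg : BastianiContDiffOn (n + 1) g t) (ht : IsOpen t)
    {f : E → F} {x v : E} {d : F} (hf : HasDirDeriv f x v d) (hx : f x ∈ t) :
    HasDirDeriv (fun y => g (f y)) x v (dirDeriv g (f x, d)) := by
  rw [hasDirDeriv_iff_hasCurveDeriv] at hf ⊢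
  have := hg.comp_hasCurveDeriv ht (γ := fun r : ℝ => f (x + r • v)) (by simpa using hx) hf
  simpa using this

theorem bastianiContDiffOn_clm [IsTopologicalAddGroup E] [ContinuousSMul ℝ E] (n : ℕ)
    (L : E →L[ℝ] F) (s : Set E) : BastianiContDiffOn n L s := by
  induction n generalizing E with
  | zero => exact L.continuous.continuousOn
  | succ n ih =>
    refine ⟨L.continuous.continuousOn, L ∘L ContinuousLinearMap.snd ℝ E E, fun x _ v => ?_, ih _ _⟩
    refine tendsto_const_nhds.congr' ?_
    filter_upwards [eventually_mem_nhdsWithin] with t (ht : t ≠ 0)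
    simp [inv_smul_smul₀ ht]

theorem bastianiContDiffOn_const [IsTopologicalAddGroup E] [ContinuousSMul ℝ E] (n : ℕ)
    (c : F) (s : Set E) : BastianiContDiffOn n (fun _ => c) s := by
  cases n with
  | zero => exact continuousOn_const
  | succ n =>
    refine ⟨continuousOn_const, fun _ => 0, fun x _ v => by
      simpa [HasDirDeriv] using tendsto_const_nhds, ?_⟩
    exact bastianiContDiffOn_clm n (0 : E × E →L[ℝ] F) _

theorem BastianiContDiffOn.prodMk {n : ℕ} {f : E → F} {g : E → H} {s : Set E}
    (hf : BastianiContDiffOn n f s) (hg : BastianiContDiffOn n g s) :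
    BastianiContDiffOn n (fun x => (f x, g x)) s := by
  induction n generalizing E with
  | zero => exact ContinuousOn.prodMk hf hg
  | succ n ih =>
    obtain ⟨hc, df, hd, hdf⟩ := hf
    obtain ⟨hc', dg, hd', hdg⟩ := hg
    exact ⟨hc.prodMk hc', _, fun x hx v => (hd x hx v).prodMk (hd' x hx v), ih hdf hdg⟩

theorem BastianiContDiffOn.pi {ι : Type*} {n : ℕ} {f : ι → E → F} {s : Set E}
    (hf : ∀ k, BastianiContDiffOn n (f k) s) :
    BastianiContDiffOn n (fun x k => f k x) s := by
  induction n generalizing E with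
  | zero => exact continuousOn_pi.2 hf
  | succ n ih =>
    choose hc df hd hdf using hf
    exact ⟨continuousOn_pi.2 hc, _, fun x hx v => HasDirDeriv.pi fun k => hd k x hx v, ih hdf⟩

theorem BastianiContDiffOn.comp_clm {n : ℕ} {f : F → H} {t : Set F}
    (hf : BastianiContDiffOn n f t) (L : E →L[ℝ] F) :
    BastianiContDiffOn n (fun x => f (L x)) (L ⁻¹' t) := by
  induction n generalizing E F with
  | zero => exact ContinuousOn.comp hf L.continuous.continuousOn fun _ hx => hx
  | succ n ih =>
    obtain ⟨hc, df, hd, hdf⟩ := hf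
    refine ⟨hc.comp L.continuous.continuousOn fun _ hx => hx, fun p => df (L.prodMap L p),
      fun x hx v => ?_, (ih hdf (L.prodMap L)).mono fun p hp => ⟨hp.1, mem_univ _⟩⟩
    simpa [HasDirDeriv] using hd (L x) hx (L v)

/-- **Chain rule**: compositions of `C^n` maps are of class `C^n`. -/
theorem BastianiContDiffOn.comp [IsTopologicalAddGroup E] [ContinuousSMul ℝ E]
    [IsTopologicalAddGroup F] [ContinuousSMul ℝ F]
    [IsTopologicalAddGroup H] [ContinuousSMul ℝ H] [LocallyConvexSpace ℝ H] [T2Space H]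
    {n : ℕ} {g : F → H} {t : Set F} (hg : BastianiContDiffOn n g t)
    {f : E → F} {s : Set E} (hf : BastianiContDiffOn n f s) (ht : IsOpen t)
    (hst : MapsTo f s t) : BastianiContDiffOn n (fun x => g (f x)) s := by
  induction n generalizing E F H with
  | zero => exact ContinuousOn.comp hg hf hst
  | succ n ih =>
    refine ⟨hg.continuousOn.comp hf.continuousOn hst, ?_⟩
    have hg' := ((bastianiContDiffOn_succ_iff ht).1 hg).2.2
    have hf1 := hf.of_succ
    obtain ⟨hc, df, hd, hdf⟩ := hf
    refine ⟨fun p => dirDeriv g (f p.1, df p), fun x hx v =>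
      (hd x hx v).comp hg ht (hst hx), ?_⟩
    refine ih hg' (BastianiContDiffOn.prodMk ?_ hdf) (ht.prod isOpen_univ)
      fun p hp => ⟨hst hp.1, mem_univ _⟩
    exact (hf1.comp_clm (ContinuousLinearMap.fst ℝ E E)).mono fun p hp => hp.1

end calculus

/-! ### Smoothness near a point -/

section smoothAt

variable {E : Type u} [AddCommGroup E] [Module ℝ E] [TopologicalSpace E]
  [IsTopologicalAddGroup E] [ContinuousSMul ℝ E] [LocallyConvexSpace ℝ E] [T2Space E]
  {F : Type v} [AddCommGroup F] [Module ℝ F] [TopologicalSpace F]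
  [IsTopologicalAddGroup F] [ContinuousSMul ℝ F] [LocallyConvexSpace ℝ F] [T2Space F]
  {H : Type w} [AddCommGroup H] [Module ℝ H] [TopologicalSpace H]
  [IsTopologicalAddGroup H] [ContinuousSMul ℝ H] [LocallyConvexSpace ℝ H] [T2Space H]

/-- `f` is smooth on some open neighbourhood of `x`. -/
def BastianiSmoothAt {E : Type u} [AddCommGroup E] [Module ℝ E] [TopologicalSpace E]
    {F : Type v} [AddCommGroup F] [Module ℝ F] [TopologicalSpace F] (f : E → F) (x : E) : Prop :=
  ∃ s, IsOpen s ∧ x ∈ s ∧ BastianiSmoothOn f s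

theorem BastianiSmoothOn.smoothAt {f : E → F} {s : Set E} (h : BastianiSmoothOn f s)
    (hs : IsOpen s) {x : E} (hx : x ∈ s) : BastianiSmoothAt f x :=
  ⟨s, hs, hx, h⟩

theorem bastianiSmoothOn_of_forall {f : E → F} {s : Set E}
    (h : ∀ x ∈ s, BastianiSmoothAt f x) : BastianiSmoothOn f s := fun n =>
  bastianiContDiffOn_of_locally fun x hx =>
    let ⟨t, ht, hxt, hf⟩ := h x hx
    ⟨t, ht, hxt, hf n⟩

theorem BastianiSmoothAt.eventually {f : E → F} {x : E} (h : BastianiSmoothAt f x) :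
    ∀ᶠ y in 𝓝 x, BastianiSmoothAt f y :=
  let ⟨_, hs, hx, hf⟩ := h
  eventually_of_mem (hs.mem_nhds hx) fun _ hy => hf.smoothAt hs hy

theorem BastianiSmoothAt.continuousAt {f : E → F} {x : E} (h : BastianiSmoothAt f x) :
    ContinuousAt f x :=
  let ⟨_, hs, hx, hf⟩ := h
  ContinuousOn.continuousAt (hf 0) (hs.mem_nhds hx)

theorem BastianiSmoothAt.congr {f g : E → F} {x : E} (h : BastianiSmoothAt f x)
    (hfg : f =ᶠ[𝓝 x] g) : BastianiSmoothAt g x := by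
  obtain ⟨s, hs, hx, hf⟩ := h
  obtain ⟨t, ht, hto, hxt⟩ := eventually_nhds_iff.1 hfg
  exact ⟨s ∩ t, hs.inter hto, ⟨hx, hxt⟩, fun n =>
    ((hf n).mono inter_subset_left).congr (hs.inter hto) fun y hy => ht y hy.2⟩

theorem BastianiSmoothAt.hasDirDeriv {f : E → F} {x : E} (h : BastianiSmoothAt f x) (v : E) :
    HasDirDeriv f x v (dirDeriv f (x, v)) :=
  let ⟨_, hs, hx, hf⟩ := h
  ((bastianiContDiffOn_succ_iff hs).1 (hf 1)).2.1 x hx v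

theorem BastianiSmoothAt.comp_hasCurveDeriv {f : E → F} {γ : ℝ → E} {v : E}
    (h : BastianiSmoothAt f (γ 0)) (hγ : HasCurveDeriv γ v) :
    HasCurveDeriv (fun t => f (γ t)) (dirDeriv f (γ 0, v)) :=
  let ⟨_, hs, hx, hf⟩ := h
  (hf 1).comp_hasCurveDeriv hs hx hγ

theorem BastianiSmoothAt.tendsto_diffQuotient {f : E → F} {x : E} (h : BastianiSmoothAt f x)
    (v : E) :
    Tendsto (fun p : (E × E) × ℝ => p.2⁻¹ • (f (p.1.1 + p.2 • p.1.2) - f p.1.1))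
      (𝓝 (x, v) ×ˢ 𝓝[≠] 0) (𝓝 (dirDeriv f (x, v))) :=
  let ⟨_, hs, hx, hf⟩ := h
  (hf 1).tendsto_diffQuotient hs hx v

theorem BastianiSmoothAt.isLinearMap_dirDeriv {f : E → F} {x : E} (h : BastianiSmoothAt f x) :
    IsLinearMap ℝ (fun v => dirDeriv f (x, v)) :=
  let ⟨_, hs, hx, hf⟩ := h
  ⟨(hf 1).dirDeriv_add hs hx, (hf 1).dirDeriv_smul hs hx⟩

theorem BastianiSmoothAt.dirDeriv {f : E → F} {x : E} (h : BastianiSmoothAt f x) (v : E) :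
    BastianiSmoothAt (dirDeriv f) (x, v) :=
  let ⟨s, hs, hx, hf⟩ := h
  ⟨s ×ˢ univ, hs.prod isOpen_univ, ⟨hx, mem_univ _⟩, fun n =>
    ((bastianiContDiffOn_succ_iff hs).1 (hf (n + 1))).2.2⟩

theorem BastianiSmoothAt.comp {g : F → H} {f : E → F} {x : E} (hg : BastianiSmoothAt g (f x))
    (hf : BastianiSmoothAt f x) : BastianiSmoothAt (fun y => g (f y)) x := by
  obtain ⟨t, ht, hxt, hg⟩ := hg
  obtain ⟨s, hs, hx, hf⟩ := hf
  have hst : IsOpen (s ∩ f ⁻¹' t) := ContinuousOn.isOpen_inter_preimage (hf 0) hs ht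
  exact ⟨s ∩ f ⁻¹' t, hst, ⟨hx, hxt⟩, fun n =>
    (hg n).comp ((hf n).mono inter_subset_left) ht fun y hy => hy.2⟩

theorem ContinuousLinearMap.bastianiSmoothAt (L : E →L[ℝ] F) (x : E) : BastianiSmoothAt L x :=
  ⟨univ, isOpen_univ, mem_univ _, fun n => bastianiContDiffOn_clm n L _⟩

theorem bastianiSmoothAt_const (c : F) (x : E) : BastianiSmoothAt (fun _ : E => c) x :=
  ⟨univ, isOpen_univ, mem_univ _, fun n => bastianiContDiffOn_const n c _⟩

theorem bastianiSmoothAt_id (x : F) : BastianiSmoothAt (fun y : F => y) x :=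
  (ContinuousLinearMap.id ℝ F).bastianiSmoothAt x

theorem BastianiSmoothAt.prodMk {f : E → F} {g : E → H} {x : E} (hf : BastianiSmoothAt f x)
    (hg : BastianiSmoothAt g x) : BastianiSmoothAt (fun y => (f y, g y)) x := by
  obtain ⟨s, hs, hx, hf⟩ := hf
  obtain ⟨t, ht, hxt, hg⟩ := hg
  exact ⟨s ∩ t, hs.inter ht, ⟨hx, hxt⟩, fun n =>
    ((hf n).mono inter_subset_left).prodMk ((hg n).mono inter_subset_right)⟩

theorem BastianiSmoothAt.clm_comp (L : F →L[ℝ] H) {f : E → F} {x : E}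
    (hf : BastianiSmoothAt f x) : BastianiSmoothAt (fun y => L (f y)) x :=
  (L.bastianiSmoothAt _).comp hf

theorem BastianiSmoothAt.fst {f : E → F × H} {x : E}
    (hf : BastianiSmoothAt f x) : BastianiSmoothAt (fun y => (f y).1) x :=
  hf.clm_comp (ContinuousLinearMap.fst ℝ F H)

theorem BastianiSmoothAt.snd {f : E → F × H} {x : E}
    (hf : BastianiSmoothAt f x) : BastianiSmoothAt (fun y => (f y).2) x :=
  hf.clm_comp (ContinuousLinearMap.snd ℝ F H)

theorem BastianiSmoothAt.apply {ι : Type*} {f : E → ι → F} {x : E}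
    (hf : BastianiSmoothAt f x) (k : ι) : BastianiSmoothAt (fun y => f y k) x :=
  hf.clm_comp (ContinuousLinearMap.proj (R := ℝ) (φ := fun _ : ι => F) k)

theorem BastianiSmoothAt.pi {ι : Type*} [Finite ι] {f : ι → E → F} {x : E}
    (hf : ∀ k, BastianiSmoothAt (f k) x) : BastianiSmoothAt (fun y k => f k y) x := by
  choose s hs hx hf using hf
  exact ⟨⋂ k, s k, isOpen_iInter_of_finite hs, mem_iInter.2 hx, fun n =>
    BastianiContDiffOn.pi fun k => (hf k n).mono (iInter_subset _ k)⟩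

theorem HasCurveDeriv.prodMk {γ : ℝ → F} {δ : ℝ → H} {v : F} {w : H} (hγ : HasCurveDeriv γ v)
    (hδ : HasCurveDeriv δ w) : HasCurveDeriv (fun t => (γ t, δ t)) (v, w) := by
  simpa [HasCurveDeriv] using Tendsto.prodMk_nhds hγ hδ

theorem hasCurveDeriv_const (c : F) : HasCurveDeriv (fun _ => c) (0 : F) := by
  simp [HasCurveDeriv]

theorem hasCurveDeriv_line (x v : F) : HasCurveDeriv (fun t : ℝ => x + t • v) v := by
  refine tendsto_const_nhds.congr' ?_
  filter_upwards [eventually_mem_nhdsWithin] with t (ht : t ≠ 0)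
  simp [inv_smul_smul₀ ht]

theorem HasCurveDeriv.clm_comp (L : F →L[ℝ] H) {γ : ℝ → F} {v : F} (h : HasCurveDeriv γ v) :
    HasCurveDeriv (fun t => L (γ t)) (L v) := by
  simpa [HasCurveDeriv, Function.comp_def] using (L.continuous.tendsto v).comp h

theorem HasCurveDeriv.continuousAt {γ : ℝ → F} {v : F} (h : HasCurveDeriv γ v) :
    ContinuousAt γ 0 := by
  have h1 : Tendsto (fun t : ℝ => t) (𝓝[≠] 0) (𝓝 0) := tendsto_id.mono_left nhdsWithin_le_nhds
  have h2 := (h1.smul h).add_const (γ 0)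
  rw [zero_smul, zero_add] at h2
  rw [continuousAt_iff_punctured_nhds]
  refine h2.congr' ?_
  filter_upwards [eventually_mem_nhdsWithin] with t (ht : t ≠ 0)
  simp [smul_inv_smul₀ ht]

theorem bastianiContDiffOn_smul (n : ℕ) {a : E → ℝ} {f : E → F} {s : Set E}
    (ha : BastianiContDiffOn n a s) (hf : BastianiContDiffOn n f s) :
    BastianiContDiffOn n (fun x => a x • f x) s := by
  have hadd : ∀ {E' : Type u} [AddCommGroup E'] [Module ℝ E'] [TopologicalSpace E']
      [IsTopologicalAddGroup E'] [ContinuousSMul ℝ E'] {n : ℕ} {f g : E' → F} {s : Set E'},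
      BastianiContDiffOn n f s → BastianiContDiffOn n g s →
        BastianiContDiffOn n (fun x => f x + g x) s := fun hf hg =>
    (bastianiContDiffOn_clm _ (ContinuousLinearMap.fst ℝ F F + ContinuousLinearMap.snd ℝ F F)
      univ).comp (hf.prodMk hg) isOpen_univ (mapsTo_univ _ _)
  induction n generalizing E with
  | zero => exact ContinuousOn.smul ha hf
  | succ n ih =>
    have ha1 := (ha.of_succ.comp_clm (ContinuousLinearMap.fst ℝ E E)).mono
      (t := s ×ˢ univ) fun p hp => hp.1
    have hf1 := (hf.of_succ.comp_clm (ContinuousLinearMap.fst ℝ E E)).mono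
      (t := s ×ˢ univ) fun p hp => hp.1
    have hac := ha.continuousOn
    obtain ⟨hc, da, hd, hda⟩ := ha
    obtain ⟨hc', df, hd', hdf⟩ := hf
    refine ⟨hc.smul hc', fun p => a p.1 • df p + da p • f p.1, fun x hx v => ?_,
      hadd (ih ha1 hdf) (ih hda hf1)⟩
    have h1 : Tendsto (fun t : ℝ => a (x + t • v)) (𝓝[≠] 0) (𝓝 (a x)) := by
      have := (hasDirDeriv_iff_hasCurveDeriv.1 (hd x hx v)).continuousAt
      simpa [ContinuousAt] using this.tendsto.mono_left nhdsWithin_le_nhds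
    refine ((h1.smul (hd' x hx v)).add (Tendsto.smul_const (hd x hx v) (f x))).congr fun t => ?_
    simp only [smul_sub, smul_smul, sub_smul, smul_eq_mul, mul_sub]
    rw [mul_comm (a (x + t • v))]
    abel

theorem BastianiSmoothAt.smul {a : E → ℝ} {f : E → F} {x : E} (ha : BastianiSmoothAt a x)
    (hf : BastianiSmoothAt f x) : BastianiSmoothAt (fun y => a y • f y) x := by
  obtain ⟨s, hs, hx, ha⟩ := ha
  obtain ⟨t, ht, hxt, hf⟩ := hf
  exact ⟨s ∩ t, hs.inter ht, ⟨hx, hxt⟩, fun n =>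
    bastianiContDiffOn_smul n ((ha n).mono inter_subset_left) ((hf n).mono inter_subset_right)⟩

/-- The second difference quotients converge to the iterated directional derivative. -/
theorem BastianiSmoothAt.tendsto_secondDiffQuotient {f : E → F} {x : E}
    (h : BastianiSmoothAt f x) (v w : E) :
    Tendsto (fun t : ℝ => t⁻¹ • t⁻¹ • (f (x + t • v + t • w) - f (x + t • v) -
      (f (x + t • w) - f x))) (𝓝[≠] 0)
      (𝓝 (_root_.dirDeriv (fun y => _root_.dirDeriv f (y, v)) (x, w))) := by
  have hg : BastianiSmoothAt (fun y => _root_.dirDeriv f (y, v)) x :=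
    (h.dirDeriv v).comp (g := _root_.dirDeriv f) (f := fun y => (y, v))
      ((bastianiSmoothAt_id x).prodMk (bastianiSmoothAt_const v x))
  intro N hN
  obtain ⟨C, hC, hcl, hconv, hsub⟩ := exists_isClosed_convex_mem_nhds hN
  obtain ⟨A, hA, B, hB, hAB⟩ := mem_prod_iff.1 (hg.tendsto_diffQuotient w hC)
  have key : ∀ᶠ t : ℝ in 𝓝 0, ∀ r ∈ Icc (0 : ℝ) 1,
      (x + (r * t) • v, w) ∈ A ∧ BastianiSmoothAt f (x + (r * t) • v) ∧
        BastianiSmoothAt f (x + (r * t) • v + t • w) := by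
    refine isCompact_Icc.eventually_forall_of_forall_eventually fun r _ => ?_
    have h1 : Continuous fun z : ℝ × ℝ => x + (z.2 * z.1) • v := by fun_prop
    have h2 : Continuous fun z : ℝ × ℝ => x + (z.2 * z.1) • v + z.1 • w := by fun_prop
    have h1' := h1.tendsto (0, r)
    have h2' := h2.tendsto (0, r)
    simp only [mul_zero, zero_smul, add_zero] at h1' h2'
    exact ((h1'.prodMk_nhds tendsto_const_nhds).eventually hA).and
      ((h1'.eventually h.eventually).and (h2'.eventually h.eventually))
  rw [mem_map]
  filter_upwards [key.filter_mono nhdsWithin_le_nhds, eventually_mem_nhdsWithin, hB]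
    with t ht (ht0 : t ≠ 0) htB
  refine hsub ?_
  have hmem := inv_smul_sub_mem_of_hasDirDeriv (f := fun y => t⁻¹ • (f (y + t • w) - f y))
    (x := x) (v := v) ht0 hconv hcl fun r hr => ?_
  · simpa only [smul_sub] using hmem
  · obtain ⟨h1, h2, h3⟩ := ht r hr
    refine ⟨_, hAB (mk_mem_prod h1 htB), ?_⟩
    have h4 : HasDirDeriv (fun y => f (y + t • w)) (x + (r * t) • v) v
        (_root_.dirDeriv f (x + (r * t) • v + t • w, v)) := by
      refine (h3.hasDirDeriv v).congr' (Eventually.of_forall fun a => ?_)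
      simp only [add_right_comm]
    refine ((h4.sub (h2.hasDirDeriv v)).const_smul t⁻¹).congr fun a => ?_
    simp only [smul_sub, smul_comm t⁻¹ a⁻¹]
    abel

/-- **Schwarz's theorem**: second directional derivatives commute. -/
theorem BastianiSmoothAt.dirDeriv_comm {f : E → F} {x : E}
    (h : BastianiSmoothAt f x) (v w : E) :
    _root_.dirDeriv (fun y => _root_.dirDeriv f (y, v)) (x, w) =
      _root_.dirDeriv (fun y => _root_.dirDeriv f (y, w)) (x, v) := by
  refine tendsto_nhds_unique (h.tendsto_secondDiffQuotient v w)
    ((h.tendsto_secondDiffQuotient w v).congr fun t => ?_)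
  rw [add_right_comm x]
  congr 2
  abel

end smoothAt

/-! ### Integrals depending on a parameter -/

section parametric

variable {E : Type u} [AddCommGroup E] [Module ℝ E] [TopologicalSpace E]
  [IsTopologicalAddGroup E] [ContinuousSMul ℝ E] [LocallyConvexSpace ℝ E] [T2Space E]
  {F : Type v} [AddCommGroup F] [Module ℝ F] [TopologicalSpace F]
  [IsTopologicalAddGroup F] [ContinuousSMul ℝ F] [LocallyConvexSpace ℝ F] [T2Space F]
  {ι : Type*} [Fintype ι]

theorem continuousAt_setIntegral {X : Type*} [TopologicalSpace X] {K : Set (ι → ℝ)}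
    (hK : IsCompact K) {h : X × (ι → ℝ) → ℝ} {x : X}
    (hx : ∀ s ∈ K, ContinuousAt h (x, s))
    (hc : ∀ᶠ y in 𝓝 x, ContinuousOn (fun s => h (y, s)) K) :
    ContinuousAt (fun y => ∫ s in K, h (y, s)) x := by
  rw [ContinuousAt, Metric.tendsto_nhds]
  intro ε hε
  set V := volume.real K
  have hV : 0 ≤ V := measureReal_nonneg
  have hδ : 0 < ε / (V + 1) := by positivity
  have key : ∀ᶠ y in 𝓝 x, ∀ s ∈ K, ‖h (y, s) - h (x, s)‖ < ε / (V + 1) := by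
    refine hK.eventually_forall_of_forall_eventually fun s hs => ?_
    have h1 : Tendsto (fun z : X × (ι → ℝ) => h (z.1, z.2) - h (x, z.2)) (𝓝 (x, s))
        (𝓝 (h (x, s) - h (x, s))) := by
      refine Tendsto.sub (hx s hs) ((hx s hs).tendsto.comp ?_)
      have : Continuous fun z : X × (ι → ℝ) => (x, z.2) := by fun_prop
      exact this.tendsto (x, s)
    rw [sub_self] at h1
    have := (tendsto_zero_iff_norm_tendsto_zero.1 h1).eventually (gt_mem_nhds hδ)
    exact this
  filter_upwards [key, hc] with y hy hcy
  rw [dist_eq_norm, ← integral_sub (hcy.integrableOn_compact hK)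
    (hc.self_of_nhds.integrableOn_compact hK)]
  calc ‖∫ s in K, (h (y, s) - h (x, s))‖ ≤ ε / (V + 1) * V :=
        norm_setIntegral_le_of_norm_le_const hK.measure_lt_top fun s hs => (hy s hs).le
    _ < ε / (V + 1) * (V + 1) := by gcongr; linarith
    _ = ε := by field_simp

/-- The difference quotients of `x ↦ h (x, s)` in the direction `v`, as a function of the increment
and of `s`, completed by the directional derivative where the increment vanishes. -/
def partialDiffQuotient {Y : Type w} [AddCommGroup Y] [Module ℝ Y] (h : E × Y → F) (x v : E)
    (p : ℝ × Y) : F :=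
  open scoped Classical in
  if p.1 = 0 then dirDeriv h ((x, p.2), (v, 0))
  else p.1⁻¹ • (h (x + p.1 • v, p.2) - h (x, p.2))

theorem BastianiContDiffOn.continuousAt_partialDiffQuotient {Y : Type w} [AddCommGroup Y]
    [Module ℝ Y] [TopologicalSpace Y] [IsTopologicalAddGroup Y] [ContinuousSMul ℝ Y]
    {n : ℕ} {h : E × Y → F} {O : Set (E × Y)} (hh : BastianiContDiffOn (n + 1) h O)
    (hO : IsOpen O) {x : E} {s : Y} (hxs : (x, s) ∈ O) (v : E) :
    ContinuousAt (partialDiffQuotient h x v) (0, s) := by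
  classical
  have hval : partialDiffQuotient h x v (0, s) = dirDeriv h ((x, s), (v, 0)) := if_pos rfl
  rw [ContinuousAt, hval]
  refine Tendsto.if ?_ ?_
  · have h1 : ContinuousAt (dirDeriv h) ((x, s), (v, 0)) :=
      ((bastianiContDiffOn_succ_iff hO).1 hh).2.2.continuousOn.continuousAt
        ((hO.prod isOpen_univ).mem_nhds ⟨hxs, mem_univ _⟩)
    have h2 : Continuous fun p : ℝ × Y => (((x, p.2), (v, 0)) : (E × Y) × (E × Y)) := by fun_prop
    exact (h1.tendsto.comp (h2.tendsto (0, s))).mono_left inf_le_left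
  · have h2 : Continuous fun p : ℝ × Y => (((x, p.2), (v, 0)) : (E × Y) × (E × Y)) := by fun_prop
    have h3 : Tendsto (fun p : ℝ × Y => ((((x, p.2), (v, 0)) : (E × Y) × (E × Y)), p.1))
        (𝓝 (0, s) ⊓ 𝓟 {p | ¬ p.1 = 0}) (𝓝 ((x, s), (v, 0)) ×ˢ 𝓝[≠] 0) := by
      refine ((h2.tendsto (0, s)).mono_left inf_le_left).prodMk ?_
      refine tendsto_nhdsWithin_iff.2
        ⟨(continuous_fst.tendsto ((0, s) : ℝ × Y)).mono_left inf_le_left, ?_⟩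
      exact mem_inf_of_right (mem_principal_self _)
    refine ((hh.tendsto_diffQuotient hO hxs (v, 0)).comp h3).congr fun p => ?_
    simp

theorem BastianiSmoothAt.continuousAt_partialDiffQuotient {Y : Type w} [AddCommGroup Y]
    [Module ℝ Y] [TopologicalSpace Y] [IsTopologicalAddGroup Y] [ContinuousSMul ℝ Y]
    {h : E × Y → F} {x : E} {s : Y} (hh : BastianiSmoothAt h (x, s)) (v : E) :
    ContinuousAt (partialDiffQuotient h x v) (0, s) :=
  let ⟨_, hO, hxs, hf⟩ := hh
  (hf 1).continuousAt_partialDiffQuotient hO hxs v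

/-- Differentiation under the integral sign, over a compact set of parameters. -/
theorem BastianiContDiffOn.setIntegral {K : Set (ι → ℝ)} (hK : IsCompact K) {n : ℕ}
    {h : E × (ι → ℝ) → ℝ} {O : Set (E × (ι → ℝ))} (hh : BastianiContDiffOn n h O)
    (hO : IsOpen O) {W : Set E} (hW : IsOpen W) (hWO : W ×ˢ K ⊆ O) :
    BastianiContDiffOn n (fun x => ∫ s in K, h (x, s)) W := by
  have hcont : ∀ {E : Type u} [TopologicalSpace E] {h : E × (ι → ℝ) → ℝ} {O : Set (E × (ι → ℝ))}
      (_ : ContinuousOn h O) (_ : IsOpen O) {W : Set E} (_ : IsOpen W) (_ : W ×ˢ K ⊆ O),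
      (∀ x ∈ W, ContinuousOn (fun s => h (x, s)) K) ∧
        ContinuousOn (fun x => ∫ s in K, h (x, s)) W := by
    intro E _ h O hh hO W hW hWO
    have h1 : ∀ x ∈ W, ContinuousOn (fun s => h (x, s)) K := fun x hx =>
      hh.comp (by fun_prop) fun s hs => hWO ⟨hx, hs⟩
    exact ⟨h1, fun x hx => (continuousAt_setIntegral hK
      (fun s hs => hh.continuousAt (hO.mem_nhds (hWO ⟨hx, hs⟩)))
      (eventually_of_mem (hW.mem_nhds hx) h1)).continuousWithinAt⟩
  induction n generalizing E with
  | zero => exact (hcont hh hO hW hWO).2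
  | succ n ih =>
    obtain ⟨hc, hcW⟩ := hcont hh.continuousOn hO hW hWO
    have hh' := (bastianiContDiffOn_succ_iff hO).1 hh
    -- the derivative is again an integral, of `dirDeriv h` precomposed with a linear map
    let L : (E × E) × (ι → ℝ) →L[ℝ] (E × (ι → ℝ)) × (E × (ι → ℝ)) :=
      (((ContinuousLinearMap.fst ℝ E E ∘L ContinuousLinearMap.fst ℝ (E × E) (ι → ℝ)).prod
        (ContinuousLinearMap.snd ℝ (E × E) (ι → ℝ))).prod
        ((ContinuousLinearMap.snd ℝ E E ∘L ContinuousLinearMap.fst ℝ (E × E) (ι → ℝ)).prod 0))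
    have hL := hh'.2.2.comp_clm L
    refine ⟨hcW, fun p => ∫ s in K, dirDeriv h (L (p, s)), fun x hx v => ?_,
      ih hL ((hO.prod isOpen_univ).preimage L.continuous) (hW.prod isOpen_univ)
        fun p hp => ⟨hWO ⟨hp.1.1, hp.2⟩, mem_univ _⟩⟩
    have h1 : ContinuousAt (fun t : ℝ => ∫ s in K, partialDiffQuotient h x v (t, s)) 0 := by
      refine continuousAt_setIntegral hK (fun s hs =>
        hh.continuousAt_partialDiffQuotient hO (hWO ⟨hx, hs⟩) v) ?_
      filter_upwards [(tendsto_add_smul_nhds_zero x v).eventually (hW.mem_nhds hx)] with t ht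
      rcases eq_or_ne t 0 with rfl | ht0
      · have h2 : ContinuousOn (fun s => dirDeriv h ((x, s), (v, 0))) K :=
          hh'.2.2.continuousOn.comp (by fun_prop) fun s hs => ⟨hWO ⟨hx, hs⟩, mem_univ _⟩
        simpa [partialDiffQuotient] using h2
      · have h2 : ContinuousOn (fun s => t⁻¹ • (h (x + t • v, s) - h (x, s))) K :=
          ((hc _ ht).sub (hc _ hx)).const_smul t⁻¹
        simpa [partialDiffQuotient, ht0] using h2
    have h0 : ∫ s in K, partialDiffQuotient h x v (0, s) =
        ∫ s in K, dirDeriv h (L ((x, v), s)) := by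
      simp [partialDiffQuotient, L]
    change Tendsto _ _ (𝓝 (∫ s in K, dirDeriv h (L ((x, v), s))))
    rw [← h0]
    refine (h1.tendsto.mono_left nhdsWithin_le_nhds).congr' ?_
    filter_upwards [eventually_mem_nhdsWithin, ((tendsto_add_smul_nhds_zero x v).eventually
      (hW.mem_nhds hx)).filter_mono nhdsWithin_le_nhds] with t (ht : t ≠ 0) htW
    rw [← integral_sub ((hc _ htW).integrableOn_compact hK) ((hc _ hx).integrableOn_compact hK),
      ← integral_smul]
    simp [partialDiffQuotient, ht]

theorem BastianiSmoothAt.setIntegral {K : Set (ι → ℝ)} (hK : IsCompact K)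
    {h : E × (ι → ℝ) → ℝ} {x : E} (hh : ∀ s ∈ K, BastianiSmoothAt h (x, s)) :
    BastianiSmoothAt (fun y => ∫ s in K, h (y, s)) x := by
  have h1 : ∀ᶠ y in 𝓝 x, ∀ s ∈ K, BastianiSmoothAt h (y, s) :=
    hK.eventually_forall_of_forall_eventually fun s hs => (hh s hs).eventually
  obtain ⟨W, hWs, hW, hxW⟩ := eventually_nhds_iff.1 h1
  have hO : IsOpen {p | BastianiSmoothAt h p} :=
    isOpen_iff_eventually.2 fun p hp => BastianiSmoothAt.eventually hp
  exact ⟨W, hW, hxW, fun n => (bastianiSmoothOn_of_forall (fun p hp => hp) n).setIntegral hK hO hW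
    fun p hp => hWs _ hp.1 _ hp.2⟩

end parametric

/-! ### Smooth functions of finitely many real variables -/

section finiteDimensional

/-- In finite dimension, a `C¹` function in the sense of Michal and Bastiani is Fréchet differentiable:
the difference quotients converge uniformly in the direction, since the unit ball is compact. -/
theorem BastianiContDiffOn.hasFDerivAt {V : Type u} [NormedAddCommGroup V] [NormedSpace ℝ V]
    [FiniteDimensional ℝ V] {n : ℕ} {f : V → ℝ} {s : Set V} (hf : BastianiContDiffOn (n + 1) f s)
    (hs : IsOpen s) {x : V} (hx : x ∈ s) :
    ∃ L : V →L[ℝ] ℝ, HasFDerivAt f L x ∧ ∀ v, L v = dirDeriv f (x, v) := by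
  let L0 : V →ₗ[ℝ] ℝ := IsLinearMap.mk' (fun v => dirDeriv f (x, v))
    ⟨hf.dirDeriv_add hs hx, hf.dirDeriv_smul hs hx⟩
  refine ⟨L0.toContinuousLinearMap, ?_, fun v => rfl⟩
  set L := L0.toContinuousLinearMap
  rw [hasFDerivAt_iff_isLittleO_nhds_zero, Asymptotics.isLittleO_iff]
  intro c hc
  have key : ∀ᶠ t : ℝ in 𝓝 0, ∀ u ∈ Metric.closedBall (0 : V) 1, t ≠ 0 →
      ‖t⁻¹ • (f (x + t • u) - f x) - L u‖ < c := by
    refine (isCompact_closedBall _ _).eventually_forall_of_forall_eventually fun u _ => ?_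
    have h1 := hf.tendsto_diffQuotient hs hx u
    have h2 : Tendsto (fun p : ℝ × V => ((x, p.2), p.1)) (𝓝 (0, u) ⊓ 𝓟 {p | p.1 ≠ 0})
        (𝓝 (x, u) ×ˢ 𝓝[≠] 0) := by
      have : Continuous fun p : ℝ × V => (x, p.2) := by fun_prop
      refine ((this.tendsto (0, u)).mono_left inf_le_left).prodMk ?_
      exact tendsto_nhdsWithin_iff.2
        ⟨(continuous_fst.tendsto ((0, u) : ℝ × V)).mono_left inf_le_left,
          mem_inf_of_right (mem_principal_self _)⟩
    have h3 : Tendsto (fun p : ℝ × V => L p.2) (𝓝 (0, u) ⊓ 𝓟 {p | p.1 ≠ 0})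
        (𝓝 (dirDeriv f (x, u))) :=
      ((L.continuous.comp continuous_snd).tendsto (0, u)).mono_left inf_le_left
    have h4 := ((h1.comp h2).sub h3)
    rw [sub_self] at h4
    have h5 := (tendsto_zero_iff_norm_tendsto_zero.1 h4).eventually (gt_mem_nhds hc)
    exact eventually_inf_principal.1 h5
  have h6 : Tendsto (fun h : V => ‖h‖) (𝓝 0) (𝓝 0) := by
    simpa using (continuous_norm (E := V)).tendsto 0
  filter_upwards [h6.eventually key] with h hh
  rcases eq_or_ne h 0 with rfl | h0
  · simp
  · have hn : ‖h‖ ≠ 0 := norm_ne_zero_iff.2 h0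
    have h7 := (hh (‖h‖⁻¹ • h) (by simp [norm_smul, hn]) hn).le
    rw [smul_inv_smul₀ hn, map_smul, ← smul_sub, norm_smul, norm_inv, norm_norm] at h7
    rwa [inv_mul_le_iff₀ (by positivity), mul_comm] at h7

theorem BastianiContDiffOn.contDiffOn {V : Type u} [NormedAddCommGroup V] [NormedSpace ℝ V]
    [FiniteDimensional ℝ V] {n : ℕ} {f : V → ℝ} {s : Set V} (hf : BastianiContDiffOn n f s)
    (hs : IsOpen s) : ContDiffOn ℝ n f s := by
  induction n generalizing V with
  | zero => simpa using (contDiffOn_zero (𝕜 := ℝ)).2 hf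
  | succ n ih =>
    have h1 := fun x hx => hf.hasFDerivAt hs (x := x) hx
    rw [Nat.cast_succ, contDiffOn_succ_iff_fderiv_of_isOpen hs]
    refine ⟨fun x hx => ?_, by simp, ?_⟩
    · obtain ⟨L, hL, -⟩ := h1 x hx
      exact hL.differentiableAt.differentiableWithinAt
    · rw [contDiffOn_clm_apply]
      intro v
      have h2 := ih ((bastianiContDiffOn_succ_iff hs).1 hf).2.2 (hs.prod isOpen_univ)
      have h3 : ContDiffOn ℝ n (fun x => dirDeriv f (x, v)) s :=
        h2.comp (by fun_prop) fun x hx => ⟨hx, mem_univ _⟩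
      refine h3.congr fun x hx => ?_
      obtain ⟨L, hL, hLv⟩ := h1 x hx
      rw [hL.fderiv, hLv]

/-- On a finite-dimensional space, smoothness in the sense of Michal and Bastiani implies Mathlib's
notion of smoothness. -/
theorem BastianiSmoothAt.contDiffAt {V : Type u} [NormedAddCommGroup V] [NormedSpace ℝ V]
    [FiniteDimensional ℝ V] {f : V → ℝ} {x : V} (hf : BastianiSmoothAt f x) (n : ℕ) :
    ContDiffAt ℝ n f x :=
  let ⟨_, hs, hx, hf⟩ := hf
  ((hf n).contDiffOn hs).contDiffAt (hs.mem_nhds hx)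

end finiteDimensional

/-! ### Mixed derivatives of functions of several real variables -/

section mixedDerivatives

variable {V : Type*} [NormedAddCommGroup V] [NormedSpace ℝ V]
  {W : Type*} [NormedAddCommGroup W] [NormedSpace ℝ W]

theorem iteratedFDeriv_succ_apply_eq_fderiv {f : V → W} {x : V} {n : ℕ}
    (hf : DifferentiableAt ℝ (iteratedFDeriv ℝ n f) x) (m : Fin (n + 1) → V) :
    iteratedFDeriv ℝ (n + 1) f x m =
      fderiv ℝ (fun y => iteratedFDeriv ℝ n f y (Fin.tail m)) x (m 0) := by
  rw [iteratedFDeriv_succ_apply_left, fderiv_continuousMultilinear_apply_const_apply hf]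

theorem ContDiffAt.eventually_differentiableAt_iteratedFDeriv {f : V → W} {n : ℕ} {x : V}
    (hf : ContDiffAt ℝ (n + 1 : ℕ) f x) :
    ∀ᶠ y in 𝓝 x, DifferentiableAt ℝ (iteratedFDeriv ℝ n f) y := by
  filter_upwards [hf.eventually (by simp)] with y hy
  exact hy.differentiableAt_iteratedFDeriv (by exact_mod_cast Nat.lt_succ_self n)

/-- Adjacent arguments of an iterated derivative may be exchanged; the two outermost ones by
Schwarz's theorem, the others by differentiating the symmetry of a lower derivative. -/
theorem ContDiffAt.iteratedFDeriv_comp_swap {f : V → W} {n : ℕ} {x : V}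
    (hf : ContDiffAt ℝ (n + 1 : ℕ) f x) (m : Fin (n + 1) → V) (k : Fin n) :
    iteratedFDeriv ℝ (n + 1) f x (m ∘ Equiv.swap k.castSucc k.succ) =
      iteratedFDeriv ℝ (n + 1) f x m := by
  induction n generalizing x with
  | zero => exact k.elim0
  | succ n ih =>
    have hd := hf.eventually_differentiableAt_iteratedFDeriv
    rw [iteratedFDeriv_succ_apply_eq_fderiv hd.self_of_nhds,
      iteratedFDeriv_succ_apply_eq_fderiv hd.self_of_nhds]
    rcases Fin.eq_zero_or_eq_succ k with rfl | ⟨j, rfl⟩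
    · have hf' : ContDiffAt ℝ (n + 1 : ℕ) f x := hf.of_le (by exact_mod_cast Nat.le_succ _)
      have hd' := hf'.eventually_differentiableAt_iteratedFDeriv
      set g : V → W := fun z => iteratedFDeriv ℝ n f z (Fin.tail (Fin.tail m))
      have hg : ContDiffAt ℝ 2 g x := by
        have h1 : ContDiffAt ℝ 2 (iteratedFDeriv ℝ n f) x :=
          hf.iteratedFDeriv_right (by norm_cast; omega)
        exact (ContinuousMultilinearMap.apply ℝ (fun _ : Fin n => V) W
          (Fin.tail (Fin.tail m))).contDiff.contDiffAt.comp x h1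
      have hg1 : DifferentiableAt ℝ (fderiv ℝ g) x :=
        (hg.fderiv_right (m := 1) (by norm_num)).differentiableAt (by simp)
      have key : ∀ v w : V, fderiv ℝ (fun y => fderiv ℝ g y v) x w = fderiv ℝ (fderiv ℝ g) x w v := by
        intro v w
        rw [fderiv_clm_apply hg1 (differentiableAt_const v)]
        simp
      have h2 : ∀ p : Fin (n + 2) → V, Fin.tail (Fin.tail p) = Fin.tail (Fin.tail m) →
          (fun y => iteratedFDeriv ℝ (n + 1) f y (Fin.tail p)) =ᶠ[𝓝 x]
            fun y => fderiv ℝ g y (p 1) := by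
        intro p hp
        filter_upwards [hd'] with y hy
        rw [iteratedFDeriv_succ_apply_eq_fderiv hy, hp]
        rfl
      have h3 : Fin.tail (Fin.tail (m ∘ Equiv.swap (0 : Fin (n + 1)).castSucc
          (0 : Fin (n + 1)).succ)) = Fin.tail (Fin.tail m) := by
        funext j
        simp only [Fin.tail, Function.comp_apply]
        rw [Equiv.swap_apply_of_ne_of_ne] <;> simp [Fin.ext_iff]
      rw [(h2 _ h3).fderiv_eq, (h2 m rfl).fderiv_eq, key, key]
      have h4 := hg.isSymmSndFDerivAt (by simp)
      have e0 : (m ∘ Equiv.swap (0 : Fin (n + 1)).castSucc (0 : Fin (n + 1)).succ) 0 = m 1 := by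
        simp
      have e1 : (m ∘ Equiv.swap (0 : Fin (n + 1)).castSucc (0 : Fin (n + 1)).succ) 1 = m 0 := by
        simp
      rw [e0, e1]
      exact h4 _ _
    · have e0 : (m ∘ Equiv.swap j.succ.castSucc j.succ.succ) 0 = m 0 := by
        simp only [Function.comp_apply]
        rw [Equiv.swap_apply_of_ne_of_ne] <;> simp [Fin.ext_iff]
      have e1 : Fin.tail (m ∘ Equiv.swap j.succ.castSucc j.succ.succ) =
          Fin.tail m ∘ Equiv.swap j.castSucc j.succ := by
        funext l
        simp only [Fin.tail, Function.comp_apply, ← Fin.succ_castSucc]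
        rw [← (Fin.succ_injective _).map_swap]
      rw [e0, e1]
      have hf' : ContDiffAt ℝ (n + 1 : ℕ) f x := hf.of_le (by exact_mod_cast Nat.le_succ _)
      have h5 : (fun y => iteratedFDeriv ℝ (n + 1) f y (Fin.tail m ∘ Equiv.swap j.castSucc j.succ))
          =ᶠ[𝓝 x] fun y => iteratedFDeriv ℝ (n + 1) f y (Fin.tail m) := by
        filter_upwards [hf'.eventually (by simp)] with y hy
        exact ih hy _ j
      rw [h5.fderiv_eq]

/-- The `n`-th derivative of a `C^n` function is symmetric. -/
theorem ContDiffAt.iteratedFDeriv_comp_equivPerm {f : V → W} {n : ℕ} {x : V}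
    (hf : ContDiffAt ℝ n f x) (m : Fin n → V) (σ : Equiv.Perm (Fin n)) :
    iteratedFDeriv ℝ n f x (m ∘ σ) = iteratedFDeriv ℝ n f x m := by
  cases n with
  | zero => rw [Subsingleton.elim (m ∘ σ) m]
  | succ n =>
    have hσ : σ ∈ Submonoid.closure (Set.range fun i : Fin n ↦ Equiv.swap i.castSucc i.succ) := by
      rw [Equiv.Perm.mclosure_swap_castSucc_succ]
      trivial
    induction hσ using Submonoid.closure_induction generalizing m with
    | mem τ hτ =>
      obtain ⟨k, rfl⟩ := hτ
      exact hf.iteratedFDeriv_comp_swap m k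
    | one => rfl
    | mul τ ρ _ _ hτ hρ =>
      rw [Equiv.Perm.coe_mul, ← Function.comp_assoc, hρ, hτ]

/-- The leading coefficient of a polynomial `p` of degree at most `n` for which `p(ε) / ε^n` converges
as `ε → 0`: all lower coefficients vanish. -/
theorem eq_of_tendsto_sum_pow_div {P : ℝ} (n : ℕ) (a : ℕ → ℝ)
    (h : Tendsto (fun ε : ℝ => (∑ k ∈ Finset.range (n + 1), a k * ε ^ k) / ε ^ n)
      (𝓝[≠] 0) (𝓝 P)) : a n = P := by
  induction n generalizing a with
  | zero =>
    refine tendsto_nhds_unique ?_ h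
    simp
  | succ n ih =>
    have hid : Tendsto (fun ε : ℝ => ε) (𝓝[≠] 0) (𝓝 0) := tendsto_id.mono_left nhdsWithin_le_nhds
    have h0 : a 0 = 0 := by
      have h1 := h.mul (hid.pow (n + 1))
      rw [zero_pow (Nat.succ_ne_zero n), mul_zero] at h1
      have h2 : Tendsto (fun ε : ℝ => ∑ k ∈ Finset.range (n + 1 + 1), a k * ε ^ k) (𝓝[≠] 0)
          (𝓝 (∑ k ∈ Finset.range (n + 1 + 1), a k * 0 ^ k)) :=
        tendsto_finsetSum _ fun k _ => (hid.pow k).const_mul _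
      rw [Finset.sum_eq_single 0 (fun k _ hk => by simp [hk]) (by simp), pow_zero, mul_one] at h2
      refine tendsto_nhds_unique h2 (h1.congr' ?_)
      filter_upwards [eventually_mem_nhdsWithin] with ε (hε : ε ≠ 0)
      rw [div_mul_cancel₀ _ (pow_ne_zero _ hε)]
    refine ih (fun k => a (k + 1)) (h.congr' ?_)
    filter_upwards [eventually_mem_nhdsWithin] with ε (hε : ε ≠ 0)
    rw [Finset.sum_range_succ', h0, zero_mul, add_zero, pow_succ ε n, ← div_div,
      div_right_comm, Finset.sum_div]
    congr 1
    refine Finset.sum_congr rfl fun k _ => ?_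
    rw [pow_succ, ← mul_assoc, mul_div_cancel_right₀ _ hε]

/-- If `g(ε) / ε^n → P`, then the `n`-th Taylor coefficient of `g` at `0` is `P`. -/
theorem ContDiffAt.iteratedDeriv_eq_of_tendsto {g : ℝ → ℝ} {n : ℕ} (hg : ContDiffAt ℝ n g 0)
    {P : ℝ} (h : Tendsto (fun ε : ℝ => g ε / ε ^ n) (𝓝[≠] 0) (𝓝 P)) :
    iteratedDeriv n g 0 = n.factorial * P := by
  obtain ⟨u, hu, hgu⟩ := hg.contDiffOn le_rfl (by simp)
  obtain ⟨r, hr, hru⟩ := Metric.mem_nhds_iff.1 hu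
  have hs : Metric.ball (0 : ℝ) r ∈ 𝓝 (0 : ℝ) := Metric.ball_mem_nhds _ hr
  have hT := Real.taylor_tendsto (convex_ball (0 : ℝ) r) (Metric.mem_ball_self hr)
    (hgu.mono hru)
  rw [nhdsWithin_eq_nhds.2 hs] at hT
  have h1 := h.sub (hT.mono_left nhdsWithin_le_nhds)
  rw [sub_zero] at h1
  have h2 := eq_of_tendsto_sum_pow_div n
    (fun k => (k.factorial : ℝ)⁻¹ * iteratedDerivWithin k g (Metric.ball 0 r) 0)
    (h1.congr fun ε => ?_)
  · rw [← h2, iteratedDerivWithin_of_isOpen Metric.isOpen_ball (Metric.mem_ball_self hr)]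
    field_simp
  · rw [sub_zero, ← sub_div, sub_sub_cancel, taylor_within_apply]
    congr 1
    refine Finset.sum_congr rfl fun k _ => ?_
    simp only [sub_zero, smul_eq_mul]
    ring

theorem ContDiffAt.iteratedFDeriv_diagonal {f : V → ℝ} {n : ℕ} (hf : ContDiffAt ℝ n f 0)
    {t : V} {P : ℝ} (h : Tendsto (fun ε : ℝ => f (ε • t) / ε ^ n) (𝓝[≠] 0) (𝓝 P)) :
    iteratedFDeriv ℝ n f 0 (fun _ => t) = n.factorial * P := by
  let L : ℝ →L[ℝ] V := (ContinuousLinearMap.id ℝ ℝ).smulRight t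
  have hL : ContDiffAt ℝ n (f ∘ L) 0 := by
    refine ContDiffAt.comp 0 ?_ L.contDiff.contDiffAt
    simpa using hf
  have h1 := hL.iteratedDeriv_eq_of_tendsto (P := P) (by simpa [L] using h)
  obtain ⟨u, hu, hgu⟩ := hf.contDiffOn le_rfl (by simp)
  obtain ⟨s, hsu, hs, h0⟩ := mem_nhds_iff.1 hu
  have hs' : IsOpen (L ⁻¹' s) := hs.preimage L.continuous
  have h0' : L 0 ∈ s := by simpa using h0
  have h2 := L.iteratedFDerivWithin_comp_right (hgu.mono hsu) hs.uniqueDiffOn hs'.uniqueDiffOn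
    (x := 0) h0' le_rfl
  rw [iteratedFDerivWithin_of_isOpen n hs' h0', iteratedFDerivWithin_of_isOpen n hs h0'] at h2
  rw [← h1, iteratedDeriv_eq_iteratedFDeriv, h2]
  simp [L]

/-- A symmetric multilinear map `M` with `M(∑ t_k e_k, …, ∑ t_k e_k) = c t₁ ⋯ t_n` satisfies
`n! M(e₁, …, e_n) = c`, by comparison of the coefficients of `t₁ ⋯ t_n`. -/
theorem MultilinearMap.factorial_mul_eq_of_diagonal {V : Type*} [AddCommGroup V] [Module ℝ V]
    {n : ℕ} (M : MultilinearMap ℝ (fun _ : Fin n => V) ℝ)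
    (hM : ∀ (m : Fin n → V) (σ : Equiv.Perm (Fin n)), M (m ∘ σ) = M m) (e : Fin n → V) (c : ℝ)
    (h : ∀ t : Fin n → ℝ, M (fun _ => ∑ k, t k • e k) = c * ∏ k, t k) :
    n.factorial * M e = c := by
  classical
  have h1 : ∀ t : Fin n → ℝ, ∑ r : Fin n → Fin n, M (e ∘ r) * ∏ k, t (r k) = c * ∏ k, t k := by
    intro t
    rw [← h t, M.map_sum]
    refine Finset.sum_congr rfl fun r _ => ?_
    rw [M.map_smul_univ (fun k => t (r k)) (fun k => e (r k)), smul_eq_mul, mul_comm]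
    rfl
  have h2 : (∑ r : Fin n → Fin n, MvPolynomial.C (M (e ∘ r)) * ∏ k, MvPolynomial.X (r k)) =
      MvPolynomial.C c * ∏ k : Fin n, (MvPolynomial.X k : MvPolynomial (Fin n) ℝ) := by
    refine MvPolynomial.funext fun t => ?_
    simpa using h1 t
  have h3 : ∀ r : Fin n → Fin n, (∏ k, (MvPolynomial.X (r k) : MvPolynomial (Fin n) ℝ)) =
      MvPolynomial.monomial (∑ k, Finsupp.single (r k) 1) 1 := by
    intro r
    rw [MvPolynomial.monomial_sum_one]
    rfl
  have h4 : ∀ r : Fin n → Fin n,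
      (∑ k, Finsupp.single (r k) 1 : Fin n →₀ ℕ) = ∑ k, Finsupp.single k 1 ↔
        Function.Bijective r := by
    intro r
    refine ⟨fun hr => Finite.surjective_iff_bijective.1 fun l => ?_, fun hr => ?_⟩
    · by_contra! hl
      have h5 := DFunLike.congr_fun hr l
      simp [Finsupp.finsetSum_apply, Finsupp.single_apply, hl] at h5
    · exact hr.sum_comp (fun k => (Finsupp.single k 1 : Fin n →₀ ℕ))
  have h5 := congrArg (MvPolynomial.coeff (∑ k, Finsupp.single k 1)) h2
  simp only [h3, MvPolynomial.coeff_sum, MvPolynomial.coeff_C_mul,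
    MvPolynomial.coeff_monomial, h4, mul_ite, mul_one, mul_zero, if_true] at h5
  rw [← h5, ← Finset.sum_filter]
  rw [Finset.sum_congr rfl (g := fun _ => M e)]
  · rw [Finset.sum_const, nsmul_eq_mul, ← Fintype.card_subtype,
      Fintype.card_congr Equiv.bijectiveEquiv, Fintype.card_perm, Fintype.card_fin]
  · intro r hr
    exact hM e (Equiv.ofBijective r (Finset.mem_filter.1 hr).2)

/-- If `f(εt) / ε^n → c t₁ ⋯ t_n` for all `t`, then `∂^n f / ∂t₁ ⋯ ∂t_n` has the value `c` at `0`. -/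
theorem ContDiffAt.iteratedFDeriv_single_eq {n : ℕ} {f : (Fin n → ℝ) → ℝ}
    (hf : ContDiffAt ℝ n f 0) {c : ℝ}
    (h : ∀ t : Fin n → ℝ,
      Tendsto (fun ε : ℝ => f (ε • t) / ε ^ n) (𝓝[≠] 0) (𝓝 (c * ∏ k, t k))) :
    iteratedFDeriv ℝ n f 0 (fun k => Pi.single k 1) = c := by
  have h1 := (iteratedFDeriv ℝ n f 0).toMultilinearMap.factorial_mul_eq_of_diagonal
    (fun m σ => hf.iteratedFDeriv_comp_equivPerm m σ) (fun k => Pi.single k 1) (n.factorial * c)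
    fun t => ?_
  · exact mul_left_cancel₀ (by positivity) h1
  · have h2 : ∑ k, t k • (Pi.single k 1 : Fin n → ℝ) = t := by
      simpa [← Pi.single_smul] using Finset.univ_sum_single t
    rw [h2, mul_assoc]
    exact hf.iteratedFDeriv_diagonal (h t)

end mixedDerivatives

/-! ### The simplex and the cube -/

section simplexCube

variable {n : ℕ}

/-- The open standard simplex `{x | x_j > 0, x₁ + ⋯ + x_n < 1}`. -/
def openSimplex (n : ℕ) : Set (Fin n → ℝ) := {x | (∀ j, 0 < x j) ∧ ∑ j, x j < 1}

/-- The open unit cube. -/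
def openCube (n : ℕ) : Set (Fin n → ℝ) := Set.pi univ fun _ => Ioo 0 1

/-- The sum `x_{j+1} + ⋯ + x_n`. -/
def tailSum (x : Fin n → ℝ) (j : Fin n) : ℝ := ∑ k, if j < k then x k else 0

/-- The join parameters of a point of the simplex: the map `x_j ↦ x_j / (1 - x_{j+1} - ⋯ - x_n)`
from the open simplex onto the open cube. -/
def joinCoord (x : Fin n → ℝ) (j : Fin n) : ℝ := x j / (1 - tailSum x j)

theorem tailSum_last (x : Fin (n + 1) → ℝ) : tailSum x (Fin.last n) = 0 :=
  Finset.sum_eq_zero fun k _ => if_neg (Fin.le_last k).not_gt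

theorem tailSum_castSucc (x : Fin (n + 1) → ℝ) (j : Fin n) :
    tailSum x j.castSucc = tailSum (fun k => x k.castSucc) j + x (Fin.last n) := by
  simp [tailSum, Fin.sum_univ_castSucc, Fin.castSucc_lt_last]

theorem tailSum_div (x : Fin n → ℝ) (a : ℝ) (j : Fin n) :
    tailSum (fun k => x k / a) j = tailSum x j / a := by
  simp only [tailSum, Finset.sum_div, ite_div, zero_div]

theorem joinCoord_last (x : Fin (n + 1) → ℝ) : joinCoord x (Fin.last n) = x (Fin.last n) := by
  simp [joinCoord, tailSum_last]

theorem joinCoord_castSucc (x : Fin (n + 1) → ℝ) (hx : x (Fin.last n) ≠ 1) (j : Fin n) :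
    joinCoord x j.castSucc = joinCoord (fun k => x k.castSucc / (1 - x (Fin.last n))) j := by
  have h : 1 - x (Fin.last n) ≠ 0 := sub_ne_zero.2 hx.symm
  rw [joinCoord, joinCoord, tailSum_castSucc, tailSum_div, one_sub_div h, div_div_div_cancel_right₀ h]
  ring_nf

theorem last_lt_one_of_mem_openSimplex {x : Fin (n + 1) → ℝ} (hx : x ∈ openSimplex (n + 1)) :
    x (Fin.last n) < 1 :=
  (Finset.single_le_sum (fun j _ => (hx.1 j).le) (Finset.mem_univ _)).trans_lt hx.2

theorem init_div_mem_openSimplex {x : Fin (n + 1) → ℝ} (hx : x ∈ openSimplex (n + 1)) :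
    (fun k => x k.castSucc / (1 - x (Fin.last n))) ∈ openSimplex n := by
  have h := last_lt_one_of_mem_openSimplex hx
  refine ⟨fun j => div_pos (hx.1 _) (by linarith), ?_⟩
  have h2 := hx.2
  rw [Fin.sum_univ_castSucc] at h2
  rw [← Finset.sum_div, div_lt_one (by linarith)]
  linarith

theorem tailSum_lt_one {x : Fin n → ℝ} (hx : x ∈ openSimplex n) (j : Fin n) : tailSum x j < 1 := by
  refine lt_of_le_of_lt (Finset.sum_le_sum fun k _ => ?_) hx.2
  split_ifs
  · exact le_rfl
  · exact (hx.1 k).le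

theorem isOpen_openSimplex : IsOpen (openSimplex n) := by
  have : openSimplex n = (⋂ j, {x | 0 < x j}) ∩ {x | ∑ j, x j < 1} := by
    ext x; simp [openSimplex]
  rw [this]
  exact (isOpen_iInter_of_finite fun j => isOpen_lt continuous_const (continuous_apply j)).inter
    (isOpen_lt (by fun_prop) continuous_const)

theorem joinCoord_mem_openCube {x : Fin n → ℝ} (hx : x ∈ openSimplex n) :
    joinCoord x ∈ openCube n := by
  induction n with
  | zero => exact fun j => j.elim0
  | succ n ih =>
    have h := last_lt_one_of_mem_openSimplex hx
    intro j _
    induction j using Fin.lastCases with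
    | last => rw [joinCoord_last]; exact ⟨hx.1 _, h⟩
    | cast j => rw [joinCoord_castSucc x h.ne]; exact ih (init_div_mem_openSimplex hx) j trivial

theorem joinCoord_injOn : InjOn joinCoord (openSimplex n) := by
  induction n with
  | zero => exact fun x _ y _ _ => Subsingleton.elim x y
  | succ n ih =>
    intro x hx y hy hxy
    have h := last_lt_one_of_mem_openSimplex hx
    have h' := last_lt_one_of_mem_openSimplex hy
    have hl : x (Fin.last n) = y (Fin.last n) := by
      rw [← joinCoord_last x, ← joinCoord_last y, hxy]
    have hi := ih (init_div_mem_openSimplex hx) (init_div_mem_openSimplex hy) (by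
      funext j
      rw [← joinCoord_castSucc x h.ne, ← joinCoord_castSucc y h'.ne, hxy])
    funext j
    induction j using Fin.lastCases with
    | last => exact hl
    | cast j =>
      have := congrFun hi j
      simp only [hl] at this
      exact (div_left_inj' (by linarith)).1 this

theorem joinCoord_image : joinCoord '' openSimplex n = openCube n := by
  refine Subset.antisymm (image_subset_iff.2 fun x hx => joinCoord_mem_openCube hx) ?_
  induction n with
  | zero => exact fun s _ => ⟨s, by simp [openSimplex], Subsingleton.elim _ _⟩
  | succ n ih =>
    intro s hs
    have hl := hs (Fin.last n) trivial
    obtain ⟨y, hy, hys⟩ := ih (show (fun k : Fin n => s k.castSucc) ∈ openCube n from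
      fun k _ => hs k.castSucc trivial)
    set a := s (Fin.last n)
    have ha : 0 < 1 - a := by linarith [hl.2]
    let x : Fin (n + 1) → ℝ := Fin.snoc (fun k => (1 - a) * y k) a
    have hxl : x (Fin.last n) = a := by simp [x]
    have hxc : ∀ k : Fin n, x k.castSucc = (1 - a) * y k := fun k => by simp [x]
    refine ⟨x, ⟨fun j => ?_, ?_⟩, ?_⟩
    · induction j using Fin.lastCases with
      | last => rw [hxl]; exact hl.1
      | cast j => rw [hxc]; exact mul_pos ha (hy.1 j)
    · rw [Fin.sum_univ_castSucc, hxl]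
      simp only [hxc]
      rw [← Finset.mul_sum]
      nlinarith [hy.2]
    · funext j
      induction j using Fin.lastCases with
      | last => rw [joinCoord_last, hxl]
      | cast j =>
        rw [joinCoord_castSucc x (by rw [hxl]; linarith), ← congrFun hys j]
        congr 1
        funext k
        rw [hxc, hxl]
        field_simp

theorem differentiableAt_joinCoord {x : Fin n → ℝ} (hx : x ∈ openSimplex n) :
    DifferentiableAt ℝ joinCoord x := by
  rw [differentiableAt_pi]
  intro j
  have h1 : DifferentiableAt ℝ (fun x : Fin n → ℝ => tailSum x j) x := by
    unfold tailSum
    refine DifferentiableAt.fun_sum fun k _ => ?_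
    split_ifs <;> fun_prop
  have h2 : DifferentiableAt ℝ (fun x : Fin n → ℝ => x j) x := by fun_prop
  have h3 : DifferentiableAt ℝ (fun x : Fin n → ℝ => (1 - tailSum x j)⁻¹) x :=
    (h1.const_sub 1).fun_inv (sub_ne_zero.2 (tailSum_lt_one hx j).ne')
  exact h2.fun_mul h3

theorem hasDerivAt_joinCoord {x : Fin n → ℝ} (hx : x ∈ openSimplex n) (v : Fin n → ℝ) :
    HasDerivAt (fun t : ℝ => joinCoord (x + t • v)) (fderiv ℝ joinCoord x v) 0 := by
  have h1 : HasDerivAt (fun t : ℝ => x + t • v) v 0 := by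
    simpa using ((hasDerivAt_id (0 : ℝ)).smul_const v).const_add x
  have h2 := (differentiableAt_joinCoord hx).hasFDerivAt
  exact HasFDerivAt.comp_hasDerivAt_of_eq 0 h2 h1 (by simp)

/-- The part of the Jacobian matrix of `joinCoord` on and below the diagonal. It is upper triangular,
so its other entries do not enter the determinant. -/
theorem fderiv_joinCoord_single {x : Fin n → ℝ} (hx : x ∈ openSimplex n) {j k : Fin n}
    (hkj : k ≤ j) : fderiv ℝ joinCoord x (Pi.single k 1) j =
      if k = j then (1 - tailSum x j)⁻¹ else 0 := by
  have h1 := hasDerivAt_pi.1 (hasDerivAt_joinCoord hx (Pi.single k 1)) j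
  have h2 : ∀ t : ℝ, joinCoord (x + t • (Pi.single k 1 : Fin n → ℝ)) j =
      (x j + t * (Pi.single k 1 : Fin n → ℝ) j) / (1 - tailSum x j) := by
    intro t
    have h3 : tailSum (x + t • (Pi.single k 1 : Fin n → ℝ)) j = tailSum x j := by
      refine Finset.sum_congr rfl fun l _ => ?_
      split_ifs with hl
      · have : l ≠ k := (hkj.trans_lt hl).ne'
        simp [this]
      · rfl
    rw [joinCoord, h3]
    simp
  simp only [h2] at h1
  have h4 : HasDerivAt (fun t : ℝ => (x j + t * (Pi.single k 1 : Fin n → ℝ) j) / (1 - tailSum x j))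
      ((1 * (Pi.single k 1 : Fin n → ℝ) j) / (1 - tailSum x j)) 0 :=
    (((hasDerivAt_id (0 : ℝ)).mul_const _).const_add _).div_const _
  rw [h1.unique h4]
  split_ifs with h
  · subst h; simp
  · rw [Pi.single_eq_of_ne (Ne.symm h)]; simp

theorem det_fderiv_joinCoord {x : Fin n → ℝ} (hx : x ∈ openSimplex n) :
    (fderiv ℝ joinCoord x).det = ∏ j, (1 - tailSum x j)⁻¹ := by
  rw [ContinuousLinearMap.det, ← LinearMap.det_toMatrix', Matrix.det_of_isUpperTriangular]
  · refine Finset.prod_congr rfl fun j _ => ?_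
    rw [LinearMap.toMatrix'_apply]
    exact (fderiv_joinCoord_single hx le_rfl).trans (if_pos rfl)
  · intro j k hkj
    rw [LinearMap.toMatrix'_apply]
    exact (fderiv_joinCoord_single hx (le_of_lt hkj)).trans (if_neg (ne_of_lt hkj))

theorem det_fderiv_joinCoord_pos {x : Fin n → ℝ} (hx : x ∈ openSimplex n) :
    0 < (fderiv ℝ joinCoord x).det := by
  rw [det_fderiv_joinCoord hx]
  exact Finset.prod_pos fun j _ => inv_pos.2 (sub_pos.2 (tailSum_lt_one hx j))

theorem setIntegral_openCube (g : (Fin n → ℝ) → ℝ) :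
    ∫ s in openCube n, g s =
      ∫ x in openSimplex n, (fderiv ℝ joinCoord x).det * g (joinCoord x) := by
  rw [← joinCoord_image, integral_image_eq_integral_abs_det_fderiv_smul volume
    isOpen_openSimplex.measurableSet
    (fun x hx => (differentiableAt_joinCoord hx).hasFDerivAt.hasFDerivWithinAt) joinCoord_injOn]
  refine setIntegral_congr_fun isOpen_openSimplex.measurableSet fun x hx => ?_
  simp only [smul_eq_mul, abs_of_pos (det_fderiv_joinCoord_pos hx)]

theorem AlternatingMap.map_clm_single (η : (Fin n → ℝ) [⋀^Fin n]→ₗ[ℝ] ℝ)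
    (L : (Fin n → ℝ) →L[ℝ] (Fin n → ℝ)) :
    η (fun j => L (Pi.single j 1)) = L.det * η (fun j => Pi.single j 1) := by
  have h1 := η.eq_smul_basis_det (Pi.basisFun ℝ (Fin n))
  have h2 : η (fun j => L (Pi.single j 1)) =
      η (Pi.basisFun ℝ (Fin n)) * (Pi.basisFun ℝ (Fin n)).det
        ((L : (Fin n → ℝ) →ₗ[ℝ] (Fin n → ℝ)) ∘ (Pi.basisFun ℝ (Fin n))) := by
    conv_lhs => rw [h1]
    simp [Function.comp_def]
  rw [h2, Module.Basis.det_comp, Module.Basis.det_self, mul_one, mul_comm]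
  congr 2
  funext j
  simp

/-- The change of variables `s = joinCoord x`, for a field `η` of top degree forms. -/
theorem setIntegral_openCube_form (η : (Fin n → ℝ) → (Fin n → ℝ) [⋀^Fin n]→ₗ[ℝ] ℝ) :
    ∫ s in openCube n, η s (fun k => Pi.single k 1) =
      ∫ x in openSimplex n, η (joinCoord x) (fun j => fderiv ℝ joinCoord x (Pi.single j 1)) := by
  rw [setIntegral_openCube]
  refine setIntegral_congr_fun isOpen_openSimplex.measurableSet fun x _ => ?_
  exact ((η (joinCoord x)).map_clm_single _).symm

theorem prod_one_sub_tailSum {x : Fin n → ℝ} (hx : x ∈ openSimplex n) :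
    ∏ j, (1 - tailSum x j) = ∏ j : Fin n, (1 - joinCoord x j) ^ (j : ℕ) := by
  induction n with
  | zero => rfl
  | succ n ih =>
    have h := last_lt_one_of_mem_openSimplex hx
    have h' : 1 - x (Fin.last n) ≠ 0 := by linarith
    rw [Fin.prod_univ_castSucc, Fin.prod_univ_castSucc, tailSum_last, joinCoord_last]
    simp only [joinCoord_castSucc x h.ne, Fin.val_castSucc, Fin.val_last]
    rw [← ih (init_div_mem_openSimplex hx)]
    simp only [tailSum_castSucc, tailSum_div (fun k => x k.castSucc), one_sub_div h']
    rw [Finset.prod_div_distrib, Finset.prod_const, Finset.card_univ, Fintype.card_fin,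
      div_mul_cancel₀ _ (pow_ne_zero _ h'), sub_zero, mul_one]
    exact Finset.prod_congr rfl fun j _ => by ring

theorem volume_real_openSimplex : volume.real (openSimplex n) = (n.factorial : ℝ)⁻¹ := by
  have h1 := setIntegral_openCube (n := n) fun s => ∏ j : Fin n, (1 - s j) ^ (j : ℕ)
  have h2 : ∫ x in openSimplex n, (fderiv ℝ joinCoord x).det *
      ∏ j : Fin n, (1 - joinCoord x j) ^ (j : ℕ) = ∫ x in openSimplex n, (1 : ℝ) := by
    refine setIntegral_congr_fun isOpen_openSimplex.measurableSet fun x hx => ?_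
    rw [← prod_one_sub_tailSum hx, det_fderiv_joinCoord hx, ← Finset.prod_mul_distrib]
    exact Finset.prod_eq_one fun j _ =>
      inv_mul_cancel₀ (sub_ne_zero.2 (tailSum_lt_one hx j).ne')
  rw [h2, setIntegral_const, smul_eq_mul, mul_one] at h1
  rw [← h1, openCube, volume_pi, Measure.restrict_pi_pi,
    integral_fintype_prod_eq_prod (𝕜 := ℝ) (fun (j : Fin n) (s : ℝ) => (1 - s) ^ (j : ℕ))]
  have h3 : ∀ j : Fin n, ∫ s in Ioo (0 : ℝ) 1, (1 - s) ^ (j : ℕ) = ((j : ℕ) + 1 : ℝ)⁻¹ := by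
    intro j
    rw [← integral_Ioc_eq_integral_Ioo, ← intervalIntegral.integral_of_le zero_le_one,
      intervalIntegral.integral_comp_sub_left (fun s : ℝ => s ^ (j : ℕ))]
    simp
  simp only [h3]
  rw [Finset.prod_inv_distrib, Fin.prod_univ_eq_prod_range (fun j => ((j : ℝ) + 1)),
    ← Finset.prod_range_add_one_eq_factorial]
  push_cast
  rfl

theorem setIntegral_openCube_eq_Icc (g : (Fin n → ℝ) → ℝ) :
    ∫ s in openCube n, g s = ∫ s in Icc (0 : Fin n → ℝ) 1, g s :=
  setIntegral_congr_set Measure.univ_pi_Ioo_ae_eq_Icc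

end simplexCube

/-! ### Charts and tangent vectors -/

section charts

variable {E : Type u} [AddCommGroup E] [Module ℝ E] [TopologicalSpace E]
  [IsTopologicalAddGroup E] [ContinuousSMul ℝ E] [LocallyConvexSpace ℝ E] [T2Space E]
  {G : Type v} [TopologicalSpace G] [ChartedSpace E G]
  {V : Type w} [AddCommGroup V] [Module ℝ V] [TopologicalSpace V]
  [IsTopologicalAddGroup V] [ContinuousSMul ℝ V] [LocallyConvexSpace ℝ V] [T2Space V]

theorem IsSmoothChart.smoothAt_comp_symm {φ : OpenPartialHomeomorph G E} (hφ : IsSmoothChart φ)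
    {c : OpenPartialHomeomorph G E} (hc : c ∈ atlas E G) {y : E} (hy : y ∈ φ.target)
    (hyc : φ.symm y ∈ c.source) : BastianiSmoothAt (fun x => c (φ.symm x)) y :=
  (hφ c hc).1.smoothAt (φ.symm.trans c).open_source (by simp [hy, hyc])

theorem IsSmoothChart.smoothAt_symm_comp {φ : OpenPartialHomeomorph G E} (hφ : IsSmoothChart φ)
    {c : OpenPartialHomeomorph G E} (hc : c ∈ atlas E G) {y : E} (hy : y ∈ c.target)
    (hyc : c.symm y ∈ φ.source) : BastianiSmoothAt (fun x => φ (c.symm x)) y :=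
  (hφ c hc).2.smoothAt (c.symm.trans φ).open_source (by simp [hy, hyc])

theorem IsSmoothChart.smoothAt_of_atlas {φ : OpenPartialHomeomorph G E} (hφ : IsSmoothChart φ)
    {c : OpenPartialHomeomorph G E} (hc : c ∈ atlas E G) {f : V → G} {p : V}
    (hf : ContinuousAt f p) (hp : f p ∈ φ.source) (hpc : f p ∈ c.source)
    (h : BastianiSmoothAt (fun x => c (f x)) p) : BastianiSmoothAt (fun x => φ (f x)) p := by
  have h1 := hφ.smoothAt_symm_comp hc (c.map_source hpc) (by rwa [c.left_inv hpc])
  refine (BastianiSmoothAt.comp (g := fun x => φ (c.symm x)) (f := fun x => c (f x)) h1 h).congr ?_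
  filter_upwards [hf.eventually (c.open_source.mem_nhds hpc)] with x hx
  rw [c.left_inv hx]

theorem IsSmoothChart.smoothAt_atlas {φ : OpenPartialHomeomorph G E} (hφ : IsSmoothChart φ)
    {c : OpenPartialHomeomorph G E} (hc : c ∈ atlas E G) {f : V → G} {p : V}
    (hf : ContinuousAt f p) (hp : f p ∈ φ.source) (hpc : f p ∈ c.source)
    (h : BastianiSmoothAt (fun x => φ (f x)) p) : BastianiSmoothAt (fun x => c (f x)) p := by
  have h1 := hφ.smoothAt_comp_symm hc (φ.map_source hp) (by rwa [φ.left_inv hp])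
  refine (BastianiSmoothAt.comp (g := fun x => c (φ.symm x)) (f := fun x => φ (f x)) h1 h).congr ?_
  filter_upwards [hf.eventually (φ.open_source.mem_nhds hp)] with x hx
  rw [φ.left_inv hx]

/-- The tangent vector at the point with coordinate `y` in the chart `φ` whose coordinates are `v`,
as a vector of `T_g G = E`, `g = φ⁻¹(y)`. -/
def chartTangent (φ : OpenPartialHomeomorph G E) (y v : E) : E :=
  dirDeriv (fun x => chartAt E (φ.symm y) (φ.symm x)) (y, v)

theorem IsSmoothChart.isLinearMap_chartTangent {φ : OpenPartialHomeomorph G E}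
    (hφ : IsSmoothChart φ) {y : E} (hy : y ∈ φ.target) : IsLinearMap ℝ (chartTangent φ y) :=
  (hφ.smoothAt_comp_symm (chart_mem_atlas E (φ.symm y)) hy
    (mem_chart_source E _)).isLinearMap_dirDeriv

/-- The velocity of a curve which is differentiable at `t = 0` in the chart `φ`. -/
theorem IsSmoothChart.velocity_eq {φ : OpenPartialHomeomorph G E} (hφ : IsSmoothChart φ)
    {γ : ℝ → G} (hγ : ContinuousAt γ 0) (h0 : γ 0 ∈ φ.source) {v : E}
    (h : HasCurveDeriv (fun t => φ (γ t)) v) :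
    velocity E γ = chartTangent φ (φ (γ 0)) v := by
  have h1 := hφ.smoothAt_comp_symm (chart_mem_atlas E (γ 0)) (φ.map_source h0)
    (by rw [φ.left_inv h0]; exact mem_chart_source E _)
  have h2 := BastianiSmoothAt.comp_hasCurveDeriv (γ := fun t => φ (γ t)) h1 h
  rw [velocity, chartTangent, φ.left_inv h0]
  refine (h2.congr ?_).curveDeriv_eq
  filter_upwards [hγ.eventually (φ.open_source.mem_nhds h0)] with t ht
  rw [φ.left_inv ht]

theorem OpenPartialHomeomorph.continuousAt_symm_line (φ : OpenPartialHomeomorph G E) {y : E}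
    (hy : y ∈ φ.target) (v : E) : ContinuousAt (fun t : ℝ => φ.symm (y + t • v)) 0 := by
  have h1 : ContinuousAt (fun t : ℝ => y + t • v) 0 := by fun_prop
  exact ContinuousAt.comp (f := fun t : ℝ => y + t • v) (by
    simpa using φ.continuousAt_symm hy) h1

theorem OpenPartialHomeomorph.eventually_right_inv_line (φ : OpenPartialHomeomorph G E) {y : E}
    (hy : y ∈ φ.target) (v : E) :
    (fun t : ℝ => y + t • v) =ᶠ[𝓝 0] fun t : ℝ => φ (φ.symm (y + t • v)) := by
  filter_upwards [(tendsto_add_smul_nhds_zero y v).eventually (φ.open_target.mem_nhds hy)]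
    with t ht
  rw [φ.right_inv ht]

theorem FormField.inChart_eq {i : ℕ} (ω : FormField E G i) {φ : OpenPartialHomeomorph G E}
    (hφ : IsSmoothChart φ) {y : E} (hy : y ∈ φ.target) (v : Fin i → E) :
    ω.inChart φ y v = ω (φ.symm y) (fun j => chartTangent φ y (v j)) := by
  unfold FormField.inChart
  congr 1
  funext j
  have h0 : φ.symm (y + (0 : ℝ) • v j) ∈ φ.source := by simpa using φ.map_target hy
  rw [hφ.velocity_eq (φ.continuousAt_symm_line hy (v j)) h0
    ((hasCurveDeriv_line y (v j)).congr (φ.eventually_right_inv_line hy (v j)))]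
  simp [φ.right_inv hy]

/-- The transformation rule of the coordinate expressions of a form under a change of charts. -/
theorem FormField.inChart_eq_inChart {i : ℕ} (ω : FormField E G i)
    {φ c : OpenPartialHomeomorph G E} (hφ : IsSmoothChart φ) (hc : IsSmoothChart c)
    (hcA : c ∈ atlas E G) {y : E} (hy : y ∈ φ.target) (hyc : φ.symm y ∈ c.source)
    (v : Fin i → E) :
    ω.inChart φ y v =
      ω.inChart c (c (φ.symm y)) (fun j => dirDeriv (fun x => c (φ.symm x)) (y, v j)) := by
  rw [ω.inChart_eq hc (c.map_source hyc), c.left_inv hyc]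
  unfold FormField.inChart
  congr 1
  funext j
  have h0 : φ.symm (y + (0 : ℝ) • v j) ∈ c.source := by simpa using hyc
  have h1 := hasDirDeriv_iff_hasCurveDeriv.1 ((hφ.smoothAt_comp_symm hcA hy hyc).hasDirDeriv (v j))
  rw [hc.velocity_eq (φ.continuousAt_symm_line hy (v j)) h0 h1]
  simp

/-- A smooth form has smooth coordinate expressions in every smooth chart `φ`, not only in the charts
`c` of the atlas. -/
theorem FormField.IsSmooth.inChart_smoothAt {i : ℕ} {ω : FormField E G i} (hω : ω.IsSmooth)
    {φ c : OpenPartialHomeomorph G E} (hφ : IsSmoothChart φ) (hc : IsSmoothChart c)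
    (hcA : c ∈ atlas E G) {y : E} (hy : y ∈ φ.target) (hyc : φ.symm y ∈ c.source)
    (v : Fin i → E) :
    BastianiSmoothAt (fun p : E × (Fin i → E) => ω.inChart φ p.1 p.2) (y, v) := by
  have hψ := hφ.smoothAt_comp_symm hcA hy hyc
  have h1 : BastianiSmoothAt (fun p : E × (Fin i → E) => (c (φ.symm p.1), fun j =>
      dirDeriv (fun x => c (φ.symm x)) (p.1, p.2 j))) (y, v) := by
    have hp1 : BastianiSmoothAt (fun p : E × (Fin i → E) => p.1) (y, v) :=
      (bastianiSmoothAt_id (y, v)).fst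
    refine BastianiSmoothAt.prodMk (BastianiSmoothAt.comp (g := fun x => c (φ.symm x)) hψ hp1)
      (BastianiSmoothAt.pi fun j => ?_)
    exact BastianiSmoothAt.comp (g := dirDeriv (fun x => c (φ.symm x)))
      (f := fun p : E × (Fin i → E) => (p.1, p.2 j)) (hψ.dirDeriv (v j))
      (hp1.prodMk ((bastianiSmoothAt_id (y, v)).snd.apply j))
  have h2 : BastianiSmoothAt (fun p : E × (Fin i → E) => ω.inChart c p.1 p.2)
      (c (φ.symm y), fun j => dirDeriv (fun x => c (φ.symm x)) (y, v j)) :=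
    (hω c hcA).smoothAt (c.open_target.prod isOpen_univ) ⟨c.map_source hyc, mem_univ _⟩
  refine (BastianiSmoothAt.comp (g := fun p : E × (Fin i → E) => ω.inChart c p.1 p.2)
    (f := fun p : E × (Fin i → E) => (c (φ.symm p.1), fun j =>
      dirDeriv (fun x => c (φ.symm x)) (p.1, p.2 j))) h2 h1).congr ?_
  have h3 : ∀ᶠ p : E × (Fin i → E) in 𝓝 (y, v), p.1 ∈ φ.target ∧ φ.symm p.1 ∈ c.source :=
    (continuous_fst.tendsto (y, v)).eventually
      ((φ.open_target.eventually_mem hy).and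
        ((φ.continuousAt_symm hy).eventually (c.open_source.mem_nhds hyc)))
  filter_upwards [h3] with p hp
  exact (ω.inChart_eq_inChart hφ hc hcA hp.1 hp.2 p.2).symm

end charts

/-! ### Smooth maps near the identity of a Lie group -/

section lieGroup

variable {E : Type u} [AddCommGroup E] [Module ℝ E] [TopologicalSpace E]
  [IsTopologicalAddGroup E] [ContinuousSMul ℝ E] [LocallyConvexSpace ℝ E] [T2Space E]
  {G : Type v} [Group G] [TopologicalSpace G] [ChartedSpace E G] [FrechetLieGroup E G]
  {V : Type w} [AddCommGroup V] [Module ℝ V] [TopologicalSpace V]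
  [IsTopologicalAddGroup V] [ContinuousSMul ℝ V] [LocallyConvexSpace ℝ V] [T2Space V]
  {φ : OpenPartialHomeomorph G E}

theorem FrechetLieGroup.continuous_mul (E : Type u) [AddCommGroup E] [Module ℝ E]
    [TopologicalSpace E] (G : Type v) [Group G] [TopologicalSpace G] [ChartedSpace E G]
    [FrechetLieGroup E G] : Continuous fun p : G × G => p.1 * p.2 :=
  continuousOn_univ.1 (FrechetLieGroup.smooth_mul (E := E) (G := G)).1

theorem FrechetLieGroup.continuous_inv (E : Type u) [AddCommGroup E] [Module ℝ E]
    [TopologicalSpace E] (G : Type v) [Group G] [TopologicalSpace G] [ChartedSpace E G]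
    [FrechetLieGroup E G] : Continuous fun g : G => g⁻¹ :=
  continuousOn_univ.1 (FrechetLieGroup.smooth_inv (E := E) (G := G)).1

theorem IsConvexChart.zero_mem (hφ : IsConvexChart φ) : (0 : E) ∈ φ.target :=
  hφ.map_one ▸ φ.map_source hφ.one_mem

theorem IsConvexChart.symm_zero (hφ : IsConvexChart φ) : φ.symm (0 : E) = 1 :=
  hφ.map_one ▸ φ.left_inv hφ.one_mem

/-- The identification of `T_e G` with `E` does not change when the chart `φ` is used. -/
theorem IsConvexChart.chartTangent_zero (hφ : IsConvexChart φ) (v : E) :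
    chartTangent φ 0 v = v := by
  set c := chartAt E (1 : G) with hcdef
  have hcA : c ∈ atlas E G := chart_mem_atlas E 1
  have h1c : (1 : G) ∈ c.source := mem_chart_source E 1
  have hψ := hφ.smooth.smoothAt_comp_symm hcA hφ.zero_mem (by rwa [hφ.symm_zero])
  have hχ := hφ.smooth.smoothAt_symm_comp hcA (c.map_source h1c)
    (by rw [c.left_inv h1c]; exact hφ.one_mem)
  rw [chartTangent, hφ.symm_zero]
  have hw := hasDirDeriv_iff_hasCurveDeriv.1 (hψ.hasDirDeriv v)
  set w := dirDeriv (fun x => c (φ.symm x)) (0, v)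
  have e0 : c (φ.symm (0 + (0 : ℝ) • v)) = c 1 := by rw [zero_smul, add_zero, hφ.symm_zero]
  have hw' := BastianiSmoothAt.comp_hasCurveDeriv (f := fun x => φ (c.symm x))
    (γ := fun t : ℝ => c (φ.symm (0 + t • v))) (by rw [e0]; exact hχ) hw
  have h3 : HasCurveDeriv (fun t : ℝ => φ (c.symm (c (φ.symm (0 + t • v))))) v := by
    refine (hasCurveDeriv_line 0 v).congr ?_
    filter_upwards [φ.eventually_right_inv_line hφ.zero_mem v,
      (φ.continuousAt_symm_line hφ.zero_mem v).eventually (c.open_source.mem_nhds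
        (by simpa only [zero_smul, add_zero, hφ.symm_zero] using h1c))] with t ht htc
    rw [c.left_inv htc, ← ht]
  have h4 : dirDeriv (fun x => φ (c.symm x)) (c 1, w) = w := hφ.deriv_one w
  have h5 := h3.unique hw'
  simp only [e0, h4] at h5
  exact h5.symm

/-- `f : V → G` sends `p` to the identity, and is smooth near `p` in the chart `φ`. -/
structure SmoothToOne (φ : OpenPartialHomeomorph G E) (f : V → G) (p : V) : Prop where
  eq_one : f p = 1
  continuousAt : ContinuousAt f p
  smoothAt : BastianiSmoothAt (fun x => φ (f x)) p

theorem SmoothToOne.one (p : V) :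
    SmoothToOne φ (fun _ : V => (1 : G)) p :=
  ⟨rfl, continuousAt_const, bastianiSmoothAt_const _ p⟩

theorem SmoothToOne.symm_comp (hφ : IsConvexChart φ) {z : V → E} {p : V}
    (hz : BastianiSmoothAt z p) (h0 : z p = 0) : SmoothToOne φ (fun x => φ.symm (z x)) p := by
  have h1 : ContinuousAt φ.symm (z p) := by
    rw [h0]; exact φ.continuousAt_symm hφ.zero_mem
  refine ⟨by rw [h0, hφ.symm_zero], h1.comp hz.continuousAt, hz.congr ?_⟩
  filter_upwards [hz.continuousAt.eventually (φ.open_target.mem_nhds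
    (by rw [h0]; exact hφ.zero_mem))] with x hx
  rw [φ.right_inv hx]

theorem SmoothToOne.mul (hφ : IsConvexChart φ) {a b : V → G} {p : V} (ha : SmoothToOne φ a p)
    (hb : SmoothToOne φ b p) : SmoothToOne φ (fun x => a x * b x) p := by
  set c := chartAt E (1 : G)
  have hcA : c ∈ atlas E G := chart_mem_atlas E 1
  have h1c : (1 : G) ∈ c.source := mem_chart_source E 1
  have hmul := FrechetLieGroup.continuous_mul E G
  have hcont : ContinuousAt (fun x => a x * b x) p :=
    ContinuousAt.comp (g := fun q : G × G => q.1 * q.2) hmul.continuousAt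
      (ha.continuousAt.prodMk hb.continuousAt)
  have h1 : a p * b p = 1 := by rw [ha.eq_one, hb.eq_one, mul_one]
  refine ⟨h1, hcont, hφ.smooth.smoothAt_of_atlas hcA hcont (by rw [h1]; exact hφ.one_mem)
    (by rw [h1]; exact h1c) ?_⟩
  have ha' := hφ.smooth.smoothAt_atlas hcA ha.continuousAt
    (by rw [ha.eq_one]; exact hφ.one_mem) (by rw [ha.eq_one]; exact h1c) ha.smoothAt
  have hb' := hφ.smooth.smoothAt_atlas hcA hb.continuousAt
    (by rw [hb.eq_one]; exact hφ.one_mem) (by rw [hb.eq_one]; exact h1c) hb.smoothAt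
  have hm := ((FrechetLieGroup.smooth_mul (E := E) (G := G)).2 (c.prod c)
    ⟨c, hcA, c, hcA, rfl⟩ c hcA).smoothAt (x := (c (a p), c (b p)))
    ((c.prod c).isOpen_inter_preimage_symm (isOpen_univ.inter (c.open_source.preimage hmul)))
    (by simp [ha.eq_one, hb.eq_one, h1c])
  refine (hm.comp (f := fun x => (c (a x), c (b x))) (ha'.prodMk hb')).congr ?_
  filter_upwards [ha.continuousAt.eventually (c.open_source.mem_nhds (by rwa [ha.eq_one])),
    hb.continuousAt.eventually (c.open_source.mem_nhds (by rwa [hb.eq_one]))] with x hx hx'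
  simp [c.left_inv hx, c.left_inv hx']

theorem SmoothToOne.inv (hφ : IsConvexChart φ) {a : V → G} {p : V} (ha : SmoothToOne φ a p) :
    SmoothToOne φ (fun x => (a x)⁻¹) p := by
  set c := chartAt E (1 : G)
  have hcA : c ∈ atlas E G := chart_mem_atlas E 1
  have h1c : (1 : G) ∈ c.source := mem_chart_source E 1
  have hinv := FrechetLieGroup.continuous_inv E G
  have hcont : ContinuousAt (fun x => (a x)⁻¹) p :=
    ContinuousAt.comp (g := fun q : G => q⁻¹) hinv.continuousAt ha.continuousAt
  have h1 : (a p)⁻¹ = 1 := by rw [ha.eq_one, inv_one]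
  refine ⟨h1, hcont, hφ.smooth.smoothAt_of_atlas hcA hcont (by rw [h1]; exact hφ.one_mem)
    (by rw [h1]; exact h1c) ?_⟩
  have ha' := hφ.smooth.smoothAt_atlas hcA ha.continuousAt
    (by rw [ha.eq_one]; exact hφ.one_mem) (by rw [ha.eq_one]; exact h1c) ha.smoothAt
  have hm := ((FrechetLieGroup.smooth_inv (E := E) (G := G)).2 c hcA c hcA).smoothAt (x := c (a p))
    (c.isOpen_inter_preimage_symm (isOpen_univ.inter (c.open_source.preimage hinv)))
    (by simp [ha.eq_one, h1c])
  refine (hm.comp (f := fun x => c (a x)) ha').congr ?_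
  filter_upwards [ha.continuousAt.eventually (c.open_source.mem_nhds (by rwa [ha.eq_one]))] with x hx
  simp [c.left_inv hx]

theorem SmoothToOne.affineJoin (hφ : IsConvexChart φ) {a b : V → G} {r : V → ℝ} {p : V}
    (ha : SmoothToOne φ a p) (hb : SmoothToOne φ b p) (hr : BastianiSmoothAt r p) :
    SmoothToOne φ (fun x => affineJoin φ (a x) (b x) (r x)) p := by
  have h1 := (ha.inv hφ).mul hφ hb
  refine ha.mul hφ (SmoothToOne.symm_comp hφ (hr.smul h1.smoothAt) ?_)
  simp only [h1.eq_one, hφ.map_one, smul_zero]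

theorem IsExpMap.map_zero {exp : E → G} (hexp : IsExpMap exp) : exp 0 = 1 := by
  have := hexp.map_add_smul 0 0 0
  simpa using this

theorem IsExpMap.continuous {exp : E → G} (hexp : IsExpMap exp) : Continuous exp :=
  continuousOn_univ.1 hexp.smooth.1

theorem IsExpMap.smoothAt_chart {exp : E → G} (hexp : IsExpMap exp)
    {c : OpenPartialHomeomorph G E} (hcA : c ∈ atlas E G) {X : E} (hX : exp X ∈ c.source) :
    BastianiSmoothAt (fun x => c (exp x)) X := by
  refine (hexp.smooth.2 (OpenPartialHomeomorph.refl E) rfl c hcA).smoothAt ?_ ?_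
  · exact (OpenPartialHomeomorph.refl E).isOpen_inter_preimage_symm
      (isOpen_univ.inter (c.open_source.preimage hexp.continuous))
  · simpa using hX

theorem IsExpMap.smoothToOne {exp : E → G} (hexp : IsExpMap exp) (hφ : IsConvexChart φ) :
    SmoothToOne φ exp 0 := by
  have h1c : exp 0 ∈ (chartAt E (1 : G)).source := by
    rw [hexp.map_zero]; exact mem_chart_source E 1
  exact ⟨hexp.map_zero, hexp.continuous.continuousAt,
    hφ.smooth.smoothAt_of_atlas (chart_mem_atlas E (1 : G)) hexp.continuous.continuousAt
      (by rw [hexp.map_zero]; exact hφ.one_mem) h1c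
      (hexp.smoothAt_chart (chart_mem_atlas E (1 : G)) h1c)⟩

theorem SmoothToOne.comp {V' : Type*} [AddCommGroup V'] [Module ℝ V'] [TopologicalSpace V']
    [IsTopologicalAddGroup V'] [ContinuousSMul ℝ V'] [LocallyConvexSpace ℝ V'] [T2Space V']
    {f : V → G} {z : V' → V} {p : V'}
    (hf : SmoothToOne φ f (z p)) (hz : BastianiSmoothAt z p) :
    SmoothToOne φ (fun x => f (z x)) p :=
  ⟨hf.eq_one, hf.continuousAt.comp hz.continuousAt, hf.smoothAt.comp (g := fun x => φ (f x)) hz⟩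

theorem SmoothToOne.partialProd (hφ : IsConvexChart φ) {n : ℕ} {a : Fin n → V → G} {p : V}
    (ha : ∀ k, SmoothToOne φ (a k) p) (j : Fin (n + 1)) :
    SmoothToOne φ (fun x => Fin.partialProd (fun k => a k x) j) p := by
  induction j using Fin.induction with
  | zero => simpa using SmoothToOne.one p
  | succ j ih =>
    simp only [Fin.partialProd_succ]
    exact ih.mul hφ (ha j)

/-! ### Velocities of curves through the identity -/

/-- The curve `γ` passes through the identity at `t = 0`, with velocity `v` in the chart `φ`. -/
structure HasVelocityAtOne (φ : OpenPartialHomeomorph G E) (γ : ℝ → G) (v : E) : Prop where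
  eq_one : γ 0 = 1
  continuousAt : ContinuousAt γ 0
  hasCurveDeriv : HasCurveDeriv (fun t => φ (γ t)) v

theorem HasVelocityAtOne.symm_comp (hφ : IsConvexChart φ) {z : ℝ → E} {v : E}
    (hz : HasCurveDeriv z v) (h0 : z 0 = 0) : HasVelocityAtOne φ (fun t => φ.symm (z t)) v := by
  have h1 : ContinuousAt φ.symm (z 0) := by
    rw [h0]; exact φ.continuousAt_symm hφ.zero_mem
  refine ⟨by rw [h0, hφ.symm_zero], h1.comp hz.continuousAt, hz.congr ?_⟩
  filter_upwards [hz.continuousAt.eventually (φ.open_target.mem_nhds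
    (by rw [h0]; exact hφ.zero_mem))] with x hx
  rw [φ.right_inv hx]

theorem HasVelocityAtOne.one :
    HasVelocityAtOne φ (fun _ => (1 : G)) (0 : E) :=
  ⟨rfl, continuousAt_const, hasCurveDeriv_const _⟩

/-- The derivative of the multiplication at `(e, e)` is the addition. -/
theorem HasVelocityAtOne.mul (hφ : IsConvexChart φ) {a b : ℝ → G} {v w : E}
    (ha : HasVelocityAtOne φ a v) (hb : HasVelocityAtOne φ b w) :
    HasVelocityAtOne φ (fun t => a t * b t) (v + w) := by
  let m : E × E → E := fun p => φ (φ.symm p.1 * φ.symm p.2)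
  have hm : BastianiSmoothAt m (0, 0) :=
    ((SmoothToOne.symm_comp hφ (z := fun p : E × E => p.1) (p := (0, 0))
      (bastianiSmoothAt_id _).fst rfl).mul hφ
      (SmoothToOne.symm_comp hφ (z := fun p : E × E => p.2) (p := (0, 0))
      (bastianiSmoothAt_id _).snd rfl)).smoothAt
  have hl : dirDeriv m ((0, 0), (v, 0)) = v := by
    refine ((hasDirDeriv_iff_hasCurveDeriv.2 ?_).dirDeriv_eq)
    refine (hasCurveDeriv_line 0 v).congr ?_
    filter_upwards [φ.eventually_right_inv_line hφ.zero_mem v] with t ht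
    simpa [m, hφ.symm_zero] using ht
  have hr : dirDeriv m ((0, 0), (0, w)) = w := by
    refine ((hasDirDeriv_iff_hasCurveDeriv.2 ?_).dirDeriv_eq)
    refine (hasCurveDeriv_line 0 w).congr ?_
    filter_upwards [φ.eventually_right_inv_line hφ.zero_mem w] with t ht
    simpa [m, hφ.symm_zero] using ht
  have hlr : dirDeriv m ((0, 0), (v, w)) = v + w := by
    have := hm.isLinearMap_dirDeriv.map_add (v, 0) (0, w)
    simpa [hl, hr] using this
  have ha0 : φ (a 0) = 0 := by rw [ha.eq_one, hφ.map_one]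
  have hb0 : φ (b 0) = 0 := by rw [hb.eq_one, hφ.map_one]
  refine ⟨by rw [ha.eq_one, hb.eq_one, mul_one], ContinuousAt.comp (g := fun q : G × G => q.1 * q.2)
    (FrechetLieGroup.continuous_mul E G).continuousAt
      (ha.continuousAt.prodMk hb.continuousAt), ?_⟩
  have h1 := BastianiSmoothAt.comp_hasCurveDeriv (f := m) (γ := fun t => (φ (a t), φ (b t)))
    (by simpa only [ha0, hb0] using hm) (ha.hasCurveDeriv.prodMk hb.hasCurveDeriv)
  simp only [ha0, hb0, hlr] at h1
  refine h1.congr ?_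
  filter_upwards [ha.continuousAt.eventually (φ.open_source.mem_nhds
      (by rw [ha.eq_one]; exact hφ.one_mem)),
    hb.continuousAt.eventually (φ.open_source.mem_nhds
      (by rw [hb.eq_one]; exact hφ.one_mem))] with x hx hx'
  simp [m, φ.left_inv hx, φ.left_inv hx']

theorem HasVelocityAtOne.inv (hφ : IsConvexChart φ) {a : ℝ → G} {v : E}
    (ha : HasVelocityAtOne φ a v) : HasVelocityAtOne φ (fun t => (a t)⁻¹) (-v) := by
  have hι : BastianiSmoothAt (fun x : E => φ (φ.symm x)⁻¹) 0 :=
    ((SmoothToOne.symm_comp hφ (bastianiSmoothAt_id (0 : E)) rfl).inv hφ).smoothAt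
  have ha0 : φ (a 0) = 0 := by rw [ha.eq_one, hφ.map_one]
  have h1 := BastianiSmoothAt.comp_hasCurveDeriv (γ := fun t => φ (a t))
    (by rw [ha0]; exact hι) ha.hasCurveDeriv
  have h2 : HasVelocityAtOne φ (fun t => (a t)⁻¹)
      (dirDeriv (fun x : E => φ (φ.symm x)⁻¹) (φ (a 0), v)) := by
    refine ⟨by rw [ha.eq_one, inv_one], ContinuousAt.comp (g := fun q : G => q⁻¹)
      (FrechetLieGroup.continuous_inv E G).continuousAt ha.continuousAt, h1.congr ?_⟩
    filter_upwards [ha.continuousAt.eventually (φ.open_source.mem_nhds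
      (by rw [ha.eq_one]; exact hφ.one_mem))] with x hx
    rw [φ.left_inv hx]
  have h3 := (h2.mul hφ ha).hasCurveDeriv
  simp only [inv_mul_cancel] at h3
  rwa [eq_neg_of_add_eq_zero_left (h3.unique (hasCurveDeriv_const _))] at h2

theorem HasVelocityAtOne.affineJoin (hφ : IsConvexChart φ) {a b : ℝ → G} {v w : E}
    (ha : HasVelocityAtOne φ a v) (hb : HasVelocityAtOne φ b w) (s : ℝ) :
    HasVelocityAtOne φ (fun t => affineJoin φ (a t) (b t) s) (v + s • (w - v)) := by
  have h1 := (ha.inv hφ).mul hφ hb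
  rw [neg_add_eq_sub] at h1
  refine ha.mul hφ (HasVelocityAtOne.symm_comp hφ
    (h1.hasCurveDeriv.clm_comp (s • ContinuousLinearMap.id ℝ E)) ?_)
  simp [h1.eq_one, hφ.map_one]

theorem IsExpMap.hasVelocityAtOne {exp : E → G} (hexp : IsExpMap exp) (hφ : IsConvexChart φ)
    (X : E) : HasVelocityAtOne φ (fun t : ℝ => exp (t • X)) X := by
  have h0 : exp ((0 : ℝ) • X) = 1 := by rw [zero_smul, hexp.map_zero]
  have hcont : ContinuousAt (fun t : ℝ => exp (t • X)) 0 :=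
    (hexp.continuous.comp (by fun_prop)).continuousAt
  have h1 := hasDirDeriv_iff_hasCurveDeriv.1 ((hexp.smoothToOne hφ).smoothAt.hasDirDeriv X)
  simp only [zero_add] at h1
  have h2 := hφ.smooth.velocity_eq hcont (by rw [h0]; exact hφ.one_mem) h1
  rw [h0, hφ.map_one, hφ.chartTangent_zero, hexp.velocity_eq X] at h2
  rw [← h2] at h1
  exact ⟨h0, hcont, h1⟩

theorem HasVelocityAtOne.partialProd (hφ : IsConvexChart φ) {n : ℕ} {a : Fin n → ℝ → G}
    {v : Fin n → E} (ha : ∀ k, HasVelocityAtOne φ (a k) (v k)) (j : Fin (n + 1)) :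
    HasVelocityAtOne φ (fun t => Fin.partialProd (fun k => a k t) j) (Fin.partialSum v j) := by
  induction j using Fin.induction with
  | zero => simpa using HasVelocityAtOne.one
  | succ j ih =>
    simp only [Fin.partialProd_succ, Fin.partialSum_succ]
    exact ih.mul hφ (ha j)

end lieGroup

/-! ### The affine simplices in cubical coordinates -/

section cubeSimplex

variable {E : Type u} [AddCommGroup E] [Module ℝ E] [TopologicalSpace E]
  [IsTopologicalAddGroup E] [ContinuousSMul ℝ E] [LocallyConvexSpace ℝ E] [T2Space E]
  {G : Type v} [Group G] [TopologicalSpace G]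

/-- The affine simplex with vertices `g_0, …, g_n`, as a function of the join parameters
`s₁, …, s_n`. Unlike in barycentric coordinates, it is smooth up to the boundary. -/
def cubeSimplex (φ : OpenPartialHomeomorph G E) :
    (n : ℕ) → (Fin (n + 1) → G) → (Fin n → ℝ) → G
  | 0, g, _ => g 0
  | n + 1, g, s =>
    affineJoin φ (cubeSimplex φ n (fun k => g k.castSucc) (fun k => s k.castSucc))
      (g (Fin.last (n + 1))) (s (Fin.last n))

/-- The passage from barycentric coordinates to join parameters. -/
theorem affineSimplex_simplexPoint (φ : OpenPartialHomeomorph G E) {n : ℕ} (g : Fin (n + 1) → G)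
    {x : Fin n → ℝ} (hx : x ∈ openSimplex n) :
    affineSimplex φ n g (simplexPoint x) = cubeSimplex φ n g (joinCoord x) := by
  induction n with
  | zero => rfl
  | succ n ih =>
    have h1 := last_lt_one_of_mem_openSimplex hx
    have hl : simplexPoint x (Fin.last (n + 1)) = x (Fin.last n) := by
      rw [simplexPoint, ← Fin.succ_last, Fin.cons_succ]
    have hi : (fun k : Fin (n + 1) => simplexPoint x k.castSucc / (1 - x (Fin.last n))) =
        simplexPoint (fun k => x k.castSucc / (1 - x (Fin.last n))) := by
      have h2 : 1 - x (Fin.last n) ≠ 0 := by linarith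
      funext k
      induction k using Fin.cases with
      | zero =>
        simp only [simplexPoint, Fin.castSucc_zero, Fin.cons_zero, Fin.sum_univ_castSucc,
          ← Finset.sum_div]
        field_simp
        ring
      | succ k =>
        simp only [simplexPoint, Fin.cons_succ, ← Fin.succ_castSucc]
    rw [affineSimplex, if_neg (by rw [hl]; exact h1.ne), hl, hi, ih _ (init_div_mem_openSimplex hx),
      cubeSimplex, joinCoord_last]
    simp only [joinCoord_castSucc x h1.ne]

/-- The iterated cone over `Y_0, …, Y_n` in the vector space `E`, as a function of the join
parameters: the linearization of `cubeSimplex` at the constant tuple `e`. -/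
def linearCone : (n : ℕ) → (Fin (n + 1) → E) → (Fin n → ℝ) → E
  | 0, Y, _ => Y 0
  | n + 1, Y, s =>
    linearCone n (fun k => Y k.castSucc) (fun k => s k.castSucc) +
      s (Fin.last n) • (Y (Fin.last (n + 1)) -
        linearCone n (fun k => Y k.castSucc) (fun k => s k.castSucc))

/-- In barycentric coordinates the linear cone is an affine map. -/
theorem linearCone_joinCoord {n : ℕ} (Y : Fin (n + 1) → E) {x : Fin n → ℝ}
    (hx : x ∈ openSimplex n) :
    linearCone n Y (joinCoord x) = Y 0 + ∑ j, x j • (Y j.succ - Y 0) := by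
  induction n with
  | zero => simp [linearCone]
  | succ n ih =>
    have h1 := last_lt_one_of_mem_openSimplex hx
    have h2 : 1 - x (Fin.last n) ≠ 0 := by linarith
    rw [linearCone, joinCoord_last]
    simp only [joinCoord_castSucc x h1.ne]
    rw [ih _ (init_div_mem_openSimplex hx), Fin.sum_univ_castSucc, Fin.succ_last]
    have h3 : ∑ k : Fin n, x k.castSucc • (Y k.castSucc.succ - Y 0) =
        (1 - x (Fin.last n)) • ∑ k : Fin n, (x k.castSucc / (1 - x (Fin.last n))) •
          (Y k.succ.castSucc - Y 0) := by
      rw [Finset.smul_sum]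
      refine Finset.sum_congr rfl fun k _ => ?_
      rw [smul_smul, mul_div_cancel₀ _ h2, Fin.succ_castSucc]
    rw [h3, Fin.castSucc_zero]
    module

variable [ChartedSpace E G] [FrechetLieGroup E G] {φ : OpenPartialHomeomorph G E}
  {V : Type w} [AddCommGroup V] [Module ℝ V] [TopologicalSpace V]
  [IsTopologicalAddGroup V] [ContinuousSMul ℝ V] [LocallyConvexSpace ℝ V] [T2Space V]

theorem SmoothToOne.cubeSimplex (hφ : IsConvexChart φ) {n : ℕ} {a : Fin (n + 1) → V → G}
    {r : V → Fin n → ℝ} {p : V} (ha : ∀ k, SmoothToOne φ (a k) p) (hr : BastianiSmoothAt r p) :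
    SmoothToOne φ (fun x => cubeSimplex φ n (fun k => a k x) (r x)) p := by
  induction n with
  | zero => exact ha 0
  | succ n ih =>
    exact (ih (r := fun x k => r x k.castSucc) (fun k => ha k.castSucc)
      (BastianiSmoothAt.pi fun k => hr.apply k.castSucc)).affineJoin hφ (ha _) (hr.apply _)

theorem HasVelocityAtOne.cubeSimplex (hφ : IsConvexChart φ) {n : ℕ} {a : Fin (n + 1) → ℝ → G}
    {Y : Fin (n + 1) → E} (ha : ∀ k, HasVelocityAtOne φ (a k) (Y k)) (s : Fin n → ℝ) :
    HasVelocityAtOne φ (fun t => cubeSimplex φ n (fun k => a k t) s) (linearCone n Y s) := by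
  induction n with
  | zero => exact ha 0
  | succ n ih => exact (ih (fun k => ha k.castSucc) _).affineJoin hφ (ha _) _

end cubeSimplex

/-! ### The integral of a form over an affine simplex -/

section integral

variable {E : Type u} [AddCommGroup E] [Module ℝ E] [TopologicalSpace E]
  [IsTopologicalAddGroup E] [ContinuousSMul ℝ E] [LocallyConvexSpace ℝ E] [T2Space E]
  {G : Type v} [Group G] [TopologicalSpace G] [ChartedSpace E G] [FrechetLieGroup E G]
  {φ : OpenPartialHomeomorph G E} {i : ℕ} {ω : FormField E G i}

theorem velocity_congr {γ δ : ℝ → G} (h : γ =ᶠ[𝓝 0] δ) : velocity E γ = velocity E δ := by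
  have h0 : γ 0 = δ 0 := h.self_of_nhds
  refine curveDeriv_congr ?_
  filter_upwards [h] with t ht
  rw [ht, h0]

/-- The change of variables `s = joinCoord x`, for the values of a field of top degree forms. -/
theorem setIntegral_openCube_of_alternating {n : ℕ}
    (A : (Fin n → ℝ) → (Fin n → Fin n → ℝ) → ℝ)
    (hA : ∀ s ∈ openCube n, ∃ η : (Fin n → ℝ) [⋀^Fin n]→ₗ[ℝ] ℝ, ∀ v, η v = A s v) :
    ∫ s in openCube n, A s (fun k => Pi.single k 1) =
      ∫ x in openSimplex n, A (joinCoord x) (fun j => fderiv ℝ joinCoord x (Pi.single j 1)) := by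
  choose! η hη using hA
  have hm : MeasurableSet (openCube n) :=
    MeasurableSet.univ_pi fun _ => measurableSet_Ioo
  rw [setIntegral_congr_fun hm (g := fun s => η s (fun k => Pi.single k 1))
    fun s hs => (hη s hs _).symm, setIntegral_openCube_form]
  exact setIntegral_congr_fun isOpen_openSimplex.measurableSet fun x hx =>
    hη _ (joinCoord_mem_openCube hx) _

theorem hasCurveDeriv_joinCoord {n : ℕ} {x : Fin n → ℝ} (hx : x ∈ openSimplex n)
    (v : Fin n → ℝ) :
    HasCurveDeriv (fun t : ℝ => joinCoord (x + t • v)) (fderiv ℝ joinCoord x v) := by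
  have h := (hasDerivAt_joinCoord hx v).tendsto_slope_zero
  simpa [HasCurveDeriv] using h

theorem eventually_mem_openSimplex {n : ℕ} {x : Fin n → ℝ} (hx : x ∈ openSimplex n)
    (v : Fin n → ℝ) : ∀ᶠ t : ℝ in 𝓝 0, x + t • v ∈ openSimplex n :=
  (tendsto_add_smul_nhds_zero x v).eventually (isOpen_openSimplex.mem_nhds hx)

/-- The affine simplex in the chart `φ`, as a function of the coordinates of the vertices and of
the join parameters. -/
def simplexInChart (φ : OpenPartialHomeomorph G E) (n : ℕ)
    (p : (Fin (n + 1) → E) × (Fin n → ℝ)) : E :=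
  φ (cubeSimplex φ n (fun k => φ.symm (p.1 k)) p.2)

/-- The pullback of the form `ω` to the cube of join parameters, along the affine simplex whose
vertices have the coordinates `p.1 k`. -/
def pullbackDensity (φ : OpenPartialHomeomorph G E) (ω : FormField E G i)
    (p : (Fin (i + 1) → E) × (Fin i → ℝ)) : ℝ :=
  ω.inChart φ (simplexInChart φ i p)
    (fun k => dirDeriv (simplexInChart φ i) (p, (0, Pi.single k 1)))

/-- The integral of `ω` over an affine simplex, as a function of the coordinates of the
vertices. -/
def integralInChart (φ : OpenPartialHomeomorph G E) (ω : FormField E G i)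
    (y : Fin (i + 1) → E) : ℝ :=
  ∫ s in Icc (0 : Fin i → ℝ) 1, pullbackDensity φ ω (y, s)

theorem smoothToOne_cubeSimplex_symm (hφ : IsConvexChart φ) (n : ℕ) (s : Fin n → ℝ) :
    SmoothToOne φ (fun p : (Fin (n + 1) → E) × (Fin n → ℝ) =>
      cubeSimplex φ n (fun k => φ.symm (p.1 k)) p.2) (0, s) :=
  SmoothToOne.cubeSimplex hφ (a := fun k (p : (Fin (n + 1) → E) × (Fin n → ℝ)) => φ.symm (p.1 k))
    (fun k => SmoothToOne.symm_comp hφ ((bastianiSmoothAt_id _).fst.apply k) rfl)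
    (bastianiSmoothAt_id _).snd

theorem IsConvexChart.inChart_smoothAt_zero (hφ : IsConvexChart φ) (hω : ω.IsSmooth)
    (v : Fin i → E) :
    BastianiSmoothAt (fun p : E × (Fin i → E) => ω.inChart φ p.1 p.2) (0, v) :=
  hω.inChart_smoothAt hφ.smooth
    (FrechetLieGroup.smooth_charts _ (chart_mem_atlas E (1 : G))) (chart_mem_atlas E (1 : G))
    hφ.zero_mem (by rw [hφ.symm_zero]; exact mem_chart_source E 1) v

/-- The integral over a simplex depends smoothly on the vertices, since the density is smooth near the
whole closed cube. -/
theorem smoothAt_integralInChart (hφ : IsConvexChart φ) (hω : ω.IsSmooth) :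
    BastianiSmoothAt (integralInChart φ ω) 0 := by
  refine BastianiSmoothAt.setIntegral isCompact_Icc fun s _ => ?_
  have h := smoothToOne_cubeSimplex_symm hφ i s
  have hσ : BastianiSmoothAt (simplexInChart φ i) (0, s) := h.smoothAt
  have h0 : simplexInChart φ i (0, s) = 0 := by
    change φ _ = 0
    rw [h.eq_one, hφ.map_one]
  have h1 : BastianiSmoothAt (fun p : (Fin (i + 1) → E) × (Fin i → ℝ) =>
      (simplexInChart φ i p, fun k : Fin i =>
        dirDeriv (simplexInChart φ i) (p, (0, Pi.single k 1)))) (0, s) :=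
    hσ.prodMk (BastianiSmoothAt.pi fun k => BastianiSmoothAt.comp
      (g := dirDeriv (simplexInChart φ i)) (hσ.dirDeriv (0, Pi.single k 1))
      ((bastianiSmoothAt_id _).prodMk (bastianiSmoothAt_const _ _)))
  exact BastianiSmoothAt.comp (g := fun p : E × (Fin i → E) => ω.inChart φ p.1 p.2)
    (by rw [h0]; exact hφ.inChart_smoothAt_zero hω _) h1

/-- The map `v ↦ ω(T v_1, …, T v_i)` is alternating for a linear map `T`. -/
theorem FormField.exists_alternating_comp (ω : FormField E G i) (g : G)
    {T : (Fin i → ℝ) → E} (hT : IsLinearMap ℝ T) :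
    ∃ η : (Fin i → ℝ) [⋀^Fin i]→ₗ[ℝ] ℝ, ∀ v, η v = ω g (fun j => T (v j)) :=
  ⟨(ω g).toAlternatingMap.compLinearMap (hT.mk' T), fun _ => rfl⟩

/-- For vertices near the identity, the integral over the affine simplex may be computed in cubical
coordinates. Then the whole simplex lies in the domain of `φ`. -/
theorem integral_affineSimplex_eq (hφ : IsConvexChart φ) :
    ∀ᶠ y : Fin (i + 1) → E in 𝓝 0,
      ω.integral (affineSimplex φ i (fun k => φ.symm (y k))) = integralInChart φ ω y := by
  have key : ∀ᶠ y : Fin (i + 1) → E in 𝓝 0, ∀ s ∈ Icc (0 : Fin i → ℝ) 1,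
      BastianiSmoothAt (simplexInChart φ i) (y, s) ∧
      ∀ᶠ p in 𝓝 (y, s), cubeSimplex φ i (fun k => φ.symm (p.1 k)) p.2 ∈ φ.source := by
    refine isCompact_Icc.eventually_forall_of_forall_eventually fun s _ => ?_
    have h := smoothToOne_cubeSimplex_symm hφ i s
    exact (BastianiSmoothAt.eventually (f := simplexInChart φ i) h.smoothAt).and
      (h.continuousAt.eventually (φ.open_source.mem_nhds
        (mem_of_eq_of_mem h.eq_one hφ.one_mem))).eventually_nhds
  filter_upwards [key] with y hy
  have hcube : openCube i ⊆ Icc (0 : Fin i → ℝ) 1 := fun s hs =>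
    ⟨fun k => (hs k trivial).1.le, fun k => (hs k trivial).2.le⟩
  -- the integrand, as a field of alternating forms on the cube
  let A : (Fin i → ℝ) → (Fin i → Fin i → ℝ) → ℝ := fun s v =>
    ω (cubeSimplex φ i (fun k => φ.symm (y k)) s) fun j =>
      chartTangent φ (simplexInChart φ i (y, s)) (dirDeriv (simplexInChart φ i) ((y, s), (0, v j)))
  have hsrc : ∀ s ∈ Icc (0 : Fin i → ℝ) 1,
      cubeSimplex φ i (fun k => φ.symm (y k)) s ∈ φ.source := fun s hs =>
    (hy s hs).2.self_of_nhds
  have hA : ∀ s ∈ openCube i, ∃ η : (Fin i → ℝ) [⋀^Fin i]→ₗ[ℝ] ℝ, ∀ v, η v = A s v := by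
    intro s hs
    have hT := hφ.smooth.isLinearMap_chartTangent (φ.map_source (hsrc s (hcube hs)))
    have hD := (hy s (hcube hs)).1.isLinearMap_dirDeriv
    refine ω.exists_alternating_comp _ (T := fun v => chartTangent φ (simplexInChart φ i (y, s))
      (dirDeriv (simplexInChart φ i) ((y, s), (0, v)))) ⟨fun v w => ?_, fun a v => ?_⟩
    · have := hD.map_add (0, v) (0, w)
      simp only [Prod.mk_add_mk, add_zero] at this
      rw [this]
      exact hT.map_add _ _
    · have := hD.map_smul a (0, v)
      simp only [Prod.smul_mk, smul_zero] at this
      rw [this]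
      exact hT.map_smul _ _
  have h1 : integralInChart φ ω y = ∫ s in openCube i, A s (fun k => Pi.single k 1) := by
    have hm : MeasurableSet (openCube i) := MeasurableSet.univ_pi fun _ => measurableSet_Ioo
    rw [integralInChart, ← setIntegral_openCube_eq_Icc (fun s => pullbackDensity φ ω (y, s))]
    refine setIntegral_congr_fun hm fun s hs => ?_
    have h2 := hsrc s (hcube hs)
    have h3 := ω.inChart_eq hφ.smooth (φ.map_source h2)
      (fun k => dirDeriv (simplexInChart φ i) ((y, s), (0, Pi.single k 1)))
    rw [φ.left_inv h2] at h3
    exact h3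
  rw [h1, setIntegral_openCube_of_alternating A hA, FormField.integral]
  refine setIntegral_congr_fun isOpen_openSimplex.measurableSet fun x hx => ?_
  have hx' := hcube (joinCoord_mem_openCube hx)
  simp only [A]
  rw [affineSimplex_simplexPoint φ _ hx]
  congr 1
  funext j
  set δ : ℝ → G := fun t => cubeSimplex φ i (fun k => φ.symm (y k))
    (joinCoord (x + t • (Pi.single j 1 : Fin i → ℝ))) with hδ
  have hvel := velocity_congr (E := E) (γ := fun t : ℝ => affineSimplex φ i (fun k => φ.symm (y k))
    (simplexPoint (x + t • (Pi.single j 1 : Fin i → ℝ)))) (δ := δ) (by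
      filter_upwards [eventually_mem_openSimplex hx (Pi.single j 1)] with t ht
      exact affineSimplex_simplexPoint φ _ ht)
  have hδ0 : δ 0 = cubeSimplex φ i (fun k => φ.symm (y k)) (joinCoord x) := by simp [hδ]
  have hcurve : HasCurveDeriv
      (fun t : ℝ => (y, joinCoord (x + t • (Pi.single j 1 : Fin i → ℝ))))
      (0, fderiv ℝ joinCoord x (Pi.single j 1)) :=
    (hasCurveDeriv_const y).prodMk (hasCurveDeriv_joinCoord hx (Pi.single j 1))
  have hφδ : HasCurveDeriv (fun t => φ (δ t)) (dirDeriv (simplexInChart φ i)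
      ((y, joinCoord x), (0, fderiv ℝ joinCoord x (Pi.single j 1)))) := by
    have := BastianiSmoothAt.comp_hasCurveDeriv (f := simplexInChart φ i)
      (by simpa using (hy _ hx').1) hcurve
    simp only [zero_smul, add_zero] at this
    exact this
  have hδc : ContinuousAt δ 0 := by
    have h4 : ContinuousAt (fun t => φ.symm (φ (δ t))) 0 := by
      refine ContinuousAt.comp (g := φ.symm) (f := fun t => φ (δ t)) ?_ hφδ.continuousAt
      rw [hδ0]
      exact φ.continuousAt_symm (φ.map_source (hsrc _ hx'))
    refine h4.congr ?_
    have h5 : Tendsto (fun t : ℝ => (y, joinCoord (x + t • (Pi.single j 1 : Fin i → ℝ)))) (𝓝 0)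
        (𝓝 (y, joinCoord x)) := by
      simpa [ContinuousAt] using hcurve.continuousAt
    filter_upwards [h5.eventually (hy _ hx').2] with t ht
    exact φ.left_inv ht
  rw [hvel, hφ.smooth.velocity_eq hδc (by rw [hδ0]; exact hsrc _ hx') hφδ, hδ0]
  rfl

end integral

/-! ### The leading term of the integral over a small simplex -/

section leadingTerm

variable {E : Type u} [AddCommGroup E] [Module ℝ E] [TopologicalSpace E]
  [IsTopologicalAddGroup E] [ContinuousSMul ℝ E] [LocallyConvexSpace ℝ E] [T2Space E]
  {G : Type v} [Group G] [TopologicalSpace G] [ChartedSpace E G] [FrechetLieGroup E G]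
  {φ : OpenPartialHomeomorph G E} {i : ℕ} {ω : FormField E G i}

theorem IsConvexChart.inChart_zero (hφ : IsConvexChart φ) (v : Fin i → E) :
    ω.inChart φ 0 v = ω 1 v := by
  rw [ω.inChart_eq hφ.smooth hφ.zero_mem, hφ.symm_zero]
  simp only [hφ.chartTangent_zero]

theorem FormField.inChart_smul (ω : FormField E G i) (hφ : IsSmoothChart φ) {y : E}
    (hy : y ∈ φ.target) (a : ℝ) (v : Fin i → E) :
    ω.inChart φ y (fun k => a • v k) = a ^ i * ω.inChart φ y v := by
  rw [ω.inChart_eq hφ hy, ω.inChart_eq hφ hy]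
  simp only [(hφ.isLinearMap_chartTangent hy).map_smul]
  have := (ω (φ.symm y)).toContinuousMultilinearMap.toMultilinearMap.map_smul_univ (fun _ => a)
    (fun k => chartTangent φ y (v k))
  simpa using this

/-- The integral of the limiting density, which is computed in barycentric coordinates, where the
linear cone is affine. -/
theorem setIntegral_linearCone (ω : FormField E G i) (Y : Fin (i + 1) → E)
    {β : ℝ × (Fin i → ℝ) → E} (hβ : ∀ s, BastianiSmoothAt β (0, s))
    (hβY : ∀ s, β (0, s) = linearCone i Y s) :
    ∫ s in Icc (0 : Fin i → ℝ) 1, ω 1 (fun k => dirDeriv β ((0, s), (0, Pi.single k 1))) =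
      (i.factorial : ℝ)⁻¹ * ω 1 (fun k => Y k.succ - Y 0) := by
  let A : (Fin i → ℝ) → (Fin i → Fin i → ℝ) → ℝ := fun s v =>
    ω 1 fun j => dirDeriv β ((0, s), (0, v j))
  have hA : ∀ s ∈ openCube i, ∃ η : (Fin i → ℝ) [⋀^Fin i]→ₗ[ℝ] ℝ, ∀ v, η v = A s v := by
    intro s _
    have hD := (hβ s).isLinearMap_dirDeriv
    refine ω.exists_alternating_comp _ (T := fun v => dirDeriv β ((0, s), (0, v)))
      ⟨fun v w => ?_, fun a v => ?_⟩
    · simpa using hD.map_add (0, v) (0, w)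
    · simpa using hD.map_smul a (0, v)
  rw [← setIntegral_openCube_eq_Icc]
  change ∫ s in openCube i, A s (fun k => Pi.single k 1) = _
  rw [setIntegral_openCube_of_alternating A hA,
    setIntegral_congr_fun isOpen_openSimplex.measurableSet
      (g := fun _ => ω 1 (fun k => Y k.succ - Y 0)),
    setIntegral_const, volume_real_openSimplex, smul_eq_mul]
  intro x hx
  simp only [A]
  congr 1
  funext j
  have h1 : HasCurveDeriv
      (fun t : ℝ => ((0 : ℝ), joinCoord (x + t • (Pi.single j 1 : Fin i → ℝ))))
      (0, fderiv ℝ joinCoord x (Pi.single j 1)) :=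
    (hasCurveDeriv_const 0).prodMk (hasCurveDeriv_joinCoord hx (Pi.single j 1))
  have h2 := BastianiSmoothAt.comp_hasCurveDeriv (f := β) (hβ _) h1
  simp only [zero_smul, add_zero] at h2
  refine h2.unique ((hasCurveDeriv_line (β (0, joinCoord x)) (Y j.succ - Y 0)).congr ?_)
  filter_upwards [eventually_mem_openSimplex hx (Pi.single j 1)] with t ht
  rw [hβY, hβY, linearCone_joinCoord Y ht, linearCone_joinCoord Y hx, add_assoc]
  congr 1
  simp only [Pi.add_apply, Pi.smul_apply, smul_eq_mul, add_smul, Finset.sum_add_distrib]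
  congr 1
  rw [Finset.sum_eq_single j (fun k _ hk => by simp [hk]) (by simp)]
  simp

/-- Along curves of vertices `ε ↦ g_k(ε)` through the identity with velocities `Y_k`, the integral
of `ω` over the affine simplex is `ε^i (ω_e(Y_1 - Y_0, …, Y_i - Y_0) / i! + o(1))`. -/
theorem tendsto_integralInChart_div (hφ : IsConvexChart φ) (hω : ω.IsSmooth)
    {a : Fin (i + 1) → ℝ → G} {Y : Fin (i + 1) → E} (ha : ∀ k, SmoothToOne φ (a k) (0 : ℝ))
    (haY : ∀ k, HasVelocityAtOne φ (a k) (Y k)) :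
    Tendsto (fun ε : ℝ => integralInChart φ ω (fun k => φ (a k ε)) / ε ^ i) (𝓝[≠] 0)
      (𝓝 ((i.factorial : ℝ)⁻¹ * ω 1 (fun k => Y k.succ - Y 0))) := by
  set c := chartAt E (1 : G)
  have hcA : c ∈ atlas E G := chart_mem_atlas E 1
  have hc : IsSmoothChart c := FrechetLieGroup.smooth_charts c hcA
  let h : ℝ × (Fin i → ℝ) → E := fun p => φ (cubeSimplex φ i (fun k => a k p.1) p.2)
  have hS : ∀ s : Fin i → ℝ, SmoothToOne φ
      (fun p : ℝ × (Fin i → ℝ) => cubeSimplex φ i (fun k => a k p.1) p.2) (0, s) := fun s =>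
    SmoothToOne.cubeSimplex hφ (a := fun k (p : ℝ × (Fin i → ℝ)) => a k p.1)
      (fun k => (ha k).comp (z := fun p : ℝ × (Fin i → ℝ) => p.1) (p := (0, s))
        (bastianiSmoothAt_id _).fst) (bastianiSmoothAt_id _).snd
  have hh : ∀ s, BastianiSmoothAt h (0, s) := fun s => (hS s).smoothAt
  have hh0 : ∀ s, h (0, s) = 0 := fun s => by
    change φ _ = 0
    rw [(hS s).eq_one, hφ.map_one]
  let κ : Fin i → ℝ × (Fin i → ℝ) → E := fun k p => dirDeriv h (p, (0, Pi.single k 1))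
  have hκ : ∀ k p, BastianiSmoothAt h p → BastianiSmoothAt (κ k) p := fun k p hp =>
    BastianiSmoothAt.comp (g := dirDeriv h) (hp.dirDeriv _)
      ((bastianiSmoothAt_id _).prodMk (bastianiSmoothAt_const _ _))
  have hκ0 : ∀ k s, κ k (0, s) = 0 := fun k s => by
    refine HasDirDeriv.dirDeriv_eq (hasDirDeriv_iff_hasCurveDeriv.2 ?_)
    simpa [hh0] using hasCurveDeriv_const (0 : E)
  -- the rescaled density, extended by continuity to `ε = 0`
  let R : ℝ × (Fin i → ℝ) → ℝ := fun p =>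
    ω.inChart φ (h p) (fun k => partialDiffQuotient (κ k) 0 1 p)
  have hgood : ∀ᶠ ε : ℝ in 𝓝 0, ∀ s ∈ Icc (0 : Fin i → ℝ) 1,
      BastianiSmoothAt h (ε, s) ∧ h (ε, s) ∈ φ.target ∧ φ.symm (h (ε, s)) ∈ c.source := by
    refine isCompact_Icc.eventually_forall_of_forall_eventually fun s _ => ?_
    have h1 : ∀ᶠ y in 𝓝 (h (0, s)), y ∈ φ.target ∧ φ.symm y ∈ c.source := by
      rw [hh0]
      exact (φ.open_target.eventually_mem hφ.zero_mem).and
        ((φ.continuousAt_symm hφ.zero_mem).eventually (c.open_source.mem_nhds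
          (by rw [hφ.symm_zero]; exact mem_chart_source E 1)))
    exact (hh s).eventually.and ((hh s).continuousAt.eventually h1)
  have hRcont : ∀ s ∈ Icc (0 : Fin i → ℝ) 1, ContinuousAt R (0, s) := by
    intro s _
    have h1 : ContinuousAt (fun p => (h p, fun k => partialDiffQuotient (κ k) 0 1 p)) (0, s) :=
      (hh s).continuousAt.prodMk (continuousAt_pi.2 fun k =>
        (hκ k _ (hh s)).continuousAt_partialDiffQuotient 1)
    exact ContinuousAt.comp (g := fun p : E × (Fin i → E) => ω.inChart φ p.1 p.2)
      (by rw [hh0]; exact (hφ.inChart_smoothAt_zero hω _).continuousAt) h1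
  have hRon : ∀ᶠ ε : ℝ in 𝓝 0, ContinuousOn (fun s => R (ε, s)) (Icc (0 : Fin i → ℝ) 1) := by
    filter_upwards [hgood] with ε hε s hs
    obtain ⟨h1, h2, h3⟩ := hε s hs
    have hmk : ∀ b : ℝ, ContinuousAt (fun s : Fin i → ℝ => (b, s)) s := fun b => by fun_prop
    refine ContinuousAt.continuousWithinAt ?_
    have hq : ContinuousAt (fun s => (h (ε, s), fun k => partialDiffQuotient (κ k) 0 1 (ε, s)))
        s := by
      refine (ContinuousAt.comp (g := h) h1.continuousAt (hmk ε)).prodMk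
        (continuousAt_pi.2 fun k => ?_)
      rcases eq_or_ne ε 0 with rfl | hε0
      · exact ContinuousAt.comp (g := partialDiffQuotient (κ k) 0 1)
          ((hκ k _ (hh s)).continuousAt_partialDiffQuotient 1) (hmk 0)
      · have h4 : ContinuousAt (fun s => ε⁻¹ • (κ k (ε, s) - κ k (0, s))) s :=
          ((ContinuousAt.comp (g := κ k) (hκ k _ h1).continuousAt (hmk ε)).sub
            (ContinuousAt.comp (g := κ k) (hκ k _ (hh s)).continuousAt (hmk 0))).const_smul ε⁻¹
        simpa [partialDiffQuotient, hε0] using h4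
    exact ContinuousAt.comp (g := fun p : E × (Fin i → E) => ω.inChart φ p.1 p.2)
      (f := fun s => (h (ε, s), fun k => partialDiffQuotient (κ k) 0 1 (ε, s)))
      (hω.inChart_smoothAt hφ.smooth hc hcA h2 h3 _).continuousAt hq
  have hlim := (continuousAt_setIntegral isCompact_Icc hRcont hRon).tendsto
  -- the limit is the integral over the linear cone, by the symmetry of second derivatives
  have hβ : ∀ s, BastianiSmoothAt (fun p => dirDeriv h (p, ((1 : ℝ), (0 : Fin i → ℝ)))) (0, s) :=
    fun s => BastianiSmoothAt.comp (g := dirDeriv h) ((hh s).dirDeriv _)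
      ((bastianiSmoothAt_id _).prodMk (bastianiSmoothAt_const _ _))
  have hβY : ∀ s, dirDeriv h ((0, s), ((1 : ℝ), (0 : Fin i → ℝ))) = linearCone i Y s := by
    intro s
    refine HasDirDeriv.dirDeriv_eq (hasDirDeriv_iff_hasCurveDeriv.2 ?_)
    have h1 := (HasVelocityAtOne.cubeSimplex hφ haY s).hasCurveDeriv
    simpa [h] using h1
  have h0 : ∫ s in Icc (0 : Fin i → ℝ) 1, R (0, s) =
      (i.factorial : ℝ)⁻¹ * ω 1 (fun k => Y k.succ - Y 0) := by
    rw [← setIntegral_linearCone ω Y hβ hβY]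
    congr 1
    funext s
    simp only [R, hh0, hφ.inChart_zero, partialDiffQuotient, if_true]
    congr 1
    funext k
    exact (hh s).dirDeriv_comm _ _
  rw [h0] at hlim
  refine (hlim.mono_left nhdsWithin_le_nhds).congr' ?_
  have hsrc : ∀ᶠ ε : ℝ in 𝓝 0, ∀ k, a k ε ∈ φ.source :=
    eventually_all.2 fun k => (ha k).continuousAt.eventually
      (φ.open_source.mem_nhds (mem_of_eq_of_mem (ha k).eq_one hφ.one_mem))
  filter_upwards [hgood.filter_mono nhdsWithin_le_nhds, hsrc.filter_mono nhdsWithin_le_nhds,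
    eventually_mem_nhdsWithin] with ε hε hεs (hε0 : ε ≠ 0)
  rw [eq_div_iff (pow_ne_zero _ hε0), integralInChart, mul_comm, ← integral_const_mul]
  refine setIntegral_congr_fun measurableSet_Icc fun s hs => ?_
  have h1 : ∀ s, simplexInChart φ i (fun k => φ (a k ε), s) = h (ε, s) := fun s => by
    simp only [simplexInChart, h, φ.left_inv (hεs _)]
  have h2 : ∀ k, dirDeriv (simplexInChart φ i) ((fun k => φ (a k ε), s), (0, Pi.single k 1)) =
      ε • partialDiffQuotient (κ k) 0 1 (ε, s) := by
    intro k
    have h3 : dirDeriv (simplexInChart φ i) ((fun k => φ (a k ε), s), (0, Pi.single k 1)) =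
        κ k (ε, s) := by
      simp [dirDeriv, κ, h1]
    rw [h3]
    simp [partialDiffQuotient, hε0, hκ0, smul_inv_smul₀ hε0]
  simp only [pullbackDensity, R, h1, h2]
  exact (ω.inChart_smul hφ.smooth (hε s hs).2.1 _ _).symm

end leadingTerm

/-! ### Locally smooth cochains and their derivatives -/

section cochain

variable {E : Type u} [AddCommGroup E] [Module ℝ E] [TopologicalSpace E]
  [IsTopologicalAddGroup E] [ContinuousSMul ℝ E] [LocallyConvexSpace ℝ E] [T2Space E]
  {G : Type v} [Group G] [TopologicalSpace G] [ChartedSpace E G] [FrechetLieGroup E G]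
  {φ : OpenPartialHomeomorph G E} {i : ℕ} {ω : FormField E G i}

/-- A cochain is smooth near the identity if it is so in the coordinates given by `φ`. -/
theorem isLocallySmooth_of_eventuallyEq (hφ : IsConvexChart φ) {n : ℕ}
    {f : (Fin (n + 1) → G) → ℝ} {F : (Fin (n + 1) → E) → ℝ} (hF : BastianiSmoothAt F 0)
    (hf : ∀ᶠ g in 𝓝 (fun _ => (1 : G)), f g = F (fun k => φ (g k))) :
    IsLocallySmooth E f := by
  have hsrc : ∀ᶠ g : Fin (n + 1) → G in 𝓝 (fun _ => (1 : G)), ∀ k, g k ∈ φ.source :=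
    eventually_all.2 fun k => ((continuous_apply k).tendsto (fun _ => (1 : G))).eventually
      (φ.open_source.mem_nhds hφ.one_mem)
  have hφc : ContinuousAt (fun g : Fin (n + 1) → G => fun k => φ (g k)) (fun _ => 1) :=
    continuousAt_pi.2 fun k => ContinuousAt.comp (g := φ) (φ.continuousAt hφ.one_mem)
      (continuous_apply k).continuousAt
  have hsm : ∀ᶠ g : Fin (n + 1) → G in 𝓝 (fun _ => (1 : G)),
      BastianiSmoothAt F (fun k => φ (g k)) := by
    refine hφc.eventually ?_
    simp only [hφ.map_one]
    exact hF.eventually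
  obtain ⟨W, hW, hWo, h1W⟩ := eventually_nhds_iff.1 (hf.and (hsrc.and hsm))
  refine ⟨W, hWo, h1W, fun g hg => ?_, ?_⟩
  · obtain ⟨-, hgs, hgF⟩ := hW g hg
    have h1 : ContinuousAt (fun g : Fin (n + 1) → G => F fun k => φ (g k)) g :=
      ContinuousAt.comp (g := F) hgF.continuousAt (continuousAt_pi.2 fun k =>
        ContinuousAt.comp (g := φ) (φ.continuousAt (hgs k)) (continuous_apply k).continuousAt)
    refine (h1.congr ?_).continuousWithinAt
    filter_upwards [hWo.mem_nhds hg] with g' hg'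
    exact (hW g' hg').1.symm
  · rintro _ ⟨c, hc, rfl⟩ _ rfl
    refine bastianiSmoothOn_of_forall fun x hx => ?_
    have hxc : ∀ k, x k ∈ (c k).target := fun k => by simpa using hx.1 k trivial
    have hxW : (fun k => (c k).symm (x k)) ∈ W := hx.2.1
    obtain ⟨-, hgs, hgF⟩ := hW _ hxW
    have h1 : BastianiSmoothAt (fun x : Fin (n + 1) → E => fun k => φ ((c k).symm (x k))) x :=
      BastianiSmoothAt.pi fun k => BastianiSmoothAt.comp (g := fun y => φ ((c k).symm y))
        (f := fun x : Fin (n + 1) → E => x k)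
        (hφ.smooth.smoothAt_symm_comp (hc k) (hxc k) (hgs k)) ((bastianiSmoothAt_id x).apply k)
    refine (BastianiSmoothAt.comp (g := F) (f := fun x : Fin (n + 1) → E => fun k =>
      φ ((c k).symm (x k))) hgF h1).congr ?_
    have h2 : IsOpen ((OpenPartialHomeomorph.pi c).target ∩
        (OpenPartialHomeomorph.pi c).symm ⁻¹' W) :=
      (OpenPartialHomeomorph.pi c).isOpen_inter_preimage_symm hWo
    filter_upwards [h2.mem_nhds ⟨hx.1, hxW⟩] with x' hx'
    exact (hW _ hx'.2).1.symm

theorem IsLocallySmooth.continuousAt {n : ℕ} {f : (Fin (n + 1) → G) → ℝ}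
    (hf : IsLocallySmooth E f) : ContinuousAt f (fun _ => 1) :=
  let ⟨_, hW, h1, hs⟩ := hf
  hs.1.continuousAt (hW.mem_nhds h1)

theorem eventually_mem_smallTuples (E : Type u) [AddCommGroup E] [Module ℝ E]
    [TopologicalSpace E] [ChartedSpace E G] [FrechetLieGroup E G] {U : Set G}
    (hU : U ∈ 𝓝 (1 : G)) (n : ℕ) :
    ∀ᶠ g in 𝓝 (fun _ : Fin (n + 1) => (1 : G)), g ∈ smallTuples U n := by
  refine eventually_all.2 fun k => eventually_all.2 fun l => ?_
  have h1 : Continuous fun g : Fin (n + 1) → G => (g k)⁻¹ * g l :=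
    (FrechetLieGroup.continuous_mul E G).comp
      (((FrechetLieGroup.continuous_inv E G).comp (continuous_apply k)).prodMk (continuous_apply l))
  have h2 := h1.tendsto (fun _ => (1 : G))
  simp only [inv_one, mul_one] at h2
  exact h2.eventually hU

/-- Near the identity, an extension of the filling cochain is the integral of `ω` over the affine
simplex, expressed in coordinates. -/
theorem eventually_eq_integralInChart (hφ : IsConvexChart φ) {U : Set G} (hU : U ∈ 𝓝 (1 : G))
    {f : (Fin (i + 1) → G) → ℝ} (hf : ∀ g : smallTuples U i, f g = fillingCochain φ U ω g) :
    ∀ᶠ g in 𝓝 (fun _ => (1 : G)), f g = integralInChart φ ω (fun k => φ (g k)) := by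
  have hφc : Tendsto (fun g : Fin (i + 1) → G => fun k => φ (g k)) (𝓝 fun _ => 1) (𝓝 0) := by
    refine tendsto_pi_nhds.2 fun k => ?_
    have := (φ.continuousAt hφ.one_mem).tendsto.comp ((continuous_apply k).tendsto
      (fun _ : Fin (i + 1) => (1 : G)))
    rwa [hφ.map_one] at this
  have hsrc : ∀ᶠ g : Fin (i + 1) → G in 𝓝 (fun _ => (1 : G)), ∀ k, g k ∈ φ.source :=
    eventually_all.2 fun k => ((continuous_apply k).tendsto (fun _ => (1 : G))).eventually
      (φ.open_source.mem_nhds hφ.one_mem)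
  filter_upwards [eventually_mem_smallTuples E hU i, hsrc,
    hφc.eventually (integral_affineSimplex_eq (ω := ω) hφ)] with g hg hgs hgi
  rw [← hgi, hf ⟨g, hg⟩, fillingCochain]
  simp only [φ.left_inv (hgs _)]

theorem IsExpMap.smoothToOne_partialProd {exp : E → G} (hexp : IsExpMap exp)
    (hφ : IsConvexChart φ) {n : ℕ} (X : Fin n → E) (j : Fin (n + 1)) :
    SmoothToOne φ (fun t : Fin n → ℝ => Fin.partialProd (fun k => exp (t k • X k)) j) 0 := by
  refine SmoothToOne.partialProd hφ (a := fun k (t : Fin n → ℝ) => exp (t k • X k)) (fun k => ?_) j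
  refine SmoothToOne.comp (f := exp) (z := fun t : Fin n → ℝ => t k • X k) ?_
    (((bastianiSmoothAt_id _).apply k).smul (bastianiSmoothAt_const _ _))
  simpa using hexp.smoothToOne hφ

theorem IsExpMap.tendsto_partialProd {exp : E → G} (hexp : IsExpMap exp)
    (hφ : IsConvexChart φ) {n : ℕ} (X : Fin n → E) :
    Tendsto (fun t : Fin n → ℝ => Fin.partialProd (fun k => exp (t k • X k))) (𝓝 0)
      (𝓝 (fun _ => 1)) := by
  refine tendsto_pi_nhds.2 fun j => ?_
  have := (hexp.smoothToOne_partialProd hφ X j).continuousAt.tendsto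
  rwa [(hexp.smoothToOne_partialProd hφ X j).eq_one] at this

/-- An alternating form does not change when its arguments are replaced by their partial sums: the
transition matrix is unitriangular. -/
theorem ContinuousAlternatingMap.map_partialSum_succ {n : ℕ} (η : E [⋀^Fin n]→L[ℝ] ℝ)
    (Z : Fin n → E) : η (fun j => Fin.partialSum Z j.succ) = η Z := by
  let S : (Fin n → ℝ) →ₗ[ℝ] E := Fintype.linearCombination ℝ Z
  let A : Matrix (Fin n) (Fin n) ℝ := Matrix.of fun k j => if k ≤ j then 1 else 0
  have hS : ∀ j, S (Pi.single j 1) = Z j := fun j => by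
    simp [S, Fintype.linearCombination_apply_single]
  have hsum : ∀ j : Fin (n + 1), Fin.partialSum Z j =
      ∑ k : Fin n, if k.castSucc < j then Z k else 0 := by
    intro j
    induction j using Fin.induction with
    | zero => simp
    | succ j ih =>
      rw [Fin.partialSum_succ, ih]
      have h1 : Z j = ∑ k : Fin n, if k = j then Z k else 0 := by simp
      conv_lhs => rw [h1]
      rw [← Finset.sum_add_distrib]
      refine Finset.sum_congr rfl fun k _ => ?_
      rcases lt_trichotomy k j with h | h | h
      · simp [h.ne, h, h.le, Fin.castSucc_lt_succ_iff]
      · simp [h]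
      · simp [h.ne', h.not_gt, h.not_ge, Fin.castSucc_lt_succ_iff]
  have hSA : ∀ j, S (Matrix.toLin' A (Pi.single j 1)) = Fin.partialSum Z j.succ := by
    intro j
    rw [hsum, Matrix.toLin'_apply, Matrix.mulVec_single_one]
    simp [S, Fintype.linearCombination_apply, A, Fin.castSucc_lt_succ_iff, Matrix.col]
  have hdet : (LinearMap.toContinuousLinearMap (Matrix.toLin' A)).det = 1 := by
    rw [ContinuousLinearMap.det, LinearMap.coe_toContinuousLinearMap, LinearMap.det_toLin',
      Matrix.det_of_isUpperTriangular]
    · simp [A]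
    · intro k j hjk
      have hjk' : j < k := hjk
      simp [A, hjk'.not_ge]
  have h1 := (η.toAlternatingMap.compLinearMap S).map_clm_single
    (LinearMap.toContinuousLinearMap (Matrix.toLin' A))
  rw [hdet, one_mul] at h1
  have h2 : η (fun j => S (Matrix.toLin' A (Pi.single j 1))) =
      η (fun j => S (Pi.single j 1)) := h1
  simp only [hS, hSA] at h2
  exact h2

/-- The mixed derivative of a cochain which near the identity is the integral of `ω` over the
affine simplex. -/
theorem iteratedDirDeriv_eq {exp : E → G} (hexp : IsExpMap exp) (hφ : IsConvexChart φ)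
    (hω : ω.IsSmooth) {f : (Fin (i + 1) → G) → ℝ}
    (hf : ∀ᶠ g in 𝓝 (fun _ => (1 : G)), f g = integralInChart φ ω (fun k => φ (g k)))
    (X : Fin i → E) :
    (∀ n : ℕ, ContDiffAt ℝ n (fun t : Fin i → ℝ => cochainInExp exp f fun k => t k • X k) 0) ∧
      iteratedDirDeriv exp f X = (i.factorial : ℝ)⁻¹ * ω 1 X := by
  have hev : ∀ᶠ t : Fin i → ℝ in 𝓝 0, cochainInExp exp f (fun k => t k • X k) =
      integralInChart φ ω
        (fun j => φ (Fin.partialProd (fun k => exp (t k • X k)) j)) :=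
    (hexp.tendsto_partialProd hφ X).eventually hf
  have hsm : BastianiSmoothAt
      (fun t : Fin i → ℝ => cochainInExp exp f fun k => t k • X k) 0 := by
    have h1 : BastianiSmoothAt (fun (t : Fin i → ℝ) j =>
        φ (Fin.partialProd (fun k => exp (t k • X k)) j)) 0 :=
      BastianiSmoothAt.pi fun j => (hexp.smoothToOne_partialProd hφ X j).smoothAt
    refine (BastianiSmoothAt.comp (g := integralInChart φ ω) ?_ h1).congr
      (hev.mono fun t ht => ht.symm)
    have h2 : (fun j => φ (Fin.partialProd (fun k => exp ((0 : Fin i → ℝ) k • X k)) j)) =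
        (0 : Fin (i + 1) → E) := by
      funext j
      have := (hexp.smoothToOne_partialProd hφ X j).eq_one
      rw [this, hφ.map_one]
      rfl
    rw [h2]
    exact smoothAt_integralInChart hφ hω
  refine ⟨hsm.contDiffAt, (hsm.contDiffAt i).iteratedFDeriv_single_eq fun t => ?_⟩
  have hline : BastianiSmoothAt (fun ε : ℝ => ε • t) 0 :=
    (bastianiSmoothAt_id _).smul (bastianiSmoothAt_const _ _)
  have h3 := tendsto_integralInChart_div hφ hω
    (a := fun j (ε : ℝ) => Fin.partialProd (fun k => exp ((ε • t) k • X k)) j)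
    (Y := Fin.partialSum fun k => t k • X k)
    (fun j => SmoothToOne.comp (f := fun t : Fin i → ℝ =>
      Fin.partialProd (fun k => exp (t k • X k)) j) (z := fun ε : ℝ => ε • t)
      (by simpa using hexp.smoothToOne_partialProd hφ X j) hline)
    (fun j => HasVelocityAtOne.partialProd hφ
      (a := fun k (ε : ℝ) => exp ((ε • t) k • X k)) (fun k => by
        simpa [smul_smul] using hexp.hasVelocityAtOne hφ (t k • X k)) j)
  have h4 : ω 1 (fun k => Fin.partialSum (fun k => t k • X k) k.succ -
      Fin.partialSum (fun k => t k • X k) 0) = (∏ k, t k) * ω 1 X := by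
    simp only [Fin.partialSum_zero, sub_zero]
    rw [(ω 1).map_partialSum_succ]
    exact (ω 1).toContinuousMultilinearMap.toMultilinearMap.map_smul_univ t X
  rw [h4, mul_comm _ (ω 1 X), ← mul_assoc] at h3
  refine h3.congr' ?_
  have h5 : Tendsto (fun ε : ℝ => ε • t) (𝓝[≠] 0) (𝓝 0) := by
    simpa using hline.continuousAt.tendsto.mono_left nhdsWithin_le_nhds
  filter_upwards [h5.eventually hev] with ε hε
  rw [hε]

/-- Antisymmetrization does nothing to a mixed derivative which is already alternating. -/
theorem differentiation_eq {exp : E → G} {f : (Fin (i + 1) → G) → ℝ} (X : Fin i → E)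
    (h : ∀ X, iteratedDirDeriv exp f X = (i.factorial : ℝ)⁻¹ * ω 1 X) :
    ω 1 X = (i.factorial : ℝ) * differentiation exp f X := by
  have h1 : ∀ π : Equiv.Perm (Fin i),
      ((Equiv.Perm.sign π : ℤ) : ℝ) * iteratedDirDeriv exp f (fun k => X (π k)) =
        (i.factorial : ℝ)⁻¹ * ω 1 X := by
    intro π
    have h2 : ω 1 (fun k => X (π k)) = Equiv.Perm.sign π • ω 1 X :=
      (ω 1).toAlternatingMap.map_perm X π
    rw [h, h2, Units.smul_def, zsmul_eq_mul, mul_left_comm, ← mul_assoc ((_ : ℤ) : ℝ)]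
    rcases Int.units_eq_one_or (Equiv.Perm.sign π) with hπ | hπ <;> simp [hπ]
  rw [differentiation, Finset.sum_congr rfl fun π _ => h1 π]
  have h0 : (i.factorial : ℝ) ≠ 0 := by positivity
  simp [Fintype.card_perm, h0]

/-- Near the identity, two continuous lifts of an `ℝ/Λ`-valued cochain differ by a constant, since
`Λ` is discrete. -/
theorem exists_eventually_eq_add {X : Type*} [TopologicalSpace X] {Λ : AddSubgroup ℝ}
    [DiscreteTopology Λ] {x : X} {F F' : X → ℝ} (hF : ContinuousAt F x) (hF' : ContinuousAt F' x)
    (h : ∀ᶠ y in 𝓝 x, (F y : ℝ ⧸ Λ) = (F' y : ℝ ⧸ Λ)) :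
    ∃ d : ℝ, ∀ᶠ y in 𝓝 x, F y = F' y + d := by
  have hmem : ∀ᶠ y in 𝓝 x, F y - F' y ∈ Λ := by
    filter_upwards [h] with y hy
    have := QuotientAddGroup.eq.1 hy.symm
    rwa [neg_add_eq_sub] at this
  let d : Λ := ⟨F x - F' x, hmem.self_of_nhds⟩
  obtain ⟨O, hO, hOd⟩ := isOpen_induced_iff.1 (isOpen_discrete ({d} : Set Λ))
  have hdO : F x - F' x ∈ O := by
    have : d ∈ ((↑) : Λ → ℝ) ⁻¹' O := by rw [hOd]; rfl
    exact this
  refine ⟨d, ?_⟩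
  filter_upwards [hmem, (hF.sub hF').eventually (hO.mem_nhds hdO)] with y hy hyO
  have h1 : (⟨F y - F' y, hy⟩ : Λ) ∈ ((↑) : Λ → ℝ) ⁻¹' O := hyO
  rw [hOd, mem_singleton_iff] at h1
  have h2 : F y - F' y = d := congrArg Subtype.val h1
  linarith

end cochain

end

theorem proposition3
    {E : Type*} [AddCommGroup E] [Module ℝ E] [UniformSpace E] [FrechetSpace E]
    {G : Type*} [Group G] [TopologicalSpace G] [T2Space G] [ChartedSpace E G]
    [FrechetLieGroup E G]
    (exp : E → G) (hexp : IsExpMap exp)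
    (φ : OpenPartialHomeomorph G E) (hφ : IsConvexChart φ)
    (q : ℕ) (U : Set G) (hU : IsFillingNhd φ q U)
    (i : ℕ) (hi : i ≤ q)
    (ω : FormField E G i) (hsmooth : ω.IsSmooth) (hinv : ω.IsLeftInvariant)
    (hclosed : ω.IsClosed) :
    -- real coefficients
    (∀ f : (Fin (i + 1) → G) → ℝ,
      (∀ g : smallTuples U i, f g = fillingCochain φ U ω g) →
        IsLocallySmooth E f ∧
          ∀ X : Fin i → E, ω 1 X = (i.factorial : ℝ) * differentiation exp f X) ∧
    -- coefficients in `ℝ/Λ`, for example `Λ = ℤ`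
    (∀ Λ : AddSubgroup ℝ, DiscreteTopology Λ → 1 ≤ i →
      ∀ f : (Fin (i + 1) → G) → ℝ ⧸ Λ,
        (∀ g : smallTuples U i, f g = (fillingCochain φ U ω g : ℝ ⧸ Λ)) →
          (∃ F, IsSmoothLift E f F) ∧
            ∀ F, IsSmoothLift E f F →
              ∀ X : Fin i → E, ω 1 X = (i.factorial : ℝ) * differentiation exp F X) := by
  have hsm : ∀ f : (Fin (i + 1) → G) → ℝ,
      (∀ g : smallTuples U i, f g = fillingCochain φ U ω g) → IsLocallySmooth E f := fun f hf =>
    isLocallySmooth_of_eventuallyEq hφ (smoothAt_integralInChart hφ hsmooth)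
      (eventually_eq_integralInChart hφ hU.mem_nhds hf)
  refine ⟨fun f hf => ⟨hsm f hf, fun X => differentiation_eq X fun X =>
    (iteratedDirDeriv_eq hexp hφ hsmooth
      (eventually_eq_integralInChart hφ hU.mem_nhds hf) X).2⟩, ?_⟩
  intro Λ hΛ hi1 f hf
  classical
  -- the extension of the filling cochain by zero is a lift
  let F₀ : (Fin (i + 1) → G) → ℝ := fun g =>
    if hg : g ∈ smallTuples U i then fillingCochain φ U ω ⟨g, hg⟩ else 0
  have hF₀ : ∀ g : smallTuples U i, F₀ g = fillingCochain φ U ω g := fun g => dif_pos g.2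
  have hlift : IsSmoothLift E f F₀ := by
    refine ⟨hsm F₀ hF₀, ?_⟩
    filter_upwards [eventually_mem_smallTuples E hU.mem_nhds i] with g hg
    rw [hf ⟨g, hg⟩, ← hF₀ ⟨g, hg⟩]
  refine ⟨⟨F₀, hlift⟩, fun F hF X => differentiation_eq X fun X => ?_⟩
  obtain ⟨d, hd⟩ := exists_eventually_eq_add (Λ := Λ) hF.1.continuousAt hlift.1.continuousAt
    (by filter_upwards [hF.2, hlift.2] with g h1 h2; rw [← h1, ← h2])
  obtain ⟨hC, hval⟩ := iteratedDirDeriv_eq hexp hφ hsmooth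
    (eventually_eq_integralInChart hφ hU.mem_nhds hF₀) X
  rw [← hval, iteratedDirDeriv, iteratedDirDeriv]
  have hev : (fun t : Fin i → ℝ => cochainInExp exp F fun k => t k • X k) =ᶠ[𝓝 0]
      fun t => cochainInExp exp F₀ (fun k => t k • X k) + d :=
    (hexp.tendsto_partialProd hφ X).eventually hd
  rw [(hev.iteratedFDeriv (𝕜 := ℝ) i).self_of_nhds,
    fun_iteratedFDeriv_add_apply (hC i) contDiffAt_const,
    iteratedFDeriv_const_of_ne (by omega)]
  simp
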